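/- **Setting.** For a graph $H$ write $m_H$ for its number of edges, $\mathrm d_H(v)$ for the degree of a vertex $v$, $\Delta_H$ for its maximum degree, $w_H(uv)=\min\{\mathrm d_H(u),\mathrm d_H(v)\}$ for the weight of an edge and $W_H=\sum_{e\in E(H)}w_H(e)$ for its weight. A partial $k$-coloring assigns colors from a palette of $k$ colors to some of the edges, and $M(v)$ is the set of the palette colors that no edge at $v$ has. *Color-One-Edge* (for a partial $(\Delta_H+1)$-coloring $\chi$ of $H$): choose a uniformly random uncolored edge $uv$, named so that $\mathrm d_H(u)\le \mathrm d_H(v)$. Build a fan with center $u$ and leaves $x_0=v,x_1,\dots,x_t$: pick any $c_1\in M(x_t)$; stop if $c_1\in M(u)$ or if the edge of color $c_1$ at $u$ leads to a vertex that is already in the fan, and otherwise append the other end of that edge to the fan. Choose a uniformly random $c_0\in M(u)$; if $\mathrm d_H(u)>\Delta_H/2$, this is done by listing $M(u)$, and otherwise by sampling from the whole palette until a color of $M(u)$ is hit. Follow the maximal path $P$ from $u$ whose edges alternate between the colors $c_1$ and $c_0$. If $c_1\in M(u)$, shift the fan from $x_t$ (the edge $ux_{i-1}$ gets the color of $ux_i$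 for $1\le i\le t$) and give $ux_t$ the color $c_1$. Otherwise let $x_j$ be the leaf with $\chi(ux_j)=c_1$, exchange the colors $c_0,c_1$ along $P$, then shift the fan from $x_{j-1}$ and give $ux_{j-1}$ the color $c_1$, unless $P$ ends in $x_{j-1}$, in which case shift from $x_t$ and give $ux_t$ the color $c_1$. *Color-Edges*: repeat Color-One-Edge until all edges are colored. *Recursive-Color-Edges*, run on an $n$-vertex graph $G$, does the following on each subgraph $H$ that it reaches, starting with $H=G$ (here $n$ is always the number of vertices of $G$). If $\Delta_H\le 2\sqrt{n/\log n}$, apply Color-Edges to the empty $(\Delta_H+1)$-coloring of $H$. Otherwise: 1. (Partition) split the edges of $H$ into two subgraphs $H_1,H_2$ by an Euler partition, i.e. remove maximal tours until no edge is left and put the edges of each tour alternately into $H_1$ and $H_2$; 2. (Recurse) color $H_1$ and $H_2$ recursively, with $\Delta_{H_1}+1$ and $\Delta_{H_2}+1$ colors, and merge the two colorings, with disjoint palettes, into a coloring of $H$; 3. (Prune) while the palette has more than $\Delta_H+1$ colors, uncolor a color class of minimum weight (the sum of $w_H$ over its edges) and remove its color from the palette; 4. (Repair) apply Color-Edges to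 $H$ and the resulting partial coloring. The recursion tree has $G$ at level $L_0$, and the children of a subgraph $H$ at level $L_i$ are the subgraphs $H_1,H_2$ at level $L_{i+1}$. Time is counted in elementary steps on a word RAM with words of $\Theta(\log n)$ bits; reading or writing an entry of a table, picking an arbitrary missing color of a vertex, and sampling a uniformly random color of a palette or a uniformly random uncolored edge each take one step. The time spent on $H$ consists of all steps that the call on $H$ makes itself (finding the degrees, Partition, creating and merging colorings, Prune, Repair, or, at the bottom of the recursion, Color-Edges on the empty coloring), without the steps spent inside its recursive calls. **Lemma.** There is an absolute constant $C>0$ such that for every $n$-vertex graph $G$, every level $L_i$ and every subgraph $H$ of $G$ at level $L_i$ of the recursion tree of Recursive-Color-Edges on $G$ with $m_H\ge 1$, the expected time spent on $H$ in the call of Recursive-Color-Edges on $G$ is at most $$C\left(m_H+\frac{W_H}{\Delta_H}\left(\frac{n}{\Delta_H}+\log n\right)\right).$$ This holds for whichever way the arbitrary choices of missing colors are made. Logarithms are to base $2$. -/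

import Mathlib

open scoped ENNReal

/-! ## Randomized programs with a step count

A program is built from elementary steps (`tick`), uniform sampling, arbitrary choice and loops.
Each `tick` carries a label, which says to which node of the recursion tree the step belongs.
One `tick` stands for a constant number of word-RAM instructions. -/

inductive Prog : Type → Type 1
  /-- Return a value. -/
  | ret {α : Type} (a : α) : Prog α
  /-- Run `p`, then continue with its result. -/
  | bind {α β : Type} (p : Prog β) (k : β → Prog α) : Prog α
  /-- One elementary step, spent on behalf of the recursion node `node`. -/
  | tick (node : List Bool) : Prog Unit
  /-- A uniformly random entry of the list, independent of everything before. -/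
  | unif {α : Type} (l : List α) : Prog α
  /-- An arbitrary entry of the list ("pick any"); the entry may be chosen by an adversary who
  knows the whole past of the execution. -/
  | choose {α : Type} (l : List α) : Prog α
  /-- Iterate `body` from the state `s`; `Sum.inl s'` continues with `s'`, `Sum.inr a` leaves the
  loop with result `a`. -/
  | loop {σ α : Type} (body : σ → Prog (σ ⊕ α)) (s : σ) : Prog α

instance : Monad Prog where
  pure := Prog.ret
  bind := fun p k => Prog.bind p k

/-- `Prog.cost w p f` is the expected total cost of running `p`, where a step with label `node`
costs `w node` and a run that ends with the value `a` costs a further `f a`.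
Arbitrary choices are resolved in the worst possible way. The cost of a loop is the least solution
of the equations that one gets by unrolling it once. A program that samples from, or picks from,
an empty list is stuck, and has infinite cost. -/
noncomputable def Prog.cost (w : List Bool → ℝ≥0∞) :
    {α : Type} → Prog α → (α → ℝ≥0∞) → ℝ≥0∞
  | _, .ret a, f => f a
  | _, .bind p k, f => Prog.cost w p (fun b => Prog.cost w (k b) f)
  | _, .tick node, f => w node + f ()
  | _, .unif l, f => if l.isEmpty then ⊤ else (l.map f).sum / (l.length : ℝ≥0∞)
  | _, .choose l, f => if l.isEmpty then ⊤ else ⨆ a ∈ l, f a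
  | _, .loop (σ := σ) body s, f =>
      sInf {X : σ → ℝ≥0∞ | ∀ t, Prog.cost w (body t) (Sum.elim X f) ≤ X t} s

namespace EdgeColor

open Prog

/-- `k` elementary steps. -/
def ticks (node : List Bool) : ℕ → Prog Unit
  | 0 => ret ()
  | k + 1 => do
      tick node
      ticks node k

/-- Scan a list from left to right, with one elementary step for each entry, updating an
accumulator. In every use below `g` is an update that takes constant time. -/
def scan {σ ε : Type} (node : List Bool) (g : σ → ε → σ) : List ε → σ → Prog σ
  | [], s => ret s
  | x :: xs, s => do
      tick node
      scan node g xs (g s x)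

/-- One pass over a list, with a constant amount of work for each entry. -/
def pass {ε : Type} (node : List Bool) (l : List ε) : Prog Unit :=
  scan node (fun u _ => u) l ()

/-! ## Graphs and colorings -/

/-- Graphs are given to the algorithm as lists of edges. -/
abbrev Edges (n : ℕ) := List (Fin n × Fin n)

/-- `E` lists every edge of `G` exactly once, in any order and with any orientation. -/
structure Lists {n : ℕ} (E : Edges n) (G : SimpleGraph (Fin n)) : Prop where
  mem_iff : ∀ u v, G.Adj u v ↔ (u, v) ∈ E ∨ (v, u) ∈ E
  nodup : (E.map (fun e => s(e.1, e.2))).Nodup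

/-- The graph with vertex set `Fin n` and edges `E`. -/
def toGraph {n : ℕ} (E : Edges n) : SimpleGraph (Fin n) :=
  SimpleGraph.fromEdgeSet {e | e ∈ E.map (fun p => s(p.1, p.2))}

/-- The number of edges. -/
noncomputable def numEdges {n : ℕ} (H : SimpleGraph (Fin n)) : ℕ := H.edgeSet.ncard

open Classical in
/-- The maximum degree. -/
noncomputable def maxDegree {n : ℕ} (H : SimpleGraph (Fin n)) : ℕ := H.maxDegree

open Classical in
/-- The weight of an edge: the minimum of the degrees of its endpoints. -/
noncomputable def edgeWeight {n : ℕ} (H : SimpleGraph (Fin n)) : Sym2 (Fin n) → ℕ :=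
  Sym2.lift ⟨fun u v => min (H.degree u) (H.degree v), fun _ _ => min_comm _ _⟩

open Classical in
/-- The weight of a graph: the sum of the weights of its edges. -/
noncomputable def weight {n : ℕ} (H : SimpleGraph (Fin n)) : ℕ :=
  ∑ e ∈ H.edgeFinset, edgeWeight H e

/-- A partial coloring; `none` means uncolored. The palette of a partial `K`-coloring is
`{0, …, K - 1}`. -/
abbrev Coloring (n : ℕ) := Sym2 (Fin n) → Option ℕ

/-- The entry for the color `c` in the table of the vertex `v`: the other endpoint of the edge of
color `c` at `v`, if there is one; `none` says that `c` is missing at `v`. Reading or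
writing a table entry is one step. -/
def nbr {n : ℕ} (χ : Coloring n) (v : Fin n) (c : ℕ) : Option (Fin n) :=
  (List.finRange n).find? (fun x => χ s(v, x) = some c)

/-- The set `M(v)` of the colors of the palette that are missing at `v`. -/
def missing {n : ℕ} (χ : Coloring n) (K : ℕ) (v : Fin n) : List ℕ :=
  (List.range K).filter (fun c => nbr χ v c = none)

/-- The uncolored edges. -/
def uncolored {n : ℕ} (E : Edges n) (χ : Coloring n) : Edges n :=
  E.filter (fun e => χ s(e.1, e.2) = none)

/-- The degrees of all vertices, computed by counting edges. -/
def computeDegrees {n : ℕ} (node : List Bool) (E : Edges n) : Prog (Fin n → ℕ) :=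
  scan node (fun d e => fun x => d x + (if x = e.1 then 1 else 0) + (if x = e.2 then 1 else 0))
    E (fun _ => 0)

/-- The maximum degree, computed from the degrees of the endpoints of the edges. -/
def computeMaxDegree {n : ℕ} (node : List Bool) (E : Edges n) (d : Fin n → ℕ) : Prog ℕ :=
  scan node (fun b e => max b (max (d e.1) (d e.2))) E 0

/-- The empty coloring of the edges `E`. -/
def emptyColoring {n : ℕ} (node : List Bool) (E : Edges n) : Prog (Coloring n) :=
  scan node (fun χ e => Function.update χ s(e.1, e.2) none) E (fun _ => none)

/-! ## Coloring one edge -/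

/-- `Make-Primed-Fan`: grow a fan with center `u` from the uncolored edge `(u, v)`. The result is
the list of leaves `x₀, …, x_t` and a color by which the fan is primed. The state of the
loop is the list of leaves and the last leaf. Tables are read, and membership in the fan is
tested, in one step. -/
def makePrimedFan {n : ℕ} (node : List Bool) (χ : Coloring n) (K : ℕ) (u v : Fin n) :
    Prog (List (Fin n) × ℕ) :=
  loop (fun (S : List (Fin n) × Fin n) => do
    tick node
    let c₁ ← choose (missing χ K S.2)
    tick node
    match nbr χ u c₁ with
    | none => ret (Sum.inr (S.1, c₁))
    | some y => do
        tick node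
        if y ∈ S.1 then ret (Sum.inr (S.1, c₁))
        else ret (Sum.inl (S.1 ++ [y], y))) ([v], v)

/-- A uniformly random color of the palette `{0, …, Δ}` that is missing at `u`, where `u` has degree
`du`. If `du > Δ/2`, the missing colors are collected by a scan of the palette; otherwise one
samples from the palette until the sample is missing at `u`. -/
def randomMissing {n : ℕ} (node : List Bool) (χ : Coloring n) (Δ du : ℕ) (u : Fin n) : Prog ℕ :=
  if Δ < 2 * du then do
    let A ← scan node (fun (A : List ℕ) c => if nbr χ u c = none then c :: A else A)
      (List.range (Δ + 1)) []
    tick node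
    unif A
  else
    loop (fun (_ : Unit) => do
      tick node
      let c ← unif (List.range (Δ + 1))
      tick node
      if nbr χ u c = none then ret (Sum.inr c) else ret (Sum.inl ())) ()

/-- Follow the maximal path that starts at `u`, has a first edge of color `c₁`, and alternates
between the colors `c₁` and `c₀`. The result is the list of the edges of the path with their
colors, and the last vertex. -/
def alternatingPath {n : ℕ} (node : List Bool) (χ : Coloring n) (u : Fin n) (c₀ c₁ : ℕ) :
    Prog (List (Sym2 (Fin n) × ℕ) × Fin n) :=
  loop (fun (S : List (Sym2 (Fin n) × ℕ) × Fin n × ℕ) => do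
    tick node
    match nbr χ S.2.1 S.2.2 with
    | none => ret (Sum.inr (S.1, S.2.1))
    | some y => ret (Sum.inl (S.1 ++ [(s(S.2.1, y), S.2.2)], y, if S.2.2 = c₁ then c₀ else c₁)))
    ([], u, c₁)

/-- Exchange the colors `c₀` and `c₁` on the edges of an alternating path. -/
def flipPath {n : ℕ} (node : List Bool) (c₀ c₁ : ℕ) (P : List (Sym2 (Fin n) × ℕ))
    (χ : Coloring n) : Prog (Coloring n) :=
  scan node (fun χ p => Function.update χ p.1 (some (if p.2 = c₁ then c₀ else c₁))) P χ

/-- Shift the fan with center `u` and the given leaves from its last leaf, and give the edge to the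
last leaf (which the shift leaves without a color) the color `c`. -/
def shiftAndColor {n : ℕ} (node : List Bool) (u : Fin n) (c : ℕ) :
    List (Fin n) → Coloring n → Prog (Coloring n)
  | [], χ => ret χ
  | [x], χ => do
      tick node
      ret (Function.update χ s(u, x) (some c))
  | x :: y :: F, χ => do
      tick node
      shiftAndColor node u c (y :: F) (Function.update χ s(u, x) (χ s(u, y)))

/-- `Extend-Coloring`, for a fan with center `u` and leaves `F`, primed by `c₁`, and the
`(c₀, c₁)`-alternating path `P` from `u` to `x`. In the second case `y` is the leaf whose edge has the
color `c₁`, and `F'` is the part of the fan before `y`. -/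
def extendColoring {n : ℕ} (node : List Bool) (χ : Coloring n) (u : Fin n) (F : List (Fin n))
    (c₀ c₁ : ℕ) (P : List (Sym2 (Fin n) × ℕ)) (x : Fin n) : Prog (Coloring n) := do
  tick node
  match nbr χ u c₁ with
  | none => shiftAndColor node u c₁ F χ
  | some y => do
      pass node F
      let F' := F.takeWhile (fun z => z ≠ y)
      let χ' ← flipPath node c₀ c₁ P χ
      tick node
      if F'.getLast? = some x then shiftAndColor node u c₁ F χ'
      else shiftAndColor node u c₁ F' χ'

/-- `Color-One-Edge`, on the graph with edges `E`, degrees `d` and maximum degree `Δ`. -/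
def colorOneEdge {n : ℕ} (node : List Bool) (E : Edges n) (d : Fin n → ℕ) (Δ : ℕ)
    (χ : Coloring n) : Prog (Coloring n) := do
  tick node
  let e ← unif (uncolored E χ)
  tick node
  let u := if d e.1 ≤ d e.2 then e.1 else e.2
  let v := if d e.1 ≤ d e.2 then e.2 else e.1
  let (F, c₁) ← makePrimedFan node χ (Δ + 1) u v
  let c₀ ← randomMissing node χ Δ (d u) u
  let (P, x) ← alternatingPath node χ u c₀ c₁
  extendColoring node χ u F c₀ c₁ P x

/-- `Color-Edges`: call `Color-One-Edge` while there are uncolored edges. The initial pass enters the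
edges in the tables of their endpoints and in the array of the uncolored edges. -/
def colorEdges {n : ℕ} (node : List Bool) (E : Edges n) (d : Fin n → ℕ) (Δ : ℕ)
    (χ : Coloring n) : Prog (Coloring n) := do
  pass node E
  loop (fun (χ : Coloring n) => do
    tick node
    if uncolored E χ = [] then ret (Sum.inr χ)
    else do
      let χ' ← colorOneEdge node E d Δ χ
      ret (Sum.inl χ')) χ

/-! ## Euler partition -/

/-- The state of the Euler partition: the part of the adjacency lists that has not been looked at,
and the side (`false` or `true`) of each edge that already lies on a tour. -/
structure TourState (n : ℕ) where
  adj : Fin n → List (Fin n)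
  side : Sym2 (Fin n) → Option Bool

/-- Extend a tour from its end `x` until no unused edge is left there, putting the edges alternately
on the two sides, beginning with `b`. The second component counts the steps: one for each
entry of an adjacency list that is looked at, and one for finding a list empty. -/
def walk {n : ℕ} (S : TourState n) (x : Fin n) (b : Bool) : TourState n × ℕ :=
  match h : S.adj x with
  | [] => (S, 1)
  | y :: ys =>
      if S.side s(x, y) = none then
        let r := walk ⟨Function.update S.adj x ys,
          Function.update S.side s(x, y) (some b)⟩ y (!b)
        (r.1, r.2 + 1)
      else
        let r := walk ⟨Function.update S.adj x ys, S.side⟩ x b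
        (r.1, r.2 + 1)
termination_by ∑ v, (S.adj v).length
decreasing_by
  all_goals
    refine Finset.sum_lt_sum (fun v _ => ?_) ⟨x, Finset.mem_univ _, ?_⟩
    · by_cases hv : v = x
      · subst hv; simp [h]
      · simp [hv]
    · simp [h]

/-- Remove maximal tours until no edges remain: every edge that is still unused is put on the side
`false` and extended at both of its ends to a maximal tour. The second component counts steps. -/
def tours {n : ℕ} : Edges n → TourState n → TourState n × ℕ
  | [], S => (S, 0)
  | e :: es, S =>
      if S.side s(e.1, e.2) = none then
        let S₀ : TourState n := ⟨S.adj, Function.update S.side s(e.1, e.2) (some false)⟩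
        let r₁ := walk S₀ e.2 true
        let r₂ := walk r₁.1 e.1 true
        let r := tours es r₂.1
        (r.1, r.2 + r₂.2 + r₁.2 + 1)
      else
        let r := tours es S
        (r.1, r.2 + 1)

/-- The adjacency lists of the graph with edges `E`. -/
def adjacency {n : ℕ} (E : Edges n) : Fin n → List (Fin n) :=
  E.foldl (fun A e =>
    let A' := Function.update A e.1 (e.2 :: A e.1)
    Function.update A' e.2 (e.1 :: A' e.2)) (fun _ => [])

/-- The tours of the graph with edges `E`, with the number of steps for computing them. -/
def allTours {n : ℕ} (E : Edges n) : TourState n × ℕ :=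
  tours E ⟨adjacency E, fun _ => none⟩

/-- One of the two subgraphs of the Euler partition. -/
def part {n : ℕ} (E : Edges n) (b : Bool) : Edges n :=
  E.filter (fun e => (allTours E).1.side s(e.1, e.2) = some b)

/-- The number of steps of the Euler partition: one pass over the edges for the adjacency lists, the
steps for the tours, and one pass for separating the two sides. -/
def partitionSteps {n : ℕ} (E : Edges n) : ℕ :=
  E.length + (allTours E).2 + E.length

/-! ## The recursive algorithm -/

/-- Combine colorings of two edge-disjoint graphs, where the palette of the second one is moved
behind the palette, of size `K₁`, of the first one. -/
def merge {n : ℕ} (node : List Bool) (E₁ E₂ : Edges n) (χ₁ χ₂ : Coloring n) (K₁ : ℕ) :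
    Prog (Coloring n) := do
  let χ ← emptyColoring node (E₁ ++ E₂)
  let χ ← scan node (fun χ e => Function.update χ s(e.1, e.2) (χ₁ s(e.1, e.2))) E₁ χ
  scan node (fun χ e => Function.update χ s(e.1, e.2) ((χ₂ s(e.1, e.2)).map (fun c => K₁ + c))) E₂ χ

/-- The weights of the color classes. -/
def classWeights {n : ℕ} (node : List Bool) (E : Edges n) (d : Fin n → ℕ) (χ : Coloring n) :
    Prog (ℕ → ℕ) :=
  scan node (fun W e =>
    match χ s(e.1, e.2) with
    | none => W
    | some c => Function.update W c (W c + min (d e.1) (d e.2))) E (fun _ => 0)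

/-- The `Prune` phase: while the palette `{0, …, K - 1}` has more than `Δ + 1` colors, uncolor a color
class `c` of minimum weight and remove `c` from the palette (the last color `K - 1` gets the
name `c`). -/
def prune {n : ℕ} (node : List Bool) (E : Edges n) (d : Fin n → ℕ) (Δ : ℕ) (K : ℕ)
    (χ : Coloring n) : Prog (Coloring n) :=
  loop (fun (S : ℕ × Coloring n) => do
    tick node
    if S.1 ≤ Δ + 1 then ret (Sum.inr S.2)
    else do
      let W ← classWeights node E d S.2
      let c ← scan node (fun c c' => if W c' < W c then c' else c) (List.range S.1) 0
      let χ' ← scan node (fun χ e =>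
        if χ s(e.1, e.2) = some c then Function.update χ s(e.1, e.2) none
        else if χ s(e.1, e.2) = some (S.1 - 1) then Function.update χ s(e.1, e.2) (some c)
        else χ) E S.2
      ret (Sum.inl (S.1 - 1, χ'))) (K, χ)

/-- The condition `Δ ≤ 2 √(n / log n)` under which the recursion stops. -/
def IsSmall (n Δ : ℕ) : Prop := (Δ : ℝ) ≤ 2 * Real.sqrt (n / Real.logb 2 n)

open Classical in
/-- `Recursive-Color-Edges` on the subgraph with edges `E` at the position `node` of the recursion
tree. The result is a coloring and the size `Δ + 1` of its palette. The number `n` is the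
number of vertices of the input graph throughout the recursion. The first argument bounds
the depth of the recursion; when it is at least the maximum degree of `E`, the bound is
never the reason why the recursion stops, as the maximum degree decreases at every level. -/
noncomputable def recursiveColorEdges {n : ℕ} :
    ℕ → List Bool → Edges n → Prog (Coloring n × ℕ)
  | 0, node, E => do
      let d ← computeDegrees node E
      let Δ ← computeMaxDegree node E d
      let χ ← emptyColoring node E
      let χ ← colorEdges node E d Δ χ
      ret (χ, Δ + 1)
  | depth + 1, node, E => do
      let d ← computeDegrees node E
      let Δ ← computeMaxDegree node E d
      tick node
      if IsSmall n Δ then do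
        let χ ← emptyColoring node E
        let χ ← colorEdges node E d Δ χ
        ret (χ, Δ + 1)
      else do
        ticks node (partitionSteps E)
        let (χ₁, K₁) ← recursiveColorEdges depth (node ++ [false]) (part E false)
        let (χ₂, K₂) ← recursiveColorEdges depth (node ++ [true]) (part E true)
        let χ ← merge node (part E false) (part E true) χ₁ χ₂ K₁
        let χ ← prune node E d Δ (K₁ + K₂) χ
        let χ ← colorEdges node E d Δ χ
        ret (χ, Δ + 1)

/-- `AtNode E node F`: in the recursion tree of `Recursive-Color-Edges` on the graph with edges `E`,
the subgraph at the position `node` (a node of the level `node.length`) has the edges `F`. The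
two children of a node are reached by `false` and `true`. -/
inductive AtNode {n : ℕ} (E : Edges n) : List Bool → Edges n → Prop
  | root : AtNode E [] E
  | child {node : List Bool} {F : Edges n} (b : Bool) :
      AtNode E node F → ¬ IsSmall n (maxDegree (toGraph F)) → AtNode E (node ++ [b]) (part F b)

/-- The expected number of steps that the call of `Recursive-Color-Edges` on the graph with edges `E`
spends on the subgraph at the position `node`, not counting the steps spent on subgraphs at
other positions. -/
noncomputable def expectedTimeAt {n : ℕ} (E : Edges n) (node : List Bool) : ℝ≥0∞ :=
  (recursiveColorEdges n [] E).cost (fun ν => if ν = node then 1 else 0) (fun _ => 0)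

end EdgeColor

/-!
The cost of a program is a worst-case expectation: arbitrary choices are resolved by a supremum, and
a choice from an empty list costs `⊤`. A bound on the cost therefore includes a proof that the
algorithm never gets stuck. Its correctness is carried through the cost calculus by bounds of the
form `p.cost w f ≤ T * w node + ⨆ (a satisfying Q), f a` (`Within`), and the supremum over the
outcomes of each phase is fed into the next phase.

*One edge.* A fan has at most `deg u` leaves, where `u` is the endpoint of smaller degree, so all
steps of Color-One-Edge other than walking along the alternating path take time linear in `w(uv)`.
This includes sampling a color `c₀`, because more than half of the palette is missing at a vertex of
degree at most `Δ / 2`. That the shifted coloring is proper again is Vizing's argument.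

*Alternating paths.* The expected length of the path is averaged over the random uncolored edge and
the random color `c₀`. An alternating path that passes an edge `xy` in its interior, in the direction
from `x` to `y`, has an edge of its second color at both ends of `xy`, which leaves at most `w(xy)`
possibilities for this color. The directed edge and the color determine the path, because one step
along a path is an injective partial map and `c₀` is missing at the start, so that different paths are
disjoint orbits. Hence the numbers of interior edges, summed over all starts and all pairs of colors,
add up to at most `2 W` (`sum_pathLen_le`). With `l` uncolored edges left, of which at most `ρ` times
the number of missing colors lie at any vertex, the expected length is therefore of order
`1 + ρ W / l`, and summing over `l` gives a harmonic number. Vertices of degree larger than `Δ / 2`,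
which have possibly only few missing colors, are *heavy*: for them the length is bounded by a multiple
of `n`, and an edge whose center is heavy has weight larger than `Δ / 2`, so that these edges contribute
at most a multiple of `n / Δ` times the weight of the uncolored edges. The outcome is
`colorEdges_cost_le`.

*An inner node.* The Euler partition is balanced at every vertex (`two_mul_maxDeg_part_le`), so the
merged coloring has at most `Δ + 4` colors and Prune discards at most three classes. Each of them is
a matching, so at most three edges at each vertex get uncolored, and by minimality their total
weight is at most `3 W / (Δ + 1)` (`prune_within`). With `ρ` of order `1 / Δ`, Repair takes time
of the order of `m + (W / Δ) (n / Δ + log n)` (`repair_cost_le`).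

*The bottom.* From the empty coloring there are never more uncolored edges than missing colors at a
vertex. With `ρ = 1` Color-Edges takes time of order `W log n`, and `Δ ≤ 2 √(n / log n)` gives
`log n ≤ 4 n / Δ²` (`bottom_cost_le`).

*The recursion.* Only the steps of one node of the tree are counted, and that node lies below at most
one child of each of its ancestors, so induction on the depth yields the bound for this node alone
(`recursiveColorEdges_cost_le`).
-/

namespace EdgeColor

open Prog

/-! ### Bounding the cost of programs -/

section Cost

variable {w : List Bool → ℝ≥0∞} {α β σ ε : Type} {node : List Bool}

@[simp] theorem cost_ret (a : α) (f : α → ℝ≥0∞) : (ret a).cost w f = f a := rfl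

@[simp] theorem cost_bind (p : Prog β) (k : β → Prog α) (f : α → ℝ≥0∞) :
    (p >>= k).cost w f = p.cost w (fun b => (k b).cost w f) := rfl

@[simp] theorem cost_tick (f : Unit → ℝ≥0∞) : (tick node).cost w f = w node + f () := rfl

theorem cost_unif (l : List α) (h : l ≠ []) (f : α → ℝ≥0∞) :
    (unif l).cost w f = (l.map f).sum / (l.length : ℝ≥0∞) := by
  change (if l.isEmpty then ⊤ else (l.map f).sum / (l.length : ℝ≥0∞)) = _
  rw [if_neg (by simpa using h)]

theorem cost_choose (l : List α) (h : l ≠ []) (f : α → ℝ≥0∞) :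
    (choose l).cost w f = ⨆ a ∈ l, f a := by
  change (if l.isEmpty then ⊤ else ⨆ a ∈ l, f a) = _
  rw [if_neg (by simpa using h)]

/-- A function that does not increase in expectation along one iteration bounds the cost of a
loop. -/
theorem cost_loop_le (body : σ → Prog (σ ⊕ α)) (f : α → ℝ≥0∞) (X : σ → ℝ≥0∞)
    (hX : ∀ t, (body t).cost w (Sum.elim X f) ≤ X t) (s : σ) :
    (loop body s).cost w f ≤ X s := by
  change sInf {X : σ → ℝ≥0∞ | ∀ t, Prog.cost w (body t) (Sum.elim X f) ≤ X t} s ≤ X s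
  exact (sInf_le (show X ∈ {X : σ → ℝ≥0∞ | ∀ t, Prog.cost w (body t) (Sum.elim X f) ≤ X t} from
    hX)) s

theorem cost_ticks (k : ℕ) (f : Unit → ℝ≥0∞) :
    (ticks node k).cost w f = k * w node + f () := by
  induction k with
  | zero => simp [ticks]
  | succ k ih => simp [ticks, ih]; ring

theorem cost_scan (g : σ → ε → σ) (l : List ε) (s : σ) (f : σ → ℝ≥0∞) :
    (scan node g l s).cost w f = l.length * w node + f (l.foldl g s) := by
  induction l generalizing s with
  | nil => simp [scan]
  | cons x l ih => simp [scan, ih]; ring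

theorem cost_pass (l : List ε) (f : Unit → ℝ≥0∞) :
    (pass node l).cost w f = l.length * w node + f () := by
  simp [pass, cost_scan]

/-- Every run of `p` takes at most `T` steps, all of them at `node`, and ends with a result that
satisfies `Q`; in particular, no run of `p` gets stuck. -/
def Within (w : List Bool → ℝ≥0∞) (node : List Bool) (p : Prog α) (T : ℕ) (Q : α → Prop) : Prop :=
  ∀ f, p.cost w f ≤ T * w node + ⨆ a, ⨆ (_ : Q a), f a

theorem Within.ret {a : α} {T : ℕ} {Q : α → Prop} (h : Q a) : Within w node (ret a) T Q := fun _ =>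
  le_add_left (le_iSup₂_of_le a h le_rfl)

theorem Within.mono {p : Prog α} {T T' : ℕ} {Q Q' : α → Prop} (h : Within w node p T Q)
    (hT : T ≤ T') (hQ : ∀ a, Q a → Q' a) : Within w node p T' Q' := fun f =>
  (h f).trans (add_le_add (by gcongr) (iSup₂_le fun a ha => le_iSup₂_of_le a (hQ a ha) le_rfl))

theorem Within.bind {p : Prog β} {k : β → Prog α} {T T' : ℕ} {Q : β → Prop} {Q' : α → Prop}
    (hp : Within w node p T Q) (hk : ∀ b, Q b → Within w node (k b) T' Q') :
    Within w node (p >>= k) (T + T') Q' := fun f => by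
  rw [cost_bind]
  refine (hp _).trans ?_
  push_cast
  rw [add_mul, add_assoc]
  gcongr
  exact iSup₂_le fun b hb => hk b hb f

theorem Within.tick_bind {k : Unit → Prog α} {T : ℕ} {Q : α → Prop}
    (hk : Within w node (k ()) T Q) : Within w node (tick node >>= k) (T + 1) Q := fun f => by
  rw [cost_bind, cost_tick]
  push_cast
  rw [add_mul, one_mul, add_comm _ (w node), add_assoc]
  gcongr
  exact hk f

theorem Within.choose_bind {l : List β} {k : β → Prog α} {T : ℕ} {Q : α → Prop} (hl : l ≠ [])
    (hk : ∀ b ∈ l, Within w node (k b) T Q) : Within w node (choose l >>= k) T Q := fun f => by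
  rw [cost_bind, cost_choose l hl]
  exact iSup₂_le fun b hb => hk b hb f

theorem Within.scan_bind {g : σ → ε → σ} {l : List ε} {s : σ} {k : σ → Prog α} {T : ℕ}
    {Q : α → Prop} (hk : Within w node (k (l.foldl g s)) T Q) :
    Within w node (scan node g l s >>= k) (l.length + T) Q := fun f => by
  rw [cost_bind, cost_scan]
  push_cast
  rw [add_mul, add_assoc]
  gcongr
  exact hk f

theorem Within.scan {g : σ → ε → σ} {l : List ε} {s : σ} {Q : σ → Prop}
    (hk : Q (l.foldl g s)) : Within w node (scan node g l s) l.length Q := fun f => by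
  rw [cost_scan]
  gcongr
  exact le_iSup₂_of_le (f := fun a (_ : Q a) => f a) _ hk le_rfl

/-- A loop whose iterations take at most `c` steps each, while an integer potential `T` drops by `c`
in every iteration. -/
theorem Within.loop {body : σ → Prog (σ ⊕ α)} {Q : α → Prop} (I : σ → Prop) (T : σ → ℕ) (c : ℕ)
    (hc : ∀ t, I t → c ≤ T t)
    (hbody : ∀ t, I t →
      Within w node (body t) c (Sum.elim (fun t' => I t' ∧ c + T t' ≤ T t) Q))
    {s : σ} (hs : I s) : Within w node (loop body s) (T s) Q := fun f => by
  classical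
  set S := ⨆ a, ⨆ (_ : Q a), f a with hS
  have h := cost_loop_le (w := w) body f (fun t => if I t then T t * w node + S else ⊤)
    (fun t => ?_) s
  · simpa [hs] using h
  by_cases ht : I t
  · rw [if_pos ht]
    refine (hbody t ht _).trans ?_
    obtain ⟨k, hk⟩ := Nat.exists_eq_add_of_le (hc t ht)
    rw [hk]
    push_cast
    rw [add_mul, add_assoc]
    gcongr
    refine iSup₂_le fun r hr => ?_
    rcases r with t' | a
    · obtain ⟨h1, h2⟩ := hr
      have : T t' ≤ k := by omega
      simp only [Sum.elim_inl, if_pos h1]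
      gcongr
    · exact le_add_left (le_iSup₂_of_le (f := fun a (_ : Q a) => f a) a hr le_rfl)
  · simp [ht]

end Cost

/-! ### Lists of edges -/

section EdgeLists

variable {n : ℕ} {E : Edges n}

/-- The edges of a list as unordered pairs. -/
def sym (E : Edges n) : List (Sym2 (Fin n)) := E.map fun e => s(e.1, e.2)

/-- The list describes a simple graph: there are no repetitions and no loops. -/
structure Valid (E : Edges n) : Prop where
  nodup : (sym E).Nodup
  ne : ∀ e ∈ E, e.1 ≠ e.2

/-- The degree of a vertex in the graph with edges `E`. -/
def deg (E : Edges n) (v : Fin n) : ℕ := (Finset.univ.filter fun y => s(v, y) ∈ sym E).card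

/-- The maximum degree of the graph with edges `E`. -/
def maxDeg (E : Edges n) : ℕ := Finset.univ.sup (deg E)

/-- The weight of an edge `p` in the graph with edges `E`. -/
def wt (E : Edges n) (p : Fin n × Fin n) : ℕ := min (deg E p.1) (deg E p.2)

/-- The weight of the graph with edges `E`. -/
def totalWt (E : Edges n) : ℕ := (E.map (wt E)).sum

theorem Lists.valid {G : SimpleGraph (Fin n)} (h : Lists E G) : Valid E :=
  ⟨h.nodup, fun e he => ((h.mem_iff e.1 e.2).2 (Or.inl he)).ne⟩

theorem mem_sym_of_mem {e : Fin n × Fin n} (h : e ∈ E) : s(e.1, e.2) ∈ sym E :=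
  List.mem_map_of_mem (f := fun e : Fin n × Fin n => s(e.1, e.2)) h

theorem Valid.filter (h : Valid E) (p : Fin n × Fin n → Bool) : Valid (E.filter p) :=
  ⟨h.nodup.sublist (List.filter_sublist.map _), fun e he => h.ne e (List.mem_filter.1 he).1⟩

theorem Valid.tail {e : Fin n × Fin n} (h : Valid (e :: E)) : Valid E :=
  ⟨(List.nodup_cons.1 h.nodup).2, fun e' he => h.ne e' (List.mem_cons_of_mem _ he)⟩

theorem Valid.notMem_sym_tail {e : Fin n × Fin n} (h : Valid (e :: E)) :
    s(e.1, e.2) ∉ sym E := (List.nodup_cons.1 h.nodup).1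

theorem Valid.ne_of_mem (h : Valid E) {x y : Fin n} (hxy : s(x, y) ∈ sym E) : x ≠ y := by
  rintro rfl
  obtain ⟨e, he, h'⟩ := List.mem_map.1 hxy
  have := h.ne e he
  simp only [Sym2.eq_iff] at h'
  grind

theorem mem_sym_filter {p : Sym2 (Fin n) → Bool} {e : Sym2 (Fin n)} :
    e ∈ sym (E.filter fun e => p s(e.1, e.2)) ↔ e ∈ sym E ∧ p e := by
  simp only [sym, List.mem_map, List.mem_filter]
  constructor
  · rintro ⟨a, ⟨h1, h2⟩, rfl⟩
    exact ⟨⟨a, h1, rfl⟩, h2⟩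
  · rintro ⟨⟨a, h1, rfl⟩, h2⟩
    exact ⟨a, ⟨h1, h2⟩, rfl⟩

theorem mem_sym_uncolored {χ : Coloring n} {e : Sym2 (Fin n)} :
    e ∈ sym (uncolored E χ) ↔ e ∈ sym E ∧ χ e = none := by
  have := mem_sym_filter (E := E) (p := fun e => decide (χ e = none)) (e := e)
  simpa [uncolored] using this

theorem mem_sym_part {b : Bool} {e : Sym2 (Fin n)} :
    e ∈ sym (part E b) ↔ e ∈ sym E ∧ (allTours E).1.side e = some b := by
  have := mem_sym_filter (E := E) (p := fun e => decide ((allTours E).1.side e = some b)) (e := e)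
  simpa [part] using this

theorem sum_ite_mk_eq {M : Type*} [AddCommMonoid M] {a b : Fin n} (hab : a ≠ b) (v : Fin n)
    (c : M) : ∑ y, (if s(v, y) = s(a, b) then c else 0) =
      (if v = a then c else 0) + (if v = b then c else 0) := by
  by_cases h1 : v = a
  · subst h1
    have : ∀ y, (s(v, y) = s(v, b)) ↔ y = b := fun y => Sym2.congr_right
    simp [this, hab]
  · by_cases h2 : v = b
    · subst h2
      have : ∀ y, (s(v, y) = s(a, v)) ↔ y = a := fun y => by
        rw [Sym2.eq_swap (a := a)]; exact Sym2.congr_right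
      simp [this, h1]
    · have : ∀ y, ¬ (s(v, y) = s(a, b)) := fun y => by
        simp only [Sym2.eq_iff]; tauto
      simp [this, h1, h2]

theorem sum_ite_mem_cons {M : Type*} [AddCommMonoid M] {e : Fin n × Fin n}
    (h : Valid (e :: E)) (v : Fin n) (g : Sym2 (Fin n) → M) :
    ∑ y, (if s(v, y) ∈ sym (e :: E) then g s(v, y) else 0) =
      (if v = e.1 then g s(e.1, e.2) else 0) + (if v = e.2 then g s(e.1, e.2) else 0) +
        ∑ y, (if s(v, y) ∈ sym E then g s(v, y) else 0) := by
  rw [← sum_ite_mk_eq (h.ne e List.mem_cons_self), ← Finset.sum_add_distrib]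
  refine Finset.sum_congr rfl fun y _ => ?_
  have hn := h.notMem_sym_tail
  by_cases h1 : s(v, y) = s(e.1, e.2)
  · have : s(v, y) ∈ sym (e :: E) := by rw [h1]; exact mem_sym_of_mem List.mem_cons_self
    rw [if_pos this, if_pos h1, if_neg (h1 ▸ hn), h1, add_zero]
  · have : s(v, y) ∈ sym (e :: E) ↔ s(v, y) ∈ sym E := by
      simp only [sym, List.map_cons, List.mem_cons, h1, false_or]
    simp [this, h1]

theorem deg_eq_sum (v : Fin n) : deg E v = ∑ y, (if s(v, y) ∈ sym E then 1 else 0) := by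
  rw [deg, Finset.card_filter]

theorem deg_cons {e : Fin n × Fin n} (h : Valid (e :: E)) (v : Fin n) :
    deg (e :: E) v = (if v = e.1 then 1 else 0) + (if v = e.2 then 1 else 0) + deg E v := by
  rw [deg_eq_sum, deg_eq_sum, sum_ite_mem_cons h v (fun _ => 1)]

/-- Every edge is counted from both of its ends. -/
theorem sum_darts (h : Valid E) (g : Sym2 (Fin n) → ℕ) :
    ∑ x, ∑ y, (if s(x, y) ∈ sym E then g s(x, y) else 0) =
      2 * (E.map fun e => g s(e.1, e.2)).sum := by
  induction E with
  | nil => simp [sym]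
  | cons e E ih =>
    simp only [sum_ite_mem_cons h, Finset.sum_add_distrib, ih h.tail]
    simp
    ring

theorem sum_endpoint_le (h : Valid E) (g : Fin n → ℝ≥0∞) (c : Fin n × Fin n → Fin n)
    (hc : ∀ e, c e = e.1 ∨ c e = e.2) :
    (E.map fun e => g (c e)).sum ≤ ∑ u, (deg E u : ℝ≥0∞) * g u := by
  induction E with
  | nil => simp
  | cons e E ih =>
    simp only [deg_cons h, List.map_cons, List.sum_cons, Nat.cast_add, add_mul,
      Finset.sum_add_distrib]
    refine add_le_add ?_ (ih h.tail)
    rcases hc e with h1 | h1 <;> simp [h1]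

theorem deg_mono {E' : Edges n} (h : ∀ e, e ∈ sym E → e ∈ sym E') (v : Fin n) :
    deg E v ≤ deg E' v :=
  Finset.card_le_card fun y hy => by
    simp only [Finset.mem_filter, Finset.mem_univ, true_and] at hy ⊢
    exact h _ hy

theorem deg_pos_left {e : Fin n × Fin n} (h : e ∈ E) : 0 < deg E e.1 :=
  Finset.card_pos.2 ⟨e.2, by simpa using mem_sym_of_mem h⟩

theorem deg_pos_right {e : Fin n × Fin n} (h : e ∈ E) : 0 < deg E e.2 :=
  Finset.card_pos.2 ⟨e.1, by simpa [Sym2.eq_swap] using mem_sym_of_mem h⟩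

theorem wt_pos {e : Fin n × Fin n} (h : e ∈ E) : 0 < wt E e :=
  lt_min (deg_pos_left h) (deg_pos_right h)

theorem deg_le_maxDeg (v : Fin n) : deg E v ≤ maxDeg E := Finset.le_sup (Finset.mem_univ v)

theorem deg_le_length (v : Fin n) : deg E v ≤ E.length := by
  have : deg E v ≤ (sym E).toFinset.card := by
    refine Finset.card_le_card_of_injOn (fun y => s(v, y)) (fun y hy => ?_) fun y _ y' _ h => ?_
    · simpa using hy
    · exact Sym2.congr_right.1 h
  refine this.trans ((List.toFinset_card_le _).trans ?_)
  simp [sym]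

theorem maxDeg_le_length : maxDeg E ≤ E.length := Finset.sup_le fun v _ => deg_le_length v

theorem maxDeg_le_card : maxDeg E ≤ n := by
  refine Finset.sup_le fun v _ => ?_
  exact (Finset.card_le_univ _).trans (by simp)

theorem Valid.length_le (h : Valid E) : E.length ≤ n * n := by
  have : E.Nodup := List.Nodup.of_map _ h.nodup
  rw [← List.toFinset_card_of_nodup this]
  exact (Finset.card_le_univ _).trans (by simp)

theorem maxDeg_pos (h : E ≠ []) : 0 < maxDeg E := by
  obtain ⟨e, he⟩ := List.exists_mem_of_ne_nil _ h
  exact (deg_pos_left he).trans_le (deg_le_maxDeg _)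

theorem foldl_degrees (h : Valid E) (d : Fin n → ℕ) :
    E.foldl (fun d e => fun x => d x + (if x = e.1 then 1 else 0) + (if x = e.2 then 1 else 0)) d =
      fun x => d x + deg E x := by
  induction E generalizing d with
  | nil => simp [deg, sym]
  | cons e E ih =>
    rw [List.foldl_cons, ih h.tail]
    funext x
    rw [deg_cons h]
    ring

theorem foldl_max_le_iff {ι : Type*} (g : ι → ℕ) (l : List ι) (b c : ℕ) :
    l.foldl (fun b e => max b (g e)) b ≤ c ↔ b ≤ c ∧ ∀ e ∈ l, g e ≤ c := by
  induction l generalizing b with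
  | nil => simp
  | cons x l ih => simp [ih, and_assoc]

theorem exists_edge_of_mem_sym {x y : Fin n} (h : s(x, y) ∈ sym E) :
    (x, y) ∈ E ∨ (y, x) ∈ E := by
  obtain ⟨e, he, h'⟩ := List.mem_map.1 h
  rcases Sym2.eq_iff.1 h' with ⟨rfl, rfl⟩ | ⟨rfl, rfl⟩
  · exact Or.inl he
  · exact Or.inr he

theorem foldl_maxDegree :
    E.foldl (fun b e => max b (max (deg E e.1) (deg E e.2))) 0 = maxDeg E := by
  refine le_antisymm ?_ ?_
  · rw [foldl_max_le_iff (fun e : Fin n × Fin n => max (deg E e.1) (deg E e.2))]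
    exact ⟨Nat.zero_le _, fun e _ => max_le (deg_le_maxDeg _) (deg_le_maxDeg _)⟩
  · have h := ((foldl_max_le_iff (fun e : Fin n × Fin n => max (deg E e.1) (deg E e.2)) E 0 _).1
      le_rfl).2
    refine Finset.sup_le fun v _ => ?_
    rcases Nat.eq_zero_or_pos (deg E v) with h0 | h0
    · rw [h0]; exact Nat.zero_le _
    · obtain ⟨y, hy⟩ := Finset.card_pos.1 h0
      rcases exists_edge_of_mem_sym (by simpa using hy) with h1 | h1
      · exact (le_max_left _ _).trans (h _ h1)
      · exact (le_max_right _ _).trans (h _ h1)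

theorem foldl_adjacency_length (A : Fin n → List (Fin n)) (h : Valid E) :
    ∑ v, ((E.foldl (fun A (e : Fin n × Fin n) =>
      let A' := Function.update A e.1 (e.2 :: A e.1)
      Function.update A' e.2 (e.1 :: A' e.2)) A) v).length =
      ∑ v, (A v).length + 2 * E.length := by
  have key : ∀ (A : Fin n → List (Fin n)) (x y : Fin n),
      ∑ v, (Function.update A x (y :: A x) v).length = ∑ v, (A v).length + 1 := by
    intro A x y
    have : ∀ v, (Function.update A x (y :: A x) v).length =
        (A v).length + if v = x then 1 else 0 := fun v => by
      by_cases hv : v = x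
      · subst hv; simp
      · simp [hv]
    simp [this, Finset.sum_add_distrib]
  induction E generalizing A with
  | nil => simp
  | cons e E ih =>
    rw [List.foldl_cons, ih _ h.tail, key, key, List.length_cons]
    ring

theorem mem_foldl_adjacency (A : Fin n → List (Fin n)) (x y : Fin n) :
    y ∈ (E.foldl (fun A (e : Fin n × Fin n) =>
      let A' := Function.update A e.1 (e.2 :: A e.1)
      Function.update A' e.2 (e.1 :: A' e.2)) A) x ↔ y ∈ A x ∨ s(x, y) ∈ sym E := by
  have key : ∀ (A : Fin n → List (Fin n)) (a b : Fin n),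
      y ∈ Function.update A a (b :: A a) x ↔ y ∈ A x ∨ (x = a ∧ y = b) := by
    intro A a b
    by_cases hx : x = a
    · subst hx; simp [or_comm]
    · simp [hx]
  induction E generalizing A with
  | nil => simp [sym]
  | cons e E ih =>
    rw [List.foldl_cons]
    refine (ih _).trans ?_
    rw [key, key]
    simp only [sym, List.map_cons, List.mem_cons, Sym2.eq_iff]
    tauto

theorem toGraph_adj (h : Valid E) (x y : Fin n) : (toGraph E).Adj x y ↔ s(x, y) ∈ sym E := by
  rw [toGraph, SimpleGraph.fromEdgeSet_adj]
  exact ⟨fun h' => h'.1, fun h' => ⟨h', h.ne_of_mem h'⟩⟩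

open Classical in
theorem degree_toGraph (h : Valid E) (v : Fin n) : (toGraph E).degree v = deg E v := by
  rw [← SimpleGraph.card_neighborFinset_eq_degree, deg]
  congr 1
  ext y
  simp [toGraph_adj h]

theorem maxDegree_toGraph (h : Valid E) : maxDegree (toGraph E) = maxDeg E := by
  classical
  rw [maxDegree]
  refine le_antisymm (SimpleGraph.maxDegree_le_of_forall_degree_le _ _ fun v => ?_)
    (Finset.sup_le fun v _ => ?_)
  · convert deg_le_maxDeg (E := E) v
    convert degree_toGraph h v
  · rw [← degree_toGraph h]
    exact SimpleGraph.degree_le_maxDegree _ _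

open Classical in
theorem edgeFinset_toGraph (h : Valid E) : (toGraph E).edgeFinset = (sym E).toFinset := by
  ext e
  induction e with
  | _ x y => simp [toGraph_adj h]

theorem numEdges_toGraph (h : Valid E) : numEdges (toGraph E) = E.length := by
  classical
  rw [numEdges, ← SimpleGraph.coe_edgeFinset, Set.ncard_coe_finset, edgeFinset_toGraph h,
    List.toFinset_card_of_nodup h.nodup]
  simp [sym]

theorem weight_toGraph (h : Valid E) : weight (toGraph E) = totalWt E := by
  classical
  rw [weight]
  have : (toGraph E).edgeFinset = (sym E).toFinset := edgeFinset_toGraph h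
  have h2 : ∑ e ∈ (sym E).toFinset, edgeWeight (toGraph E) e = totalWt E := by
    rw [List.sum_toFinset _ h.nodup, totalWt, sym, List.map_map]
    congr 1
    refine List.map_congr_left fun e _ => ?_
    simp [edgeWeight, wt, degree_toGraph h]
  rw [← h2]
  refine Finset.sum_congr ?_ fun _ _ => rfl
  convert this

end EdgeLists

/-! ### Proper partial colorings -/

section Colorings

variable {n : ℕ} {E : Edges n} {K : ℕ} {χ : Coloring n}

/-- `χ` is a proper partial `K`-coloring of the edges `E`. -/
structure Proper (E : Edges n) (K : ℕ) (χ : Coloring n) : Prop where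
  mem_sym : ∀ e, χ e ≠ none → e ∈ sym E
  lt : ∀ e c, χ e = some c → c < K
  inj : ∀ v x y c, χ s(v, x) = some c → χ s(v, y) = some c → x = y

/-- No edge at `v` has the color `c`. -/
def Miss (χ : Coloring n) (v : Fin n) (c : ℕ) : Prop := ∀ y, χ s(v, y) ≠ some c

theorem nbr_eq_none {v : Fin n} {c : ℕ} : nbr χ v c = none ↔ Miss χ v c := by
  simp [nbr, Miss, List.find?_eq_none]

theorem color_of_nbr {v y : Fin n} {c : ℕ} (h : nbr χ v c = some y) : χ s(v, y) = some c := by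
  simpa using List.find?_some h

theorem Proper.nbr_eq_some (h : Proper E K χ) {v y : Fin n} {c : ℕ} :
    nbr χ v c = some y ↔ χ s(v, y) = some c := by
  refine ⟨color_of_nbr, fun hy => ?_⟩
  cases h' : nbr χ v c with
  | none => exact absurd hy (nbr_eq_none.1 h' y)
  | some z => rw [h.inj v z y c (color_of_nbr h') hy]

theorem mem_missing {v : Fin n} {c : ℕ} : c ∈ missing χ K v ↔ c < K ∧ Miss χ v c := by
  simp [missing, nbr_eq_none]

theorem nodup_missing (v : Fin n) : (missing χ K v).Nodup := List.nodup_range.filter _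

theorem Proper.card_seen_le (h : Proper E K χ) (v : Fin n) :
    ((Finset.range K).filter fun c => nbr χ v c ≠ none).card + deg (uncolored E χ) v ≤
      deg E v := by
  classical
  have h3 := Finset.card_filter_add_card_filter_not
    (s := Finset.univ.filter fun y => s(v, y) ∈ sym E) (fun y => χ s(v, y) = none)
  have h4 : deg (uncolored E χ) v =
      ((Finset.univ.filter fun y => s(v, y) ∈ sym E).filter fun y => χ s(v, y) = none).card := by
    rw [deg, Finset.filter_filter]
    simp only [mem_sym_uncolored]
  have h5 : ((Finset.range K).filter fun c => nbr χ v c ≠ none).card ≤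
      ((Finset.univ.filter fun y => s(v, y) ∈ sym E).filter fun y => ¬ χ s(v, y) = none).card := by
    refine Finset.card_le_card_of_surjOn (fun y => (χ s(v, y)).getD 0) fun c hc => ?_
    simp only [Finset.coe_filter, Finset.mem_range, Set.mem_ofPred_eq] at hc
    obtain ⟨y, hy⟩ := Option.ne_none_iff_exists'.1 hc.2
    have hy' := color_of_nbr hy
    refine ⟨y, ?_, by simp [hy']⟩
    simp [hy', h.mem_sym _ (by rw [hy']; simp : χ s(v, y) ≠ none)]
  rw [h4]
  change _ = deg E v at h3
  omega

/-- An uncolored edge at `v` contributes to the number of the colors that are missing at `v`. -/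
theorem Proper.le_length_missing (h : Proper E K χ) (v : Fin n) :
    K + deg (uncolored E χ) v ≤ (missing χ K v).length + deg E v := by
  classical
  have h1 : (missing χ K v).length = ((Finset.range K).filter fun c => nbr χ v c = none).card := by
    rw [← List.toFinset_card_of_nodup (nodup_missing v)]
    congr 1
    ext c
    simp [missing]
  have h2 := Finset.card_filter_add_card_filter_not (s := Finset.range K)
    (fun c => nbr χ v c = none)
  have h3 := h.card_seen_le v
  rw [Finset.card_range] at h2
  simp only [ne_eq] at h3
  omega

theorem Proper.missing_ne_nil (h : Proper E K χ) {v : Fin n} (hK : deg E v < K) :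
    missing χ K v ≠ [] := by
  have := h.le_length_missing v
  intro h0
  rw [h0, List.length_nil] at this
  omega

theorem Proper.mono {K' : ℕ} (h : Proper E K χ) (hK : K ≤ K') : Proper E K' χ :=
  ⟨h.mem_sym, fun e c hc => (h.lt e c hc).trans_le hK, h.inj⟩

theorem Proper.uncolor (h : Proper E K χ) (e : Sym2 (Fin n)) :
    Proper E K (Function.update χ e none) := by
  have key : ∀ e' c, Function.update χ e none e' = some c → χ e' = some c := by
    intro e' c
    rw [Function.update_apply]
    split_ifs <;> simp
  refine ⟨fun e' he' => h.mem_sym e' ?_, fun e' c hc => h.lt e' c (key _ _ hc),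
    fun v x y c h1 h2 => h.inj v x y c (key _ _ h1) (key _ _ h2)⟩
  obtain ⟨c, hc⟩ := Option.ne_none_iff_exists'.1 he'
  simp [key _ _ hc]

theorem Proper.color (h : Proper E K χ) {u x : Fin n} {c : ℕ} (hx : s(u, x) ∈ sym E)
    (hc : c < K) (hu : Miss χ u c) (hxc : Miss χ x c) :
    Proper E K (Function.update χ s(u, x) (some c)) := by
  have miss : ∀ v y z, s(v, y) = s(u, x) → χ s(v, z) ≠ some c := by
    intro v y z hv
    rcases Sym2.eq_iff.1 hv with ⟨rfl, rfl⟩ | ⟨rfl, rfl⟩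
    · exact hu z
    · exact hxc z
  refine ⟨fun e he => ?_, fun e c' => ?_, fun v y z c' => ?_⟩
  · by_cases h1 : e = s(u, x)
    · rwa [h1]
    · rw [Function.update_of_ne h1] at he
      exact h.mem_sym e he
  · rw [Function.update_apply]
    split_ifs
    · rintro ⟨⟩
      exact hc
    · exact h.lt e c'
  · rw [Function.update_apply, Function.update_apply]
    split_ifs with h1 h2 h2
    · intro _ _
      exact Sym2.congr_right.1 (h1.trans h2.symm)
    · rintro ⟨⟩ h3
      exact absurd h3 (miss _ _ _ h1)
    · rintro h3 ⟨⟩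
      exact absurd h3 (miss _ _ _ h2)
    · exact h.inj v y z c'

theorem Miss.uncolor {v : Fin n} {c : ℕ} (h : Miss χ v c) (e : Sym2 (Fin n)) :
    Miss (Function.update χ e none) v c := fun y => by
  rw [Function.update_apply]
  split_ifs
  · simp
  · exact h y

theorem Miss.color {v u x : Fin n} {c c' : ℕ} (h : Miss χ v c)
    (h' : ∀ y, s(v, y) = s(u, x) → c' ≠ c) :
    Miss (Function.update χ s(u, x) (some c')) v c := fun y => by
  rw [Function.update_apply]
  split_ifs with h1
  · simpa using h' y h1
  · exact h y

/-! ### Fans -/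

/-- Consecutive leaves `x`, `y` of a fan with center `u`: the color of `uy` is missing at `x`. -/
def FanRel (χ : Coloring n) (u x y : Fin n) : Prop := ∃ a, χ s(u, y) = some a ∧ Miss χ x a

/-- `F` is a fan with center `u` and first leaf `v`. -/
structure IsFan (E : Edges n) (χ : Coloring n) (u v : Fin n) (F : List (Fin n)) : Prop where
  nodup : F.Nodup
  chain : F.IsChain (FanRel χ u)
  head : F.head? = some v
  adj : ∀ y ∈ F, s(u, y) ∈ sym E

/-- The fan `F` is primed by the color `c`: it is missing at the last leaf, and either missing at
the center or the color of an edge of the fan. -/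
structure Primed (K : ℕ) (χ : Coloring n) (u : Fin n) (F : List (Fin n)) (c : ℕ) : Prop where
  lt : c < K
  last : ∀ l, F.getLast? = some l → Miss χ l c
  closed : ∀ y, nbr χ u c = some y → y ∈ F

theorem IsFan.length_le {u v : Fin n} {F : List (Fin n)} (h : IsFan E χ u v F) :
    F.length ≤ deg E u := by
  rw [← List.toFinset_card_of_nodup h.nodup]
  exact Finset.card_le_card fun y hy => by simpa using h.adj y (by simpa using hy)

theorem makePrimedFan_within {w : List Bool → ℝ≥0∞} {node : List Bool} {u v : Fin n}
    (hχ : Proper E K χ) (hK : ∀ x, deg E x < K) (hv : s(u, v) ∈ sym E) :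
    Within w node (makePrimedFan node χ K u v) (3 * deg E u)
      (fun r => IsFan E χ u v r.1 ∧ Primed K χ u r.1 r.2) := by
  have h0 : IsFan E χ u v [v] := ⟨by simp, by simp, rfl, by simpa using hv⟩
  have hT : 3 * (deg E u + 1 - ([v], v).1.length) = 3 * deg E u := by simp
  rw [makePrimedFan, ← hT]
  refine Within.loop
    (fun S : List (Fin n) × Fin n => IsFan E χ u v S.1 ∧ S.1.getLast? = some S.2)
    (fun S : List (Fin n) × Fin n => 3 * (deg E u + 1 - S.1.length)) 3 (fun S hS => ?_)
    (fun S hS => ?_) ⟨h0, rfl⟩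
  · have := hS.1.length_le
    omega
  obtain ⟨hF, hl⟩ := hS
  refine Within.tick_bind (T := 2) (Within.choose_bind (hχ.missing_ne_nil (hK _)) fun c hc => ?_)
  rw [mem_missing] at hc
  have hlast : ∀ l, S.1.getLast? = some l → Miss χ l c := fun l hl' => by
    rw [hl] at hl'
    cases hl'
    exact hc.2
  refine Within.tick_bind (T := 1) ?_
  cases hy : nbr χ u c with
  | none => exact Within.ret ⟨hF, hc.1, hlast, by simp [hy]⟩
  | some y =>
    refine Within.tick_bind (T := 0) ?_
    by_cases hyF : y ∈ S.1
    · rw [if_pos hyF]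
      refine Within.ret ⟨hF, hc.1, hlast, fun z hz => ?_⟩
      rw [hy] at hz
      cases hz
      exact hyF
    · rw [if_neg hyF]
      have hcy := color_of_nbr hy
      have hF' : IsFan E χ u v (S.1 ++ [y]) := by
        refine ⟨?_, ?_, ?_, ?_⟩
        · rw [List.nodup_append]
          refine ⟨hF.nodup, by simp, fun a ha b hb => ?_⟩
          rw [List.mem_singleton.1 hb]
          rintro rfl
          exact hyF ha
        · rw [List.isChain_append]
          refine ⟨hF.chain, by simp, fun a ha b hb => ?_⟩
          simp at hb
          subst hb
          exact ⟨c, hcy, hlast a ha⟩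
        · rw [List.head?_append, hF.head]
          rfl
        · intro z hz
          rcases List.mem_append.1 hz with h | h
          · exact hF.adj z h
          · rw [List.mem_singleton.1 h]
            exact hχ.mem_sym _ (by simp [hcy])
      refine Within.ret ⟨⟨hF', by simp⟩, ?_⟩
      have := hF'.length_le
      simp only [List.length_append, List.length_singleton] at this ⊢
      omega

/-- Shifting a fan from its last leaf. Only `χ` without the color of the edge to the first leaf
matters, so that the induction can overwrite this edge. -/
theorem shiftAndColor_within {w : List Bool → ℝ≥0∞} {node : List Bool} {u : Fin n} {c : ℕ}
    (hE : Valid E) (F : List (Fin n)) {x : Fin n} (χ : Coloring n)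
    (hχ : Proper E K (Function.update χ s(u, x) none))
    (hF : IsFan E (Function.update χ s(u, x) none) u x F) (hc : c < K)
    (hu : Miss (Function.update χ s(u, x) none) u c)
    (hl : ∀ l, F.getLast? = some l → Miss (Function.update χ s(u, x) none) l c) :
    Within w node (shiftAndColor node u c F χ) F.length (fun χ' => Proper E K χ' ∧
      ∀ e, χ' e = none ↔ Function.update χ s(u, x) none e = none ∧ e ≠ s(u, x)) := by
  induction F generalizing x χ with
  | nil => exact absurd hF.head (by simp)
  | cons x' F ih =>
    obtain rfl : x' = x := by simpa using hF.head
    have hadj := hF.adj x' List.mem_cons_self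
    cases F with
    | nil =>
      rw [shiftAndColor]
      refine Within.tick_bind (T := 0) (Within.ret ⟨?_, fun e => ?_⟩)
      · have := hχ.color hadj hc hu (hl x' rfl)
        rwa [Function.update_idem] at this
      · by_cases he : e = s(u, x') <;> simp [he]
    | cons y F =>
      rw [shiftAndColor]
      refine Within.tick_bind (T := (y :: F).length) ?_
      obtain ⟨⟨a, ha, hxa⟩, hchain⟩ := List.isChain_cons_cons.1 hF.chain
      obtain ⟨hx, hnd⟩ := List.nodup_cons.1 hF.nodup
      have hxy : x' ≠ y := fun h => hx (h ▸ List.mem_cons_self)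
      have hsne : s(u, y) ≠ s(u, x') := fun h => hxy (Sym2.congr_right.1 h).symm
      have ha' : χ s(u, y) = some a := by rwa [Function.update_of_ne hsne] at ha
      set χ₀ := Function.update χ s(u, x') none with hχ₀
      have huF : ∀ z ∈ x' :: y :: F, u ≠ z := fun z hz => hE.ne_of_mem (hF.adj z hz)
      have key : Function.update (Function.update χ s(u, x') (χ s(u, y))) s(u, y) none =
          Function.update (Function.update χ₀ s(u, y) none) s(u, x') (some a) := by
        rw [hχ₀, ha', Function.update_comm hsne, Function.update_idem]
      have hua : Miss (Function.update χ₀ s(u, y) none) u a := fun z => by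
        rw [Function.update_apply]
        split_ifs with h
        · simp
        · exact fun hz => h (by rw [hχ.inj u z y a hz ha])
      have hac : a ≠ c := fun h => hu y (h ▸ ha)
      have hmiss : ∀ z ∈ y :: F, ∀ b, Miss χ₀ z b → Miss
          (Function.update (Function.update χ₀ s(u, y) none) s(u, x') (some a)) z b := by
        intro z hz b hb
        refine (hb.uncolor _).color fun t ht => ?_
        rcases Sym2.eq_iff.1 ht with ⟨rfl, -⟩ | ⟨rfl, -⟩
        · exact absurd rfl (huF z (List.mem_cons_of_mem _ hz))
        · exact absurd hz hx
      have hfan : IsFan E (Function.update (Function.update χ₀ s(u, y) none) s(u, x') (some a))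
          u y (y :: F) := by
        refine ⟨hnd, ?_, rfl, fun z hz => hF.adj z (List.mem_cons_of_mem _ hz)⟩
        have hyF := (List.nodup_cons.1 hnd).1
        rw [List.isChain_iff_getElem] at hchain ⊢
        intro i hi
        obtain ⟨b, hb, hb'⟩ := hchain i hi
        have hmem : (y :: F)[i + 1] ∈ F := by simp
        refine ⟨b, ?_, hmiss _ (List.getElem_mem _) b hb'⟩
        rw [Function.update_of_ne, Function.update_of_ne]
        · exact hb
        · exact fun h => hyF (Sym2.congr_right.1 h ▸ hmem)
        · exact fun h => hx (List.mem_cons_of_mem _ (Sym2.congr_right.1 h ▸ hmem))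
      refine (ih (x := y) (Function.update χ s(u, x') (χ s(u, y))) ?_ ?_ ?_ ?_).mono le_rfl ?_
      · rw [key]
        exact (hχ.uncolor _).color hadj (hχ.lt _ _ ha) hua (hxa.uncolor _)
      · rw [key]
        exact hfan
      · rw [key]
        exact (hu.uncolor _).color fun _ _ => hac
      · rw [key]
        intro l hl'
        refine hmiss l (List.mem_of_getLast? hl') c (hl l ?_)
        rwa [List.getLast?_cons_cons]
      · rintro χ' ⟨h1, h2⟩
        refine ⟨h1, fun e => ?_⟩
        rw [h2, key]
        by_cases h3 : e = s(u, x')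
        · simp [h3]
        · by_cases h4 : e = s(u, y)
          · simp [h4, ha]
          · simp [h3, h4]

/-! ### Alternating paths -/

/-- `AltWalk χ c₀ c₁ u P z a`: the walk from `u` to `z` along the edges `P` has the alternating
colors `c₁, c₀, c₁, …`, and `a` is the color that continues it. -/
inductive AltWalk (χ : Coloring n) (c₀ c₁ : ℕ) (u : Fin n) :
    List (Sym2 (Fin n) × ℕ) → Fin n → ℕ → Prop
  | nil : AltWalk χ c₀ c₁ u [] u c₁
  | snoc {P : List (Sym2 (Fin n) × ℕ)} {z : Fin n} {a : ℕ} (y : Fin n) :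
      AltWalk χ c₀ c₁ u P z a → χ s(z, y) = some a →
      AltWalk χ c₀ c₁ u (P ++ [(s(z, y), a)]) y (if a = c₁ then c₀ else c₁)

/-- What the correctness of the exchange of two colors needs to know about the set `S` of the
edges of a maximal alternating path from `u` to `z`. -/
structure AltPath (χ : Coloring n) (c₀ c₁ : ℕ) (u z : Fin n) (S : List (Sym2 (Fin n))) :
    Prop where
  ne : c₀ ≠ c₁
  miss : Miss χ u c₀
  color : ∀ e ∈ S, χ e = some c₀ ∨ χ e = some c₁
  closed : ∀ v y y', s(v, y) ∈ S → χ s(v, y') = some c₀ ∨ χ s(v, y') = some c₁ → s(v, y') ∈ S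
  start : ∀ y, χ s(u, y) = some c₁ → s(u, y) ∈ S
  inner : ∀ v y, s(v, y) ∈ S → v ≠ u → v ≠ z → ¬ Miss χ v c₁
  last : z ≠ u → Miss χ z c₁ → ∀ y, χ s(z, y) = some c₀ → s(z, y) ∈ S

theorem AltWalk.color {c₀ c₁ : ℕ} {u z : Fin n} {P : List (Sym2 (Fin n) × ℕ)} {a : ℕ}
    (h : AltWalk χ c₀ c₁ u P z a) :
    (∀ p ∈ P, χ p.1 = some p.2 ∧ (p.2 = c₀ ∨ p.2 = c₁)) ∧ (a = c₀ ∨ a = c₁) := by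
  induction h with
  | nil => simp
  | @snoc P z a y hw hy ih =>
    refine ⟨fun p hp => ?_, by split_ifs <;> simp⟩
    rcases List.mem_append.1 hp with hp | hp
    · exact ih.1 p hp
    · rw [List.mem_singleton.1 hp]
      exact ⟨hy, ih.2⟩

theorem AltWalk.altPath {c₀ c₁ : ℕ} {u z : Fin n} {P : List (Sym2 (Fin n) × ℕ)} {a : ℕ}
    (hχ : Proper E K χ) (hne : c₀ ≠ c₁) (hu : Miss χ u c₀) (hu' : ¬ Miss χ u c₁)
    (h : AltWalk χ c₀ c₁ u P z a) (hz : Miss χ z a) :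
    AltPath χ c₀ c₁ u z (P.map Prod.fst) := by
  -- Only the edge that continues the walk can prevent the walk from being closed.
  have key : (∀ v y y' c, s(v, y) ∈ P.map Prod.fst → χ s(v, y') = some c → c = c₀ ∨ c = c₁ →
        s(v, y') ∈ P.map Prod.fst ∨ v = z ∧ c = a) ∧
      (∀ y, χ s(z, y) = some (if a = c₁ then c₀ else c₁) → s(z, y) ∈ P.map Prod.fst) ∧
      (P = [] ∧ z = u ∧ a = c₁ ∨ ∀ y, χ s(u, y) = some c₁ → s(u, y) ∈ P.map Prod.fst) ∧
      (z = u ∨ ¬ Miss χ z (if a = c₁ then c₀ else c₁)) ∧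
      (∀ v y, s(v, y) ∈ P.map Prod.fst → v ≠ u → v ≠ z → ¬ Miss χ v c₁) := by
    clear hz
    induction h with
    | nil => simpa using fun y h => absurd h (hu y)
    | @snoc P z a y hw hy ih =>
      obtain ⟨ih1, ih2, ih3, ih4, ih5⟩ := ih
      have hca := hw.color.2
      have htog : (if (if a = c₁ then c₀ else c₁) = c₁ then c₀ else c₁) = a := by
        rcases hca with rfl | rfl <;> simp [hne]
      have hmem : ∀ e, e ∈ (P ++ [(s(z, y), a)]).map Prod.fst ↔
          e ∈ P.map Prod.fst ∨ e = s(z, y) := by simp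
      have hother : ∀ c, c = c₀ ∨ c = c₁ → c ≠ a → c = if a = c₁ then c₀ else c₁ := by
        intro c hc hca'
        split_ifs with h1
        · subst h1; tauto
        · rcases hca with rfl | rfl <;> tauto
      rw [htog]
      have hy' : χ s(y, z) = some a := by rw [Sym2.eq_swap]; exact hy
      refine ⟨fun v t t' c h1 h2 h3 => ?_, fun t ht => ?_, Or.inr fun t ht => ?_, Or.inr fun hm => ?_,
        fun v t h1 h2 h3 => ?_⟩
      · rw [hmem] at h1 ⊢
        by_cases hc : c = a
        · subst hc
          have : v = z ∨ v = y → s(v, t') = s(z, y) := by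
            rintro (rfl | rfl)
            · rw [hχ.inj v t' y c h2 hy]
            · rw [hχ.inj v t' z c h2 hy', Sym2.eq_swap]
          rcases h1 with h1 | h1
          · rcases ih1 v t t' c h1 h2 h3 with h4 | h4
            · exact Or.inl (Or.inl h4)
            · exact Or.inl (Or.inr (this (Or.inl h4.1)))
          · refine Or.inl (Or.inr (this ?_))
            rcases Sym2.eq_iff.1 h1 with h | h
            · exact Or.inl h.1
            · exact Or.inr h.1
        · rcases h1 with h1 | h1
          · rcases ih1 v t t' c h1 h2 h3 with h4 | h4
            · exact Or.inl (Or.inl h4)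
            · exact absurd h4.2 hc
          · rcases Sym2.eq_iff.1 h1 with ⟨rfl, -⟩ | ⟨rfl, -⟩
            · exact Or.inl (Or.inl (ih2 _ (hother c h3 hc ▸ h2)))
            · exact Or.inr ⟨rfl, hother c h3 hc⟩
      · rw [hmem, hχ.inj y t z a ht hy']
        exact Or.inr Sym2.eq_swap
      · rw [hmem]
        rcases ih3 with ⟨-, rfl, rfl⟩ | ih3
        · rw [hχ.inj z t y a ht hy]
          exact Or.inr rfl
        · exact Or.inl (ih3 t ht)
      · exact hm z hy'
      · rw [hmem] at h1
        -- An inner vertex of the walk has an incoming and an outgoing edge, of both colors.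
        have hvz : v = z → ¬ Miss χ v c₁ := by
          rintro rfl hm
          rcases hca with rfl | rfl
          · rcases ih4 with h | h
            · exact h2 h
            · rw [if_neg hne] at h
              exact h hm
          · exact hm y hy
        rcases h1 with h1 | h1
        · by_cases hv : v = z
          · exact hvz hv
          · exact ih5 v t h1 h2 hv
        · rcases Sym2.eq_iff.1 h1 with ⟨rfl, -⟩ | ⟨rfl, -⟩
          · exact hvz rfl
          · exact absurd rfl h3
  obtain ⟨h1, h2, h3, h4, h5⟩ := key
  refine ⟨hne, hu, fun e he => ?_, fun v y y' hy hc => ?_, ?_, h5, fun hzu hm y hy => h2 y ?_⟩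
  · obtain ⟨p, hp, rfl⟩ := List.mem_map.1 he
    obtain ⟨h6, h7⟩ := h.color.1 p hp
    rw [h6]
    simpa using h7
  · have : ∀ c, χ s(v, y') = some c → c = c₀ ∨ c = c₁ → s(v, y') ∈ P.map Prod.fst := by
      intro c hc hc'
      rcases h1 v y y' c hy hc hc' with h6 | ⟨rfl, rfl⟩
      · exact h6
      · exact absurd hc (hz y')
    rcases hc with hc | hc
    · exact this _ hc (Or.inl rfl)
    · exact this _ hc (Or.inr rfl)
  · rcases h3 with ⟨-, rfl, rfl⟩ | h3
    · exact absurd hz hu'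
    · exact h3
  · rcases h4 with h4 | h4
    · exact absurd h4 hzu
    · have : a = c₁ := by
        by_contra hac
        rw [if_neg hac] at h4
        exact h4 hm
      rw [if_pos this]
      exact hy

/-- Exchange the colors `c₀` and `c₁` on the edges in `S`. -/
def flipOn (c₀ c₁ : ℕ) (S : List (Sym2 (Fin n))) (χ : Coloring n) : Coloring n := fun e =>
  if e ∈ S then (χ e).map (fun c => if c = c₁ then c₀ else c₁) else χ e

theorem foldl_flip {c₀ c₁ : ℕ} {P : List (Sym2 (Fin n) × ℕ)} {χ : Coloring n}
    (h : ∀ p ∈ P, χ p.1 = some p.2) :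
    P.foldl (fun (χ : Coloring n) p => Function.update χ p.1 (some (if p.2 = c₁ then c₀ else c₁))) χ =
      flipOn c₀ c₁ (P.map Prod.fst) χ := by
  have key : ∀ (Q : List (Sym2 (Fin n) × ℕ)) (ψ : Coloring n), (∀ p ∈ Q, χ p.1 = some p.2) →
      ∀ e, Q.foldl (fun (χ : Coloring n) p => Function.update χ p.1 (some (if p.2 = c₁ then c₀ else c₁))) ψ e =
        if e ∈ Q.map Prod.fst then (χ e).map (fun c => if c = c₁ then c₀ else c₁) else ψ e := by
    intro Q
    induction Q with
    | nil => simp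
    | cons p Q ih =>
      intro ψ hQ e
      rw [List.foldl_cons, ih _ fun q hq => hQ q (List.mem_cons_of_mem _ hq)]
      by_cases h1 : e ∈ Q.map Prod.fst
      · rw [if_pos h1, if_pos (by rw [List.map_cons]; exact List.mem_cons_of_mem _ h1)]
      · rw [if_neg h1]
        by_cases h2 : e = p.1
        · subst h2
          simp [hQ p List.mem_cons_self]
        · rw [Function.update_of_ne h2, if_neg]
          rw [List.map_cons, List.mem_cons]
          tauto
  exact funext (key P χ h)

namespace AltPath

variable {c₀ c₁ : ℕ} {u z : Fin n} {S : List (Sym2 (Fin n))}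

theorem flip_eq_none (e : Sym2 (Fin n)) : flipOn c₀ c₁ S χ e = none ↔ χ e = none := by
  rw [flipOn]
  split_ifs <;> simp

theorem flip_cases (h : AltPath χ c₀ c₁ u z S) (e : Sym2 (Fin n)) :
    e ∉ S ∧ flipOn c₀ c₁ S χ e = χ e ∨ e ∈ S ∧ χ e = some c₀ ∧ flipOn c₀ c₁ S χ e = some c₁ ∨
      e ∈ S ∧ χ e = some c₁ ∧ flipOn c₀ c₁ S χ e = some c₀ := by
  have := h.ne
  by_cases he : e ∈ S
  · rcases h.color e he with h1 | h1 <;> simp [flipOn, he, h1, this]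
  · simp [flipOn, he]

theorem flip_eq_some (h : AltPath χ c₀ c₁ u z S) {e : Sym2 (Fin n)} {c : ℕ} (h0 : c ≠ c₀)
    (h1 : c ≠ c₁) : flipOn c₀ c₁ S χ e = some c ↔ χ e = some c := by
  rcases h.flip_cases e with ⟨-, h2⟩ | ⟨-, h2, h3⟩ | ⟨-, h2, h3⟩
  · rw [h2]
  · simp [h2, h3, h0.symm, h1.symm]
  · simp [h2, h3, h0.symm, h1.symm]

theorem proper_flip (h : AltPath χ c₀ c₁ u z S) (hχ : Proper E K χ) (h0 : c₀ < K) (h1 : c₁ < K) :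
    Proper E K (flipOn c₀ c₁ S χ) := by
  have hne := h.ne
  refine ⟨fun e he => hχ.mem_sym e (fun h2 => he ((flip_eq_none e).2 h2)), fun e c hc => ?_,
    fun v x y c hx hy => ?_⟩
  · rcases h.flip_cases e with ⟨-, h2⟩ | ⟨-, h2, h3⟩ | ⟨-, h2, h3⟩
    · exact hχ.lt e c (h2 ▸ hc)
    · rw [h3] at hc; cases hc; exact h1
    · rw [h3] at hc; cases hc; exact h0
  · have cl := h.closed v
    rcases h.flip_cases s(v, x) with ⟨h2, h3⟩ | ⟨h2, h4, h3⟩ | ⟨h2, h4, h3⟩ <;>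
    rcases h.flip_cases s(v, y) with ⟨h2', h3'⟩ | ⟨h2', h4', h3'⟩ | ⟨h2', h4', h3'⟩ <;>
    rw [h3] at hx <;> rw [h3'] at hy
    · exact hχ.inj v x y c hx hy
    · cases hy; exact absurd (cl y x h2' (Or.inr hx)) h2
    · cases hy; exact absurd (cl y x h2' (Or.inl hx)) h2
    · cases hx; exact absurd (cl x y h2 (Or.inr hy)) h2'
    · exact hχ.inj v x y _ h4 h4'
    · cases hx; cases hy; exact absurd rfl hne
    · cases hx; exact absurd (cl x y h2 (Or.inl hy)) h2'
    · cases hx; cases hy; exact absurd rfl hne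
    · exact hχ.inj v x y _ h4 h4'

theorem miss_flip_start (h : AltPath χ c₀ c₁ u z S) : Miss (flipOn c₀ c₁ S χ) u c₁ := fun y hy => by
  rcases h.flip_cases s(u, y) with ⟨h2, h3⟩ | ⟨h2, h4, h3⟩ | ⟨h2, h4, h3⟩
  · exact h2 (h.start y (h3 ▸ hy))
  · exact h.miss y h4
  · rw [h3] at hy; cases hy; exact h.ne rfl

theorem miss_flip_of_ne (h : AltPath χ c₀ c₁ u z S) {v : Fin n} (hv : Miss χ v c₁) (hu : v ≠ u)
    (hz : v ≠ z) : Miss (flipOn c₀ c₁ S χ) v c₁ := fun y hy => by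
  rcases h.flip_cases s(v, y) with ⟨h2, h3⟩ | ⟨h2, h4, h3⟩ | ⟨h2, h4, h3⟩
  · exact hv y (h3 ▸ hy)
  · exact h.inner v y h2 hu hz hv
  · exact hv y h4

theorem miss_flip_last (h : AltPath χ c₀ c₁ u z S) (hv : Miss χ z c₁) (hu : z ≠ u) :
    Miss (flipOn c₀ c₁ S χ) z c₀ := fun y hy => by
  rcases h.flip_cases s(z, y) with ⟨h2, h3⟩ | ⟨h2, h4, h3⟩ | ⟨h2, h4, h3⟩
  · exact h2 (h.last hu hv y (h3 ▸ hy))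
  · rw [h3] at hy; cases hy; exact h.ne rfl
  · exact hv y h4

theorem fanRel_flip (h : AltPath χ c₀ c₁ u z S) (hχ : Proper E K χ) {x y y' : Fin n}
    (hy : χ s(u, y) = some c₁) (hne : y' ≠ y) (hr : FanRel χ u x y') :
    FanRel (flipOn c₀ c₁ S χ) u x y' := by
  obtain ⟨a, ha, hx⟩ := hr
  have h0 : a ≠ c₀ := fun h' => h.miss y' (h' ▸ ha)
  have h1 : a ≠ c₁ := fun h' => hne (hχ.inj u y' y c₁ (h' ▸ ha) hy)
  exact ⟨a, (h.flip_eq_some h0 h1).2 ha, fun t ht => hx t ((h.flip_eq_some h0 h1).1 ht)⟩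

end AltPath

/-- Vizing's argument. Let `p` be the leaf before the leaf `y` whose edge to `u` has the color `c₁`; then
`c₁` is missing at `p` and at the last leaf. The path can end in only one of them: after the exchange
of colors, either `c₁` is still missing at `p`, or `p` has become the end of the path, `c₀` is missing
at `p` and is the color of `uy`, so that the whole fan is again a fan. -/
theorem extendColoring_within {w : List Bool → ℝ≥0∞} {node : List Bool} (hE : Valid E)
    (hχ : Proper E K χ) {u v x : Fin n} (huv : χ s(u, v) = none) {F : List (Fin n)} {c₀ c₁ : ℕ}
    (hF : IsFan E χ u v F) (hp : Primed K χ u F c₁) (hc₀ : c₀ < K) (hm : Miss χ u c₀)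
    {P : List (Sym2 (Fin n) × ℕ)} {a : ℕ} (hP : AltWalk χ c₀ c₁ u P x a) (hx : Miss χ x a) :
    Within w node (extendColoring node χ u F c₀ c₁ P x) (P.length + 2 * F.length + 2)
      (fun χ' => Proper E K χ' ∧ ∀ e, χ' e = none ↔ χ e = none ∧ e ≠ s(u, v)) := by
  have hupd : ∀ ψ : Coloring n, ψ s(u, v) = none → Function.update ψ s(u, v) none = ψ :=
    fun ψ h => by rw [← h, Function.update_eq_self]
  -- Shift a fan in a coloring that differs from `χ` by an exchange of colors.
  have shift : ∀ (ψ : Coloring n) (F' : List (Fin n)), Proper E K ψ →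
      (∀ e, ψ e = none ↔ χ e = none) → IsFan E ψ u v F' → Miss ψ u c₁ →
      (∀ l, F'.getLast? = some l → Miss ψ l c₁) →
      Within w node (shiftAndColor node u c₁ F' ψ) F'.length
        (fun χ' => Proper E K χ' ∧ ∀ e, χ' e = none ↔ χ e = none ∧ e ≠ s(u, v)) := by
    intro ψ F' h1 h2 h3 h4 h5
    have h6 := hupd ψ ((h2 _).2 huv)
    refine (shiftAndColor_within (x := v) (c := c₁) (K := K) hE F' ψ (by rwa [h6]) (by rwa [h6])
      hp.lt (by rwa [h6]) (by rwa [h6])).mono le_rfl ?_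
    rintro χ' ⟨h7, h8⟩
    refine ⟨h7, fun e => ?_⟩
    rw [h8, h6, h2]
  rw [extendColoring]
  refine Within.tick_bind (T := P.length + 2 * F.length + 1) ?_
  cases hy : nbr χ u c₁ with
  | none =>
    exact (shift χ F hχ (fun _ => Iff.rfl) hF (nbr_eq_none.1 hy) hp.last).mono (by omega)
      fun _ h => h
  | some y =>
    have hyc := color_of_nbr hy
    have hne : c₀ ≠ c₁ := fun h => hm y (h ▸ hyc)
    obtain ⟨A, B, hAB⟩ := List.append_of_mem (hp.closed y hy)
    have hnd := hF.nodup
    rw [hAB, List.nodup_append] at hnd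
    obtain ⟨hndA, hndB, hdisj⟩ := hnd
    have hyA : y ∉ A := fun h => hdisj y h y List.mem_cons_self rfl
    have hyB : y ∉ B := (List.nodup_cons.1 hndB).1
    have htake : F.takeWhile (fun z => decide (z ≠ y)) = A := by
      rw [hAB, List.takeWhile_append_of_pos (by
      intro z hz
      simpa using fun h : z = y => hyA (h ▸ hz))]
      simp
    have hAne : A ≠ [] := by
      rintro rfl
      have := hF.head
      rw [hAB] at this
      simp only [List.nil_append, List.head?_cons, Option.some.injEq] at this
      rw [this, huv] at hyc
      cases hyc
    obtain ⟨A', p, rfl⟩ : ∃ A' p, A = A' ++ [p] :=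
      ⟨A.dropLast, A.getLast hAne, (List.dropLast_append_getLast hAne).symm⟩
    have hpA : p ∈ A' ++ [p] := by simp
    have hchain := hF.chain
    rw [hAB, List.isChain_append] at hchain
    obtain ⟨hchA, hchB, hpy⟩ := hchain
    have hpy : FanRel χ u p y := hpy p (by simp) y (by simp)
    have hpm : Miss χ p c₁ := by
      obtain ⟨b, hb, hb'⟩ := hpy
      rw [hyc] at hb
      cases hb
      exact hb'
    have hup : ∀ t ∈ F, t ≠ u := fun t ht => (hE.ne_of_mem (hF.adj t ht)).symm
    have hpF : p ∈ F := by rw [hAB]; simp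
    have hW := hP.altPath hχ hne hm (fun h => h y hyc) hx
    have hprop := hW.proper_flip hχ hc₀ hp.lt
    have hchA' : (A' ++ [p]).IsChain (FanRel (flipOn c₀ c₁ (P.map Prod.fst) χ) u) := by
      rw [List.isChain_iff_getElem] at hchA ⊢
      exact fun i hi => hW.fanRel_flip hχ hyc
        (fun h => hyA (h ▸ List.getElem_mem _)) (hchA i hi)
    have hhead : (A' ++ [p]).head? = some v := by
      have := hF.head
      rw [hAB] at this
      cases A' <;> simpa using this
    change Within w node (EdgeColor.pass node F >>= fun _ => _) _ _
    refine (Within.scan_bind (T := P.length + F.length + 1) ?_).mono (by omega) fun _ h => h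
    rw [htake]
    refine (Within.scan_bind (T := F.length + 1) ?_).mono (by omega) fun _ h => h
    rw [foldl_flip fun q hq => (hP.color.1 q hq).1]
    refine Within.tick_bind ?_
    rw [List.getLast?_append_of_ne_nil _ (by simp), List.getLast?_singleton]
    split_ifs with hpx
    · -- The path ends in `p`, and `c₀` takes the role of the color that is missing at `p`.
      cases hpx
      refine shift _ F hprop AltPath.flip_eq_none ⟨hF.nodup, ?_, hF.head, hF.adj⟩
        hW.miss_flip_start fun l hl => ?_
      · rw [hAB, List.isChain_append]
        refine ⟨hchA', ?_, ?_⟩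
        · rw [List.isChain_iff_getElem] at hchB ⊢
          refine fun i hi => hW.fanRel_flip hχ hyc (fun h => hyB ?_) (hchB i hi)
          have : (y :: B)[i + 1] ∈ B := by simp
          rwa [h] at this
        · intro s hs t ht
          simp at hs ht
          subst hs ht
          refine ⟨c₀, ?_, hW.miss_flip_last hpm (hup _ hpF)⟩
          rcases hW.flip_cases s(u, y) with ⟨h2, -⟩ | ⟨-, h2, -⟩ | ⟨-, -, h2⟩
          · exact absurd (hW.start y hyc) h2
          · exact absurd h2 (hm y)
          · exact h2
      · have hlF := List.mem_of_getLast? hl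
        refine hW.miss_flip_of_ne (hp.last l hl) (hup l hlF) fun h => ?_
        rw [hAB, List.getLast?_append_of_ne_nil _ (by simp)] at hl
        exact hdisj _ hpA l (List.mem_of_getLast? hl) h.symm
    · have hsub : ∀ t ∈ A' ++ [p], t ∈ F := fun t ht => by rw [hAB]; exact List.mem_append_left _ ht
      refine (shift _ (A' ++ [p]) hprop AltPath.flip_eq_none
        ⟨hndA, hchA', hhead, fun t ht => hF.adj t (hsub t ht)⟩
        hW.miss_flip_start fun l hl => ?_).mono ?_ fun _ h => h
      · simp at hl
        subst hl
        exact hW.miss_flip_of_ne hpm (hup _ hpF) fun h => hpx (by rw [h])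
      · rw [hAB, List.length_append (as := A' ++ [p])]
        omega

end Colorings

/-! ### The lengths of alternating paths -/

section Orbits

variable {α : Type*} {T : α → Option α} {s t x : α}

/-- The states that a partial map reaches from `s`. -/
def orbit (T : α → Option α) (s : α) : ℕ → Option α
  | 0 => some s
  | i + 1 => (orbit T s i).bind T

theorem orbit_eq_none_of_le {i j : ℕ} (hij : i ≤ j) (h : orbit T s i = none) :
    orbit T s j = none := by
  induction hij with
  | refl => exact h
  | step _ ih => simp [orbit, ih]

/-- The orbits of an injective partial map from states without a preimage are disjoint, and do not
visit a state twice. -/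
theorem orbit_injective (hT : ∀ x y z, T x = some z → T y = some z → x = y)
    (hs : ∀ y, T y ≠ some s) (ht : ∀ y, T y ≠ some t) {i j : ℕ} (hi : orbit T s i = some x)
    (hj : orbit T t j = some x) : s = t ∧ i = j := by
  induction i generalizing j x with
  | zero =>
    cases hi
    cases j with
    | zero => cases hj; exact ⟨rfl, rfl⟩
    | succ j =>
      obtain ⟨y, -, hy⟩ := Option.bind_eq_some_iff.1 hj
      exact absurd hy (hs y)
  | succ i ih =>
    obtain ⟨y, hy, hyx⟩ := Option.bind_eq_some_iff.1 hi
    cases j with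
    | zero => cases hj; exact absurd hyx (ht y)
    | succ j =>
      obtain ⟨z, hz, hzx⟩ := Option.bind_eq_some_iff.1 hj
      have := ih hy (hT _ _ _ hzx hyx ▸ hz)
      exact ⟨this.1, by rw [this.2]⟩

end Orbits

section PathLengths

variable {n : ℕ} {E : Edges n} {K : ℕ} {χ : Coloring n}

/-- One step along an alternating path: in the state `(x, a, b)` the path has reached `x` along an
edge of color `b`, and continues with color `a`. -/
def altStep (χ : Coloring n) (S : Fin n × ℕ × ℕ) : Option (Fin n × ℕ × ℕ) :=
  (nbr χ S.1 S.2.1).map fun y => (y, S.2.2, S.2.1)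

theorem altStep_eq_some (hχ : Proper E K χ) {x y : Fin n} {a b a' b' : ℕ} :
    altStep χ (x, a, b) = some (y, a', b') ↔ χ s(x, y) = some a ∧ a' = b ∧ b' = a := by
  simp only [altStep, Option.map_eq_some_iff, Prod.mk.injEq]
  constructor
  · rintro ⟨z, hz, rfl, rfl, rfl⟩
    exact ⟨color_of_nbr hz, rfl, rfl⟩
  · rintro ⟨h, rfl, rfl⟩
    exact ⟨y, hχ.nbr_eq_some.2 h, rfl, rfl, rfl⟩

theorem altStep_injective (hχ : Proper E K χ) (S S' R : Fin n × ℕ × ℕ) (h : altStep χ S = some R)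
    (h' : altStep χ S' = some R) : S = S' := by
  obtain ⟨x, a, b⟩ := S
  obtain ⟨x', a', b'⟩ := S'
  obtain ⟨y, c, d⟩ := R
  rw [altStep_eq_some hχ] at h h'
  obtain ⟨h1, rfl, rfl⟩ := h
  obtain ⟨h2, rfl, rfl⟩ := h'
  rw [Sym2.eq_swap] at h1 h2
  rw [hχ.inj _ _ _ _ h1 h2]

theorem altStep_ne_start (hχ : Proper E K χ) {u : Fin n} {c₀ c₁ : ℕ} (hu : Miss χ u c₀)
    (S : Fin n × ℕ × ℕ) : altStep χ S ≠ some (u, c₁, c₀) := by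
  obtain ⟨x, a, b⟩ := S
  rw [Ne, altStep_eq_some hχ]
  rintro ⟨h1, rfl, rfl⟩
  rw [Sym2.eq_swap] at h1
  exact hu x h1

/-- The number of edges of the maximal path from `u` that alternates between `c₁` and `c₀`, if `c₀`
is missing at `u`. -/
def pathLen (χ : Coloring n) (u : Fin n) (c₀ c₁ : ℕ) : ℕ :=
  Nat.findGreatest (fun i => (orbit (altStep χ) (u, c₁, c₀) i).isSome) (2 * n)

theorem pathLen_le (u : Fin n) (c₀ c₁ : ℕ) : pathLen χ u c₀ c₁ ≤ 2 * n := Nat.findGreatest_le _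

theorem isSome_orbit_pathLen (u : Fin n) (c₀ c₁ : ℕ) {i : ℕ} (hi : i ≤ pathLen χ u c₀ c₁) :
    (orbit (altStep χ) (u, c₁, c₀) i).isSome := by
  have h : (orbit (altStep χ) (u, c₁, c₀) (pathLen χ u c₀ c₁)).isSome :=
    Nat.findGreatest_spec (P := fun i => (orbit (altStep χ) (u, c₁, c₀) i).isSome)
      (Nat.zero_le (2 * n)) rfl
  by_contra h'
  rw [Option.not_isSome_iff_eq_none] at h'
  rw [orbit_eq_none_of_le hi h'] at h
  cases h

theorem orbit_altStep_colors {u : Fin n} {c₀ c₁ i : ℕ} {S : Fin n × ℕ × ℕ}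
    (h : orbit (altStep χ) (u, c₁, c₀) i = some S) : S.2 = (c₁, c₀) ∨ S.2 = (c₀, c₁) := by
  induction i generalizing S with
  | zero => cases h; exact Or.inl rfl
  | succ i ih =>
    obtain ⟨R, hR, hRS⟩ := Option.bind_eq_some_iff.1 h
    obtain ⟨y, -, rfl⟩ := Option.map_eq_some_iff.1 hRS
    rcases ih hR with h1 | h1 <;> simp [h1]

theorem le_pathLen (hχ : Proper E K χ) {u : Fin n} {c₀ c₁ i : ℕ} (hu : Miss χ u c₀)
    (h : (orbit (altStep χ) (u, c₁, c₀) i).isSome) : i ≤ pathLen χ u c₀ c₁ := by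
  classical
  refine Nat.le_findGreatest ?_ h
  have hall : ∀ j ≤ i, ∃ S, orbit (altStep χ) (u, c₁, c₀) j = some S := fun j hj => by
    by_contra h'
    rw [← Option.isSome_iff_exists, Option.not_isSome_iff_eq_none] at h'
    rw [orbit_eq_none_of_le hj h'] at h
    cases h
  have hcard : (Finset.range (i + 1)).card ≤
      ((Finset.univ : Finset (Fin n)) ×ˢ ({(c₁, c₀), (c₀, c₁)} : Finset (ℕ × ℕ))).card := by
    refine Finset.card_le_card_of_injOn
      (fun j => (orbit (altStep χ) (u, c₁, c₀) j).getD (u, c₁, c₀)) (fun j hj => ?_)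
      fun j hj k hk hjk => ?_
    · obtain ⟨S, hS⟩ := hall j (Nat.lt_succ_iff.1 (by simpa using hj))
      simpa [hS] using orbit_altStep_colors hS
    · obtain ⟨S, hS⟩ := hall j (Nat.lt_succ_iff.1 (by simpa using hj))
      obtain ⟨R, hR⟩ := hall k (Nat.lt_succ_iff.1 (by simpa using hk))
      simp only [hS, hR, Option.getD_some] at hjk
      subst hjk
      exact (orbit_injective (altStep_injective hχ) (altStep_ne_start hχ hu)
        (altStep_ne_start hχ hu) hS hR).2
  rw [Finset.card_range, Finset.card_product, Finset.card_univ, Fintype.card_fin] at hcard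
  have : n * ({(c₁, c₀), (c₀, c₁)} : Finset (ℕ × ℕ)).card ≤ n * 2 :=
    Nat.mul_le_mul_left _ Finset.card_le_two
  omega

theorem alternatingPath_within {w : List Bool → ℝ≥0∞} {node : List Bool} (hχ : Proper E K χ)
    {u : Fin n} {c₀ c₁ : ℕ} (hu : Miss χ u c₀) :
    Within w node (alternatingPath node χ u c₀ c₁) (pathLen χ u c₀ c₁ + 1)
      (fun r => r.1.length ≤ pathLen χ u c₀ c₁ ∧
        ∃ a, AltWalk χ c₀ c₁ u r.1 r.2 a ∧ Miss χ r.2 a) := by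
  rw [alternatingPath]
  refine Within.loop (s := ([], u, c₁))
    (fun S : List (Sym2 (Fin n) × ℕ) × Fin n × ℕ => AltWalk χ c₀ c₁ u S.1 S.2.1 S.2.2 ∧
      orbit (altStep χ) (u, c₁, c₀) S.1.length =
        some (S.2.1, S.2.2, if S.2.2 = c₁ then c₀ else c₁))
    (fun S : List (Sym2 (Fin n) × ℕ) × Fin n × ℕ => pathLen χ u c₀ c₁ + 1 - S.1.length) 1
    (fun S hS => ?_) (fun S hS => ?_) ⟨AltWalk.nil, by simp [orbit]⟩
  · have := le_pathLen hχ hu (i := S.1.length) (by rw [hS.2]; rfl)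
    omega
  obtain ⟨P, z, a⟩ := S
  obtain ⟨hW, ho⟩ := hS
  simp only at hW ho
  have hlen := le_pathLen hχ hu (i := P.length) (by rw [ho]; rfl)
  refine Within.tick_bind (T := 0) ?_
  dsimp only
  cases hy : nbr χ z a with
  | none => exact Within.ret ⟨hlen, a, hW, nbr_eq_none.1 hy⟩
  | some y =>
    have ho' : orbit (altStep χ) (u, c₁, c₀) (P.length + 1) =
        some (y, if a = c₁ then c₀ else c₁, a) := by
      simp [orbit, ho, altStep, hy]
    have hlen' := le_pathLen hχ hu (i := P.length + 1) (by rw [ho']; rfl)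
    refine Within.ret ⟨⟨hW.snoc y (color_of_nbr hy), ?_⟩, ?_⟩
    · simp only [List.length_append, List.length_singleton]
      rw [ho']
      have : (if (if a = c₁ then c₀ else c₁) = c₁ then c₀ else c₁) = a := by
        rcases hW.color.2 with rfl | rfl
        · split_ifs <;> simp_all
        · simp +contextual
      rw [this]
    · simp only [List.length_append, List.length_singleton]
      omega

/-- The edges of an alternating path other than its first and its last one, traversed in the
direction of the path, come with a color that is present at both ends. So the total number of such
edges is at most twice the weight of the graph. -/
theorem sum_pathLen_le (hE : Valid E) (hχ : Proper E K χ) :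
    ∑ u, ∑ c₀ ∈ (missing χ K u).toFinset, ∑ c₁ ∈ Finset.range K, (pathLen χ u c₀ c₁ - 2) ≤
      2 * totalWt E := by
  classical
  set St : Finset (Σ _ : Fin n, Σ _ : ℕ, ℕ) := Finset.univ.sigma fun u =>
    (missing χ K u).toFinset.sigma fun _ => Finset.range K with hSt
  set A := St.sigma fun s => Finset.range (pathLen χ s.1 s.2.1 s.2.2 - 2) with hA
  set B := (Finset.univ.filter fun p : Fin n × Fin n => s(p.1, p.2) ∈ sym E).sigma
    fun p => (Finset.range K).filter fun b => nbr χ p.1 b ≠ none ∧ nbr χ p.2 b ≠ none with hB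
  have h1 : ∑ u, ∑ c₀ ∈ (missing χ K u).toFinset, ∑ c₁ ∈ Finset.range K,
      (pathLen χ u c₀ c₁ - 2) = A.card := by
    rw [hA, Finset.card_sigma, hSt, Finset.sum_sigma]
    refine Finset.sum_congr rfl fun u _ => ?_
    rw [Finset.sum_sigma]
    simp
  have h2 : B.card ≤ 2 * totalWt E := by
    let g : Sym2 (Fin n) → ℕ :=
      Sym2.lift ⟨fun x y => min (deg E x) (deg E y), fun _ _ => min_comm _ _⟩
    have hg := sum_darts hE g
    have : (E.map fun e => g s(e.1, e.2)).sum = totalWt E := rfl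
    rw [← this, ← hg, hB, Finset.card_sigma, Finset.sum_filter, ← Finset.univ_product_univ,
      Finset.sum_product]
    refine Finset.sum_le_sum fun x _ => Finset.sum_le_sum fun y _ => ?_
    split_ifs
    · have key : ∀ v : Fin n, (∀ b, nbr χ x b ≠ none ∧ nbr χ y b ≠ none → nbr χ v b ≠ none) →
          ((Finset.range K).filter fun b => nbr χ x b ≠ none ∧ nbr χ y b ≠ none).card ≤ deg E v :=
        fun v hv => (Finset.card_le_card (Finset.monotone_filter_right _ fun b _ hb => hv b hb)).trans
          ((Nat.le_add_right _ _).trans (hχ.card_seen_le v))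
      exact le_min (key x fun b hb => hb.1) (key y fun b hb => hb.2)
    · exact le_rfl
  rw [h1]
  refine le_trans ?_ h2
  have hstate : ∀ p ∈ A, Miss χ p.1.1 p.1.2.1 ∧
      ∃ x y a b, orbit (altStep χ) (p.1.1, p.1.2.2, p.1.2.1) (p.2 + 1) = some (x, a, b) ∧
      χ s(x, y) = some a ∧ nbr χ x b ≠ none ∧ nbr χ y b ≠ none ∧ b < K := by
    rintro ⟨⟨u, c₀, c₁⟩, i⟩ hp
    simp only [hA, hSt, Finset.mem_sigma, Finset.mem_univ, true_and, List.mem_toFinset,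
      Finset.mem_range, mem_missing] at hp
    obtain ⟨⟨⟨hc₀, hm⟩, hc₁⟩, hi⟩ := hp
    refine ⟨hm, ?_⟩
    have ho := isSome_orbit_pathLen (χ := χ) u c₀ c₁ (i := i + 3) (by omega)
    obtain ⟨⟨x', a', b'⟩, h3⟩ := Option.isSome_iff_exists.1 ho
    obtain ⟨⟨y, b, a⟩, h4, h4'⟩ := Option.bind_eq_some_iff.1 h3
    obtain ⟨⟨x, a₁, b₁⟩, h5, h5'⟩ := Option.bind_eq_some_iff.1 h4
    obtain ⟨⟨x₀, a₂, b₂⟩, h6, h6'⟩ := Option.bind_eq_some_iff.1 h5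
    rw [altStep_eq_some hχ] at h4' h5' h6'
    obtain ⟨e1, rfl, rfl⟩ := h4'
    obtain ⟨e2, rfl, rfl⟩ := h5'
    obtain ⟨e3, rfl, rfl⟩ := h6'
    refine ⟨x, y, _, _, h5, e2, ?_, ?_, hχ.lt _ _ e1⟩
    · rw [Sym2.eq_swap] at e3
      rw [hχ.nbr_eq_some.2 e3]
      simp
    · rw [hχ.nbr_eq_some.2 e1]
      simp
  let φ : (Σ _ : (Σ _ : Fin n, Σ _ : ℕ, ℕ), ℕ) → Σ _ : Fin n × Fin n, ℕ := fun p =>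
    let S := (orbit (altStep χ) (p.1.1, p.1.2.2, p.1.2.1) (p.2 + 1)).getD (p.1.1, 0, 0)
    ⟨(S.1, (nbr χ S.1 S.2.1).getD S.1), S.2.2⟩
  have hφ : ∀ p x y a b, orbit (altStep χ) (p.1.1, p.1.2.2, p.1.2.1) (p.2 + 1) = some (x, a, b) →
      χ s(x, y) = some a → φ p = ⟨(x, y), b⟩ := by
    intro p x y a b h h'
    simp only [φ, h, Option.getD_some, hχ.nbr_eq_some.2 h']
  refine Finset.card_le_card_of_injOn φ (fun p hp => ?_) fun p hp q hq hpq => ?_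
  · obtain ⟨-, x, y, a, b, h3, h4, h5, h6, h7⟩ := hstate p hp
    rw [hφ p x y a b h3 h4]
    simp only [hB, Finset.coe_sigma, Set.mem_sigma_iff, Finset.coe_filter, Finset.mem_univ,
      true_and, Set.mem_ofPred_eq, Finset.mem_range]
    exact ⟨hχ.mem_sym _ (by simp [h4]), h7, h5, h6⟩
  · obtain ⟨hm, x, y, a, b, h3, h4, -⟩ := hstate p hp
    obtain ⟨hm', x', y', a', b', h3', h4', -⟩ := hstate q hq
    rw [hφ p x y a b h3 h4, hφ q x' y' a' b' h3' h4'] at hpq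
    cases hpq
    rw [h4] at h4'
    cases h4'
    have := orbit_injective (altStep_injective hχ) (altStep_ne_start hχ hm)
      (altStep_ne_start hχ hm') h3 h3'
    obtain ⟨⟨u, c₀, c₁⟩, i⟩ := p
    obtain ⟨⟨u', c₀', c₁'⟩, j⟩ := q
    simp only [Prod.mk.injEq] at this
    obtain ⟨⟨rfl, rfl, rfl⟩, h⟩ := this
    obtain rfl : i = j := by omega
    rfl

end PathLengths

/-! ### The expected time for coloring edges -/

section Averages

variable {α : Type*} {l : List α}

theorem sum_map_ite_eq {β : Type*} [AddCommMonoid β] (l : List α) (p : α → Prop) [DecidablePred p]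
    (f : α → β) (X : β) :
    (l.map fun a => if p a then f a else X).sum =
      ((l.filter p).map f).sum + (l.filter fun a => ¬ p a).length • X := by
  induction l with
  | nil => simp
  | cons a l ih =>
    by_cases h : p a
    · simp only [List.map_cons, List.sum_cons, h, if_true, ih]
      simp [h, add_assoc]
    · simp only [List.map_cons, List.sum_cons, h, if_false, ih]
      simp [h, add_nsmul, add_comm, add_left_comm]

theorem length_ne_zero (hl : l ≠ []) : (l.length : ℝ≥0∞) ≠ 0 := by
  simpa using hl

theorem average_le {g : α → ℝ≥0∞} {B : ℝ≥0∞} (hg : ∀ a ∈ l, g a ≤ B) :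
    (l.map g).sum / l.length ≤ B := by
  refine ENNReal.div_le_of_le_mul ((List.sum_le_card_nsmul _ B ?_).trans ?_)
  · simpa using hg
  · simp [mul_comm]

theorem average_add_const (hl : l ≠ []) (g : α → ℝ≥0∞) (c : ℝ≥0∞) :
    (l.map fun a => g a + c).sum / l.length = (l.map g).sum / l.length + c := by
  rw [List.sum_map_add, ENNReal.add_div]
  congr 1
  simp only [List.map_const', List.sum_replicate, nsmul_eq_mul]
  rw [mul_comm, ENNReal.mul_div_cancel_right (length_ne_zero hl) (ENNReal.natCast_ne_top _)]

theorem average_mono {g g' : α → ℝ≥0∞} (h : ∀ a ∈ l, g a ≤ g' a) :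
    (l.map g).sum / l.length ≤ (l.map g').sum / l.length :=
  ENNReal.div_le_div_right (List.sum_le_sum h) _

theorem average_mul_const (g : α → ℝ≥0∞) (c : ℝ≥0∞) :
    (l.map fun a => g a * c).sum / l.length = (l.map g).sum / l.length * c := by
  rw [List.sum_map_mul_right, div_eq_mul_inv, div_eq_mul_inv, mul_right_comm]

end Averages

section ColorEdges

variable {n : ℕ} {E : Edges n} {K Δ : ℕ} {χ : Coloring n} {w : List Bool → ℝ≥0∞}
  {node : List Bool}

theorem foldl_filter_cons {α : Type*} (p : α → Prop) [DecidablePred p] (l A : List α) :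
    l.foldl (fun A c => if p c then c :: A else A) A = (l.filter p).reverse ++ A := by
  induction l generalizing A with
  | nil => rfl
  | cons x l ih =>
    rw [List.foldl_cons, ih]
    by_cases h : p x <;> simp [h]

/-- Sampling from the palette hits a missing color with probability at least one half if the degree
is at most half the maximum degree; the result is uniform among the missing colors. -/
theorem randomMissing_cost_le (hχ : Proper E (Δ + 1) χ) {u : Fin n} (hu : deg E u ≤ Δ)
    (f : ℕ → ℝ≥0∞) :
    (randomMissing node χ Δ (deg E u) u).cost w f ≤ ((2 * deg E u + 4 : ℕ) : ℝ≥0∞) * w node +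
      ((missing χ (Δ + 1) u).map f).sum / (missing χ (Δ + 1) u).length := by
  have hne : missing χ (Δ + 1) u ≠ [] := hχ.missing_ne_nil (by omega)
  rw [randomMissing]
  split_ifs with h
  · rw [cost_bind, cost_scan, foldl_filter_cons, cost_bind, cost_tick, List.append_nil]
    change _ + (w node + (unif (missing χ (Δ + 1) u).reverse).cost w f) ≤ _
    rw [cost_unif _ (by simpa using hne), List.length_range, ← add_assoc, List.length_reverse,
      List.map_reverse, List.sum_reverse]
    gcongr
    have : ((Δ + 1 : ℕ) : ℝ≥0∞) * w node + w node = ((Δ + 2 : ℕ) : ℝ≥0∞) * w node := by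
      push_cast
      ring
    rw [this]
    gcongr
    omega
  · set M := missing χ (Δ + 1) u with hM
    set avg := (M.map f).sum / M.length with havg
    refine (cost_loop_le _ _ (fun _ => 4 * w node + avg) (fun _ => ?_) ()).trans (by
      gcongr
      exact_mod_cast (by omega : 4 ≤ 2 * deg E u + 4))
    rw [cost_bind, cost_tick, cost_bind, cost_unif _ (by simp)]
    have h1 : ∀ c, ((tick node >>= fun _ => if nbr χ u c = none then
        (ret (Sum.inr c) : Prog (Unit ⊕ ℕ)) else ret (Sum.inl ())).cost w
          (Sum.elim (fun _ => 4 * w node + avg) f)) =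
        (if nbr χ u c = none then f c else 4 * w node + avg) + w node := by
      intro c
      rw [cost_bind, cost_tick, add_comm]
      split_ifs <;> rfl
    simp only [h1]
    rw [average_add_const (by simp), sum_map_ite_eq]
    have hfil : (List.range (Δ + 1)).filter (fun c => decide (nbr χ u c = none)) = M := rfl
    rw [hfil]
    set R := ((List.range (Δ + 1)).filter fun c => decide (¬ nbr χ u c = none)).length with hR
    have hlen : M.length + R = Δ + 1 := by
      have := List.length_eq_length_filter_add (l := List.range (Δ + 1))
        (fun c => decide (nbr χ u c = none))
      rw [List.length_range, hfil] at this
      rw [this, hR]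
      simp
    have h2R : 2 * R ≤ Δ + 1 := by
      have := hχ.le_length_missing u
      rw [← hM] at this
      omega
    have hF : (M.map f).sum = M.length * avg := by
      rw [havg, ENNReal.mul_div_cancel (length_ne_zero hne) (ENNReal.natCast_ne_top _)]
    have hdiv : ((M.map f).sum + R • (4 * w node + avg)) / ((List.range (Δ + 1)).length : ℝ≥0∞) ≤
        2 * w node + avg := by
      refine ENNReal.div_le_of_le_mul ?_
      rw [hF, List.length_range, nsmul_eq_mul, ← hlen]
      have h3 : ((2 * R : ℕ) : ℝ≥0∞) ≤ ((M.length + R : ℕ) : ℝ≥0∞) := by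
        rw [hlen]; exact_mod_cast h2R
      calc (M.length : ℝ≥0∞) * avg + R * (4 * w node + avg)
          = ((2 * R : ℕ) : ℝ≥0∞) * (2 * w node) + ((M.length + R : ℕ) : ℝ≥0∞) * avg := by
            push_cast; ring
        _ ≤ ((M.length + R : ℕ) : ℝ≥0∞) * (2 * w node) + ((M.length + R : ℕ) : ℝ≥0∞) * avg := by
            gcongr
        _ = _ := by ring
    calc _ ≤ w node + (2 * w node + avg + w node) := by gcongr
      _ = 4 * w node + avg := by ring

/-- The center of the fan for the edge `e`: its endpoint of smaller degree. -/
def center (E : Edges n) (e : Fin n × Fin n) : Fin n := if deg E e.1 ≤ deg E e.2 then e.1 else e.2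

theorem deg_center (e : Fin n × Fin n) : deg E (center E e) = wt E e := by
  rw [center, wt]
  split_ifs with h
  · exact (min_eq_left h).symm
  · exact (min_eq_right (by omega)).symm

/-- The expected length, for a random color `c₀`, of the alternating paths from `u`, without their
first and last edges, and added up over all colors `c₁`. -/
noncomputable def avgLen (χ : Coloring n) (K : ℕ) (u : Fin n) : ℝ≥0∞ :=
  ((missing χ K u).map fun c₀ =>
    ((∑ c₁ ∈ Finset.range K, (pathLen χ u c₀ c₁ - 2) : ℕ) : ℝ≥0∞)).sum / (missing χ K u).length

/-- The outcome of coloring the uncolored edge `e`. -/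
def Colored (E : Edges n) (K : ℕ) (χ : Coloring n) (e : Sym2 (Fin n)) (χ' : Coloring n) : Prop :=
  Proper E K χ' ∧ ∀ e', χ' e' = none ↔ χ e' = none ∧ e' ≠ e

theorem natCast_mul_le {a b : ℕ} (h : a ≤ b) (x : ℝ≥0∞) : (a : ℝ≥0∞) * x ≤ b * x := by
  gcongr

variable (heavy : Fin n → Prop) [DecidablePred heavy]

/-- The time for coloring the edge `e`, apart from the part of it that depends on the lengths of
alternating paths from vertices that are not heavy. -/
def edgeTime (E : Edges n) (e : Fin n × Fin n) : ℕ :=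
  20 * wt E e + if heavy (center E e) then 4 * n else 0

/-- The expected time for coloring the edge `e`, apart from `edgeTime`. -/
noncomputable def pathTime (E : Edges n) (χ : Coloring n) (K : ℕ) (e : Fin n × Fin n) : ℝ≥0∞ :=
  if heavy (center E e) then 0 else 2 * avgLen χ K (center E e)

theorem alternatingPath_extendColoring_cost_le (hE : Valid E) (hχ : Proper E K χ) {u v : Fin n}
    (huv : χ s(u, v) = none) {F : List (Fin n)} {c₀ c₁ : ℕ} (hF : IsFan E χ u v F)
    (hp : Primed K χ u F c₁) (hc₀ : c₀ ∈ missing χ K u) (f : Coloring n → ℝ≥0∞) :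
    (alternatingPath node χ u c₀ c₁ >>= fun q =>
        extendColoring node χ u F c₀ c₁ q.1 q.2).cost w f ≤
      ((2 * pathLen χ u c₀ c₁ + 2 * deg E u + 3 : ℕ) : ℝ≥0∞) * w node +
        ⨆ χ', ⨆ (_ : Colored E K χ s(u, v) χ'), f χ' := by
  rw [mem_missing] at hc₀
  refine ((alternatingPath_within hχ hc₀.2).bind
    (T' := pathLen χ u c₀ c₁ + 2 * deg E u + 2) (Q' := Colored E K χ s(u, v))
    (fun q hq => ?_) f).trans ?_
  · obtain ⟨hq1, a, ha, hm⟩ := hq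
    refine (extendColoring_within hE hχ huv hF hp hc₀.1 hc₀.2 ha hm).mono ?_ fun χ' h => h
    have := hF.length_le
    omega
  · exact add_le_add (natCast_mul_le (by omega) _) le_rfl

/-- The steps that follow the construction of a primed fan. The expectation is over `c₀` only. -/
theorem randomMissing_extendColoring_cost_le (hE : Valid E) (hΔ : ∀ v, deg E v ≤ Δ)
    (hχ : Proper E (Δ + 1) χ) {u v : Fin n} (huv : χ s(u, v) = none) {F : List (Fin n)} {c₁ : ℕ}
    (hF : IsFan E χ u v F) (hp : Primed (Δ + 1) χ u F c₁) (f : Coloring n → ℝ≥0∞) :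
    (randomMissing node χ Δ (deg E u) u >>= fun c₀ => alternatingPath node χ u c₀ c₁ >>= fun q =>
        extendColoring node χ u F c₀ c₁ q.1 q.2).cost w f ≤
      (((4 * deg E u + 11 : ℕ) : ℝ≥0∞) + ((if heavy u then 4 * n else 0 : ℕ) : ℝ≥0∞) +
        if heavy u then 0 else 2 * avgLen χ (Δ + 1) u) * w node +
        ⨆ χ', ⨆ (_ : Colored E (Δ + 1) χ s(u, v) χ'), f χ' := by
  have hne : missing χ (Δ + 1) u ≠ [] := hχ.missing_ne_nil (by have := hΔ u; omega)
  have main := fun c₀ (hc₀ : c₀ ∈ missing χ (Δ + 1) u) =>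
    alternatingPath_extendColoring_cost_le (w := w) (node := node) hE hχ huv hF hp hc₀ f
  rw [cost_bind]
  refine (randomMissing_cost_le hχ (hΔ u) _).trans ?_
  generalize ⨆ χ', ⨆ (_ : Colored E (Δ + 1) χ s(u, v) χ'), f χ' = S at *
  by_cases hh : heavy u
  · rw [if_pos hh, if_pos hh]
    have := average_le (l := missing χ (Δ + 1) u) (fun c₀ hc₀ => (main c₀ hc₀).trans
      (show _ ≤ ((4 * n + 2 * deg E u + 3 : ℕ) : ℝ≥0∞) * w node + S from
        add_le_add (natCast_mul_le (by
          have := pathLen_le (χ := χ) u c₀ c₁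
          omega) _) le_rfl))
    refine (add_le_add le_rfl this).trans ?_
    rw [← add_assoc, ← add_mul, add_zero, ← Nat.cast_add, ← Nat.cast_add]
    exact add_le_add (natCast_mul_le (by omega) _) le_rfl
  · rw [if_neg hh, if_neg hh]
    have hle : ∀ c₀ ∈ missing χ (Δ + 1) u,
        ((2 * pathLen χ u c₀ c₁ + 2 * deg E u + 3 : ℕ) : ℝ≥0∞) * w node + S ≤
        ((∑ c₁ ∈ Finset.range (Δ + 1), (pathLen χ u c₀ c₁ - 2) : ℕ) : ℝ≥0∞) * (2 * w node) +
          (((2 * deg E u + 7 : ℕ) : ℝ≥0∞) * w node + S) := by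
      intro c₀ _
      have h1 : pathLen χ u c₀ c₁ - 2 ≤
          ∑ c₁ ∈ Finset.range (Δ + 1), (pathLen χ u c₀ c₁ - 2) :=
        Finset.single_le_sum (f := fun c₁ => pathLen χ u c₀ c₁ - 2) (fun _ _ => Nat.zero_le _)
          (Finset.mem_range.2 hp.lt)
      generalize ∑ c₁ ∈ Finset.range (Δ + 1), (pathLen χ u c₀ c₁ - 2) = L at *
      calc _ ≤ ((L * 2 + (2 * deg E u + 7) : ℕ) : ℝ≥0∞) * w node + S :=
            add_le_add (natCast_mul_le (by omega) _) le_rfl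
        _ = _ := by push_cast; ring
    refine (add_le_add le_rfl (average_mono fun c₀ hc₀ =>
      (main c₀ hc₀).trans (hle c₀ hc₀))).trans ?_
    rw [average_add_const hne, average_mul_const]
    change _ + (avgLen χ (Δ + 1) u * (2 * w node) + _) ≤ _
    push_cast
    refine le_of_eq ?_
    ring

theorem makePrimedFan_extendColoring_cost_le (hE : Valid E) (hΔ : ∀ v, deg E v ≤ Δ)
    (hχ : Proper E (Δ + 1) χ) {u v : Fin n} (huv : χ s(u, v) = none) (hmem : s(u, v) ∈ sym E)
    (hpos : 0 < deg E u) (f : Coloring n → ℝ≥0∞) :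
    (makePrimedFan node χ (Δ + 1) u v >>= fun r => randomMissing node χ Δ (deg E u) u >>= fun c₀ =>
      alternatingPath node χ u c₀ r.2 >>= fun q =>
        extendColoring node χ u r.1 c₀ r.2 q.1 q.2).cost w f ≤
      (((18 * deg E u : ℕ) : ℝ≥0∞) + ((if heavy u then 4 * n else 0 : ℕ) : ℝ≥0∞) +
        if heavy u then 0 else 2 * avgLen χ (Δ + 1) u) * w node +
        ⨆ χ', ⨆ (_ : Colored E (Δ + 1) χ s(u, v) χ'), f χ' := by
  have hfan := makePrimedFan_within (w := w) (node := node) hχ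
    (fun x => Nat.lt_succ_of_le (hΔ x)) hmem
  rw [cost_bind]
  refine (hfan _).trans ?_
  refine (add_le_add le_rfl (iSup₂_le fun r hr =>
    randomMissing_extendColoring_cost_le heavy hE hΔ hχ huv hr.1 hr.2 f)).trans ?_
  generalize ⨆ χ', ⨆ (_ : Colored E (Δ + 1) χ s(u, v) χ'), f χ' = S
  generalize (if heavy u then 0 else 2 * avgLen χ (Δ + 1) u) = L
  generalize (if heavy u then 4 * n else 0) = N
  calc _ = ((4 * deg E u + 11 + 3 * deg E u : ℕ) : ℝ≥0∞) * w node +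
        ((N + L) * w node + S) := by push_cast; ring
    _ ≤ ((18 * deg E u : ℕ) : ℝ≥0∞) * w node + ((N + L) * w node + S) :=
        add_le_add (natCast_mul_le (by omega) _) le_rfl
    _ = _ := by push_cast; ring

theorem colorOneEdge_cost_le (hE : Valid E) (hΔ : ∀ v, deg E v ≤ Δ) (hχ : Proper E (Δ + 1) χ)
    (hU : uncolored E χ ≠ []) (f : Coloring n → ℝ≥0∞) :
    (colorOneEdge node E (deg E) Δ χ).cost w f ≤
      ((uncolored E χ).map fun e => (edgeTime heavy E e + pathTime heavy E χ (Δ + 1) e) * w node +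
        ⨆ χ', ⨆ (_ : Colored E (Δ + 1) χ s(e.1, e.2) χ'), f χ').sum / (uncolored E χ).length := by
  rw [colorOneEdge, cost_bind, cost_tick, cost_bind, cost_unif _ hU, add_comm (w node),
    ← average_add_const hU]
  refine average_mono fun e he => ?_
  rw [cost_bind, cost_tick]
  have heE : e ∈ E := (List.mem_filter.1 he).1
  have hnone : χ s(e.1, e.2) = none := by simpa using (List.mem_filter.1 he).2
  obtain ⟨v, hv⟩ : ∃ v, v = if deg E e.1 ≤ deg E e.2 then e.2 else e.1 := ⟨_, rfl⟩
  have hsym : s(e.1, e.2) = s(center E e, v) := by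
    rw [center, hv]
    split_ifs
    · rfl
    · exact Sym2.eq_swap
  have hdeg := deg_center (E := E) e
  have hwt := wt_pos heE
  dsimp only
  rw [edgeTime, pathTime, ← hdeg, ← hv]
  change w node + ((makePrimedFan node χ (Δ + 1) (center E e) v >>= fun r =>
    randomMissing node χ Δ (deg E (center E e)) (center E e) >>= fun c₀ =>
      alternatingPath node χ (center E e) c₀ r.2 >>= fun q =>
        extendColoring node χ (center E e) r.1 c₀ r.2 q.1 q.2).cost w f) + w node ≤ _
  have huv := mem_sym_of_mem heE
  rw [hsym] at hnone huv ⊢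
  rw [← hdeg] at hwt
  have hmain := makePrimedFan_extendColoring_cost_le (w := w) (node := node) heavy hE hΔ hχ hnone
    huv hwt f
  refine (add_le_add (add_le_add le_rfl hmain) le_rfl).trans ?_
  generalize ⨆ χ', ⨆ (_ : Colored E (Δ + 1) χ s(center E e, v) χ'), f χ' = S
  generalize deg E (center E e) = d at *
  generalize (if heavy (center E e) then 0 else 2 * avgLen χ (Δ + 1) (center E e)) = L
  generalize (if heavy (center E e) then 4 * n else 0) = N
  calc _ = ((18 * d + 2 : ℕ) : ℝ≥0∞) * w node + ((N + L) * w node + S) := by push_cast; ring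
    _ ≤ ((20 * d : ℕ) : ℝ≥0∞) * w node + ((N + L) * w node + S) :=
        add_le_add (natCast_mul_le (by omega) _) le_rfl
    _ = _ := by push_cast; ring

/-- All edges are colored. -/
def Full (E : Edges n) (K : ℕ) (χ : Coloring n) : Prop := Proper E K χ ∧ uncolored E χ = []

/-- The number of uncolored edges at a vertex `u` that is not heavy enters the expected length of
alternating paths only through its ratio to the number of the missing colors: `avgLen` divides by the
latter, and at most `deg (uncolored E χ) u` uncolored edges have their center at `u`. -/
theorem sum_pathTime_le (hE : Valid E) (hχ : Proper E (Δ + 1) χ) (hΔ : ∀ v, deg E v ≤ Δ)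
    {ρ : ℝ≥0∞} (hρ : ∀ u, ¬ heavy u →
      (deg (uncolored E χ) u : ℝ≥0∞) ≤ ρ * (missing χ (Δ + 1) u).length) :
    ((uncolored E χ).map (pathTime heavy E χ (Δ + 1))).sum ≤ 4 * ρ * totalWt E := by
  have h1 := sum_endpoint_le (hE.filter fun e => decide (χ s(e.1, e.2) = none))
    (fun u => if heavy u then 0 else 2 * avgLen χ (Δ + 1) u) (center E) fun e => by
      rw [center]; split_ifs <;> simp
  refine h1.trans ?_
  have h2 : ∀ u, (deg (uncolored E χ) u : ℝ≥0∞) *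
      (if heavy u then 0 else 2 * avgLen χ (Δ + 1) u) ≤ 2 * ρ *
        ((∑ c₀ ∈ (missing χ (Δ + 1) u).toFinset, ∑ c₁ ∈ Finset.range (Δ + 1),
          (pathLen χ u c₀ c₁ - 2) : ℕ) : ℝ≥0∞) := by
    intro u
    split_ifs with hh
    · simp
    have hne : missing χ (Δ + 1) u ≠ [] := hχ.missing_ne_nil (by have := hΔ u; omega)
    rw [List.sum_toFinset _ (nodup_missing u)]
    have h3 : (((missing χ (Δ + 1) u).map fun c₀ => ∑ c₁ ∈ Finset.range (Δ + 1),
        (pathLen χ u c₀ c₁ - 2)).sum : ℝ≥0∞) =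
        (missing χ (Δ + 1) u).length * avgLen χ (Δ + 1) u := by
      rw [avgLen, ENNReal.mul_div_cancel (length_ne_zero hne) (ENNReal.natCast_ne_top _)]
      rw [Nat.cast_list_sum, List.map_map]
      rfl
    rw [h3]
    calc _ ≤ ρ * (missing χ (Δ + 1) u).length * (2 * avgLen χ (Δ + 1) u) := by
          gcongr
          exact hρ u hh
      _ = _ := by ring
  calc _ ≤ ∑ u, 2 * ρ * ((∑ c₀ ∈ (missing χ (Δ + 1) u).toFinset, ∑ c₁ ∈ Finset.range (Δ + 1),
          (pathLen χ u c₀ c₁ - 2) : ℕ) : ℝ≥0∞) := Finset.sum_le_sum fun u _ => h2 u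
    _ = 2 * ρ * ((∑ u, ∑ c₀ ∈ (missing χ (Δ + 1) u).toFinset, ∑ c₁ ∈ Finset.range (Δ + 1),
          (pathLen χ u c₀ c₁ - 2) : ℕ) : ℝ≥0∞) := by
        rw [← Finset.mul_sum, Nat.cast_sum]
    _ ≤ 2 * ρ * ((2 * totalWt E : ℕ) : ℝ≥0∞) := by
        gcongr
        exact sum_pathLen_le hE hχ
    _ = _ := by push_cast; ring

/-- The harmonic numbers. -/
noncomputable def harm (l : ℕ) : ℝ≥0∞ := ∑ j ∈ Finset.range l, ((j + 1 : ℕ) : ℝ≥0∞)⁻¹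

theorem Colored.uncolored_eq (hE : Valid E) {e : Fin n × Fin n} {χ' : Coloring n} (he : e ∈ E)
    (h : Colored E K χ s(e.1, e.2) χ') : uncolored E χ' = (uncolored E χ).erase e := by
  have hnd : E.Nodup := List.Nodup.of_map _ hE.nodup
  rw [uncolored, uncolored, (hnd.filter _).erase_eq_filter, List.filter_filter]
  refine List.filter_congr fun e' he' => ?_
  have : s(e'.1, e'.2) = s(e.1, e.2) ↔ e' = e :=
    ⟨fun h' => List.inj_on_of_nodup_map hE.nodup he' he h', fun h' => by rw [h']⟩
  rw [Bool.eq_iff_iff]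
  simp [h.2, this, and_comm]

/-- `Color-Edges`. Every uncolored edge is chosen once, which gives the sum of `edgeTime`. When `l`
edges are uncolored, each of them is chosen with probability `1 / l`, and this leads to the
harmonic number. -/
theorem colorEdges_cost_le (hE : Valid E) (hΔ : ∀ v, deg E v ≤ Δ) (κ : ℕ) (ρ : ℝ≥0∞)
    (hρ : ∀ χ, Proper E (Δ + 1) χ → (∀ u, deg (uncolored E χ) u ≤ κ) → ∀ u, ¬ heavy u →
      (deg (uncolored E χ) u : ℝ≥0∞) ≤ ρ * (missing χ (Δ + 1) u).length)
    (hχ : Proper E (Δ + 1) χ) (hκ : ∀ u, deg (uncolored E χ) u ≤ κ) (f : Coloring n → ℝ≥0∞) :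
    (colorEdges node E (deg E) Δ χ).cost w f ≤
      (E.length + (1 + ((uncolored E χ).map fun e => (edgeTime heavy E e + 1 : ℝ≥0∞)).sum +
        4 * ρ * totalWt E * harm (uncolored E χ).length)) * w node +
      ⨆ χ', ⨆ (_ : Full E (Δ + 1) χ'), f χ' := by
  classical
  set S := ⨆ χ', ⨆ (_ : Full E (Δ + 1) χ'), f χ' with hS
  set b := 4 * ρ * totalWt E with hb
  let Ψ : Edges n → ℝ≥0∞ := fun U =>
    1 + (U.map fun e => (edgeTime heavy E e + 1 : ℝ≥0∞)).sum + b * harm U.length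
  let I : Coloring n → Prop := fun χ =>
    Proper E (Δ + 1) χ ∧ ∀ u, deg (uncolored E χ) u ≤ κ
  let X : Coloring n → ℝ≥0∞ := fun χ => if I χ then Ψ (uncolored E χ) * w node + S else ⊤
  have hX : ∀ χ, I χ → X χ = Ψ (uncolored E χ) * w node + S := fun χ h => if_pos h
  rw [colorEdges, cost_bind, cost_pass, add_mul, add_assoc]
  refine add_le_add le_rfl ((cost_loop_le _ _ X (fun χ => ?_) χ).trans (hX χ ⟨hχ, hκ⟩).le)
  by_cases hI : I χ
  swap
  · simp [X, hI]
  rw [hX χ hI, cost_bind, cost_tick]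
  split_ifs with hU
  · rw [cost_ret, hU, Sum.elim_inr]
    refine add_le_add ?_ (le_iSup₂_of_le (f := fun χ' (_ : Full E (Δ + 1) χ') => f χ') χ
      ⟨hI.1, hU⟩ le_rfl)
    simp [Ψ, harm]
  · set U := uncolored E χ with hUdef
    set l : ℝ≥0∞ := (U.length : ℝ≥0∞) with hl
    have hl0 : l ≠ 0 := length_ne_zero hU
    have hlt : l ≠ ⊤ := ENNReal.natCast_ne_top _
    rw [cost_bind]
    simp only [cost_ret, Sum.elim_inl]
    refine (add_le_add le_rfl (colorOneEdge_cost_le heavy hE hΔ hI.1 hU X)).trans ?_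
    rw [← hUdef]
    set A := (U.map fun e => (edgeTime heavy E e + 1 : ℝ≥0∞)).sum with hA
    have hstep : ∀ e ∈ U, (edgeTime heavy E e + pathTime heavy E χ (Δ + 1) e) * w node +
        ⨆ χ', ⨆ (_ : Colored E (Δ + 1) χ s(e.1, e.2) χ'), X χ' ≤
        pathTime heavy E χ (Δ + 1) e * w node + ((A + b * harm (U.length - 1)) * w node + S) := by
      intro e he
      have heE : e ∈ E := (List.mem_filter.1 he).1
      have hsup : ⨆ χ', ⨆ (_ : Colored E (Δ + 1) χ s(e.1, e.2) χ'), X χ' ≤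
          Ψ (U.erase e) * w node + S := by
        refine iSup₂_le fun χ' hχ' => ?_
        have hun := hχ'.uncolored_eq hE heE
        rw [hX χ' ⟨hχ'.1, fun u => (deg_mono (fun e' he' => ?_) u).trans (hI.2 u)⟩, hun]
        rw [mem_sym_uncolored] at he' ⊢
        exact ⟨he'.1, ((hχ'.2 _).1 he'.2).1⟩
      refine (add_le_add le_rfl hsup).trans ?_
      have hAe : (edgeTime heavy E e + 1 : ℝ≥0∞) +
          ((U.erase e).map fun e => (edgeTime heavy E e + 1 : ℝ≥0∞)).sum = A := by
        rw [hA, ((List.perm_cons_erase he).map _).sum_eq, List.map_cons, List.sum_cons]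
      simp only [Ψ, List.length_erase_of_mem he]
      rw [← hAe]
      refine le_of_eq ?_
      ring
    refine (add_le_add le_rfl (average_mono hstep)).trans ?_
    rw [average_add_const hU, average_mul_const]
    have hp : (U.map (pathTime heavy E χ (Δ + 1))).sum ≤ b :=
      sum_pathTime_le heavy hE hI.1 hΔ (hρ χ hI.1 hI.2)
    have hh : harm U.length = harm (U.length - 1) + l⁻¹ := by
      obtain ⟨k, hk⟩ := Nat.exists_eq_add_of_lt (List.length_pos_iff.2 hU)
      rw [hl, hk]
      simp [harm, Finset.sum_range_succ]
    have hp' : (U.map (pathTime heavy E χ (Δ + 1))).sum / (U.length : ℝ≥0∞) ≤ b * l⁻¹ := by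
      rw [div_eq_mul_inv]
      gcongr
    calc _ ≤ w node + (b * l⁻¹ * w node + ((A + b * harm (U.length - 1)) * w node + S)) := by
          gcongr
      _ = Ψ U * w node + S := by
          simp only [Ψ, hh]
          ring

end ColorEdges

/-! ### The Euler partition -/

section Euler

variable {n : ℕ} {E : Edges n}

/-- The sign of a side of the partition. -/
def sgn (b : Bool) : ℤ := if b then -1 else 1

/-- The sign of the side of an edge; `0` if the edge lies on neither side. -/
def sideSign : Option Bool → ℤ
  | none => 0
  | some b => sgn b

/-- The number of edges at `v` on the side `false` minus the number of those on the side `true`. -/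
def balance (side : Sym2 (Fin n) → Option Bool) (v : Fin n) : ℤ := ∑ y, sideSign (side s(v, y))

/-- The total length of the parts of the adjacency lists that have not been looked at. -/
def remaining (S : TourState n) : ℕ := ∑ v, (S.adj v).length

theorem sgn_not (b : Bool) : sgn (!b) = -sgn b := by cases b <;> simp [sgn]

theorem balance_update {side : Sym2 (Fin n) → Option Bool} {x y : Fin n} (hxy : x ≠ y)
    (h : side s(x, y) = none) (b : Bool) (v : Fin n) :
    balance (Function.update side s(x, y) (some b)) v =
      balance side v + ((if v = x then sgn b else 0) + if v = y then sgn b else 0) := by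
  rw [balance, balance, ← sum_ite_mk_eq hxy, ← Finset.sum_add_distrib]
  refine Finset.sum_congr rfl fun z _ => ?_
  rw [Function.update_apply]
  split_ifs with h'
  · rw [h', h]
    simp [sideSign]
  · simp

theorem remaining_update {S : TourState n} {x y : Fin n} {ys : List (Fin n)}
    (h : S.adj x = y :: ys) (side : Sym2 (Fin n) → Option Bool) :
    remaining ⟨Function.update S.adj x ys, side⟩ + 1 = remaining S := by
  have : ∀ v, (S.adj v).length =
      (Function.update S.adj x ys v).length + if v = x then 1 else 0 := fun v => by
    by_cases hv : v = x
    · subst hv; simp [h]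
    · simp [hv]
  simp [remaining, this, Finset.sum_add_distrib]

/-- Every edge that is not on a tour is still in the adjacency lists of its ends. -/
structure TourInv (E : Edges n) (S : TourState n) : Prop where
  adj_mem : ∀ x y, y ∈ S.adj x → s(x, y) ∈ sym E
  side_mem : ∀ e, S.side e ≠ none → e ∈ sym E
  unused : ∀ x y, s(x, y) ∈ sym E → S.side s(x, y) = none → y ∈ S.adj x

/-- Some edge at `v` is not on a tour. -/
def HasUnused (E : Edges n) (S : TourState n) (v : Fin n) : Prop :=
  ∃ y, s(v, y) ∈ sym E ∧ S.side s(v, y) = none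

theorem TourInv.not_hasUnused {S : TourState n} (h : TourInv E S) {v : Fin n}
    (hv : S.adj v = []) : ¬ HasUnused E S v := by
  rintro ⟨y, h1, h2⟩
  have := h.unused v y h1 h2
  rw [hv] at this
  cases this

theorem HasUnused.mono {S S' : TourState n} (h : ∀ e, S.side e ≠ none → S'.side e ≠ none)
    {v : Fin n} (hv : HasUnused E S' v) : HasUnused E S v := by
  obtain ⟨y, h1, h2⟩ := hv
  exact ⟨y, h1, by by_contra h3; exact h _ h3 h2⟩

/-- A walk from `x` changes the balance at `x`, and at the vertex where it gets stuck, by one. -/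
theorem walk_spec (hE : Valid E) (S : TourState n) (x : Fin n) (b : Bool) (hS : TourInv E S) :
    TourInv E (walk S x b).1 ∧ (∀ e, S.side e ≠ none → (walk S x b).1.side e ≠ none) ∧
    (walk S x b).2 + remaining (walk S x b).1 = remaining S + 1 ∧
    ∃ z b', (walk S x b).1.adj z = [] ∧ (z = x ∨ HasUnused E S z) ∧
      ∀ v, balance (walk S x b).1.side v + (if v = z then sgn b' else 0) =
        balance S.side v + if v = x then sgn b else 0 := by
  induction S, x, b using walk.induct with
  | case1 S x b h =>
    rw [walk]
    split
    · exact ⟨hS, fun _ h => h, Nat.add_comm _ _, x, b, h, Or.inl rfl, fun _ => rfl⟩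
    · rename_i h'
      rw [h] at h'
      cases h'
  | case2 S x b y ys h hnone ih =>
    have hmem := hS.adj_mem x y (by rw [h]; exact List.mem_cons_self)
    have hne := hE.ne_of_mem hmem
    have hS' : TourInv E ⟨Function.update S.adj x ys,
        Function.update S.side s(x, y) (some b)⟩ := by
      refine ⟨fun v t ht => ?_, fun e he => ?_, fun v t hvt hn => ?_⟩
      · by_cases hv : v = x
        · subst hv
          simp only [Function.update_self] at ht
          exact hS.adj_mem v t (by rw [h]; exact List.mem_cons_of_mem _ ht)
        · simp only [Function.update_of_ne hv] at ht
          exact hS.adj_mem v t ht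
      · by_cases h1 : e = s(x, y)
        · rwa [h1]
        · simp only [Function.update_of_ne h1] at he
          exact hS.side_mem e he
      · have h1 : s(v, t) ≠ s(x, y) := by
          intro h1
          simp [h1] at hn
        simp only [Function.update_of_ne h1] at hn
        have := hS.unused v t hvt hn
        by_cases hv : v = x
        · subst hv
          simp only [Function.update_self]
          rw [h] at this
          exact (List.mem_cons.1 this).resolve_left fun h2 => h1 (by rw [h2])
        · simpa only [Function.update_of_ne hv] using this
    have hmono : ∀ e, S.side e ≠ none →
        Function.update S.side s(x, y) (some b) e ≠ none := fun e he => by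
      rw [Function.update_apply]
      split_ifs
      · simp
      · exact he
    obtain ⟨i1, i2, i3, z, b', i4, i5, i6⟩ := ih hS'
    have hrem := remaining_update h (Function.update S.side s(x, y) (some b))
    rw [walk]
    split
    · rename_i h'
      rw [h] at h'
      cases h'
    · rename_i y' ys' h'
      rw [h] at h'
      cases h'
      rw [if_pos hnone]
      refine ⟨i1, fun e he => i2 e (hmono e he), ?_, z, b', i4, Or.inr ?_, fun v => ?_⟩
      · dsimp only
        omega
      · rcases i5 with rfl | i5
        · rw [Sym2.eq_swap] at hmem hnone
          exact ⟨x, hmem, hnone⟩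
        · exact i5.mono hmono
      · dsimp only
        rw [i6, balance_update hne hnone, sgn_not]
        split_ifs <;> ring
  | case3 S x b y ys h hsome ih =>
    have hS' : TourInv E ⟨Function.update S.adj x ys, S.side⟩ := by
      refine ⟨fun v t ht => ?_, hS.side_mem, fun v t hvt hn => ?_⟩
      · by_cases hv : v = x
        · subst hv
          simp only [Function.update_self] at ht
          exact hS.adj_mem v t (by rw [h]; exact List.mem_cons_of_mem _ ht)
        · simp only [Function.update_of_ne hv] at ht
          exact hS.adj_mem v t ht
      · have := hS.unused v t hvt hn
        by_cases hv : v = x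
        · subst hv
          simp only [Function.update_self]
          rw [h] at this
          refine (List.mem_cons.1 this).resolve_left fun h2 => hsome ?_
          rw [← h2]
          exact hn
        · simpa only [Function.update_of_ne hv] using this
    obtain ⟨i1, i2, i3, z, b', i4, i5, i6⟩ := ih hS'
    have hrem := remaining_update h S.side
    rw [walk]
    split
    · rename_i h'
      rw [h] at h'
      cases h'
    · rename_i y' ys' h'
      rw [h] at h'
      cases h'
      rw [if_neg hsome]
      exact ⟨i1, i2, by dsimp only; omega, z, b', i4, i5, i6⟩

/-- A tour is extended until it gets stuck at both ends, so a vertex is the end of at most one tour,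
and it has no unused edge afterwards. -/
theorem tours_spec (hE : Valid E) (es : Edges n) (S : TourState n) (hS : TourInv E S)
    (hes : ∀ e ∈ es, s(e.1, e.2) ∈ sym E) (h2 : ∀ v, |balance S.side v| ≤ 2)
    (h0 : ∀ v, HasUnused E S v → balance S.side v = 0) :
    TourInv E (tours es S).1 ∧ (∀ e, S.side e ≠ none → (tours es S).1.side e ≠ none) ∧
    (∀ e ∈ es, (tours es S).1.side s(e.1, e.2) ≠ none) ∧
    (∀ v, |balance (tours es S).1.side v| ≤ 2) ∧
    (tours es S).2 + remaining (tours es S).1 ≤ remaining S + 3 * es.length := by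
  induction es generalizing S with
  | nil => exact ⟨hS, fun _ h => h, by simp, h2, by simp [tours]⟩
  | cons e es ih =>
    have hes' : ∀ e ∈ es, s(e.1, e.2) ∈ sym E := fun e' he' => hes e' (List.mem_cons_of_mem _ he')
    have hmem := hes e List.mem_cons_self
    have hne := hE.ne_of_mem hmem
    rw [tours]
    split_ifs with hn
    · have hS₀ : TourInv E ⟨S.adj, Function.update S.side s(e.1, e.2) (some false)⟩ := by
        refine ⟨hS.adj_mem, fun e' he' => ?_, fun v t hvt ht => ?_⟩
        · by_cases h1 : e' = s(e.1, e.2)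
          · rwa [h1]
          · simp only [Function.update_of_ne h1] at he'
            exact hS.side_mem e' he'
        · have h1 : s(v, t) ≠ s(e.1, e.2) := by
            intro h1
            simp [h1] at ht
          simp only [Function.update_of_ne h1] at ht
          exact hS.unused v t hvt ht
      have hm₀ : ∀ e', S.side e' ≠ none →
          Function.update S.side s(e.1, e.2) (some false) e' ≠ none := fun e' he' => by
        rw [Function.update_apply]
        split_ifs
        · simp
        · exact he'
      obtain ⟨i1, i2, i3, z, b, i4, i5, i6⟩ := walk_spec hE _ e.2 true hS₀
      set r₁ := walk ⟨S.adj, Function.update S.side s(e.1, e.2) (some false)⟩ e.2 true with hr₁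
      obtain ⟨j1, j2, j3, z', b', j4, j5, j6⟩ := walk_spec hE _ e.1 true i1
      set r₂ := walk r₁.1 e.1 true with hr₂
      have hz : HasUnused E S z := by
        rcases i5 with rfl | i5
        · exact ⟨e.1, by rwa [Sym2.eq_swap], by rwa [Sym2.eq_swap]⟩
        · exact i5.mono hm₀
      have hz' : HasUnused E S z' := by
        rcases j5 with rfl | j5
        · exact ⟨e.2, hmem, hn⟩
        · exact (j5.mono i2).mono hm₀
      have hbal : ∀ v, balance r₂.1.side v = balance S.side v -
          (if v = z then sgn b else 0) - if v = z' then sgn b' else 0 := by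
        intro v
        have e1 := i6 v
        have e2 := j6 v
        have hneg : ∀ t : Fin n, (if v = t then sgn true else 0) =
            -(if v = t then sgn false else 0) := fun t => by split_ifs <;> simp [sgn]
        rw [balance_update hne hn, hneg] at e1
        rw [hneg] at e2
        linarith
      have hmono : ∀ e', S.side e' ≠ none → r₂.1.side e' ≠ none := fun e' he' =>
        j2 e' (i2 e' (hm₀ e' he'))
      have hb2 : ∀ v, |balance r₂.1.side v| ≤ 2 := fun v => by
        rw [hbal]
        by_cases h1 : HasUnused E S v
        · rw [h0 v h1]
          clear hbal i6 j6
          cases b <;> cases b' <;> split_ifs <;> simp [sgn]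
        · rw [if_neg (by rintro rfl; exact h1 hz), if_neg (by rintro rfl; exact h1 hz')]
          simpa using h2 v
      have hb0 : ∀ v, HasUnused E r₂.1 v → balance r₂.1.side v = 0 := fun v hv => by
        rw [hbal, if_neg, if_neg]
        · simpa using h0 v (hv.mono hmono)
        · rintro rfl
          exact j1.not_hasUnused j4 hv
        · rintro rfl
          exact i1.not_hasUnused i4 (hv.mono j2)
      obtain ⟨k1, k2, k3, k4, k5⟩ := ih r₂.1 j1 hes' hb2 hb0
      refine ⟨k1, fun e' he' => k2 e' (hmono e' he'), fun e' he' => ?_, k4, ?_⟩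
      · rcases List.mem_cons.1 he' with rfl | he'
        · exact k2 _ (j2 _ (i2 _ (by simp)))
        · exact k3 e' he'
      · have hr : remaining ⟨S.adj, Function.update S.side s(e.1, e.2) (some false)⟩ =
          remaining S := rfl
        rw [List.length_cons]
        change (tours es r₂.1).2 + r₂.2 + r₁.2 + 1 + remaining (tours es r₂.1).1 ≤ _
        omega
    · obtain ⟨k1, k2, k3, k4, k5⟩ := ih S hS hes' h2 h0
      refine ⟨k1, k2, fun e' he' => ?_, k4, ?_⟩
      · rcases List.mem_cons.1 he' with rfl | he'
        · exact k2 _ hn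
        · exact k3 e' he'
      · rw [List.length_cons]
        dsimp only
        omega

theorem allTours_spec (hE : Valid E) : TourInv E (allTours E).1 ∧
    (∀ e ∈ sym E, (allTours E).1.side e ≠ none) ∧
    (∀ v, |balance (allTours E).1.side v| ≤ 2) ∧ (allTours E).2 ≤ 5 * E.length := by
  have hrem : remaining ⟨adjacency E, fun _ => none⟩ = 2 * E.length := by
    refine (foldl_adjacency_length (fun _ => []) hE).trans ?_
    simp
  have hmem : ∀ x y, y ∈ adjacency E x ↔ s(x, y) ∈ sym E := fun x y =>
    (mem_foldl_adjacency (E := E) (fun _ => []) x y).trans (by simp)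
  obtain ⟨h1, -, h3, h4, h5⟩ := tours_spec hE E ⟨adjacency E, fun _ => none⟩
    ⟨fun x y h => (hmem x y).1 h, fun e he => absurd rfl he, fun x y h _ => (hmem x y).2 h⟩
    (fun e he => mem_sym_of_mem he) (fun v => by simp [balance, sideSign])
    (fun v _ => by simp [balance, sideSign])
  refine ⟨h1, fun e he => ?_, h4, ?_⟩
  · obtain ⟨e', he', rfl⟩ := List.mem_map.1 he
    exact h3 e' he'
  · rw [hrem] at h5
    change (tours E ⟨adjacency E, fun _ => none⟩).2 ≤ _
    omega

theorem partitionSteps_le (hE : Valid E) : partitionSteps E ≤ 7 * E.length := by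
  have := (allTours_spec hE).2.2.2
  rw [partitionSteps]
  omega

theorem two_mul_deg_part_le (hE : Valid E) (b : Bool) (v : Fin n) :
    2 * deg (part E b) v ≤ deg E v + 2 := by
  obtain ⟨h1, h2, h3, -⟩ := allTours_spec hE
  have key : (2 * deg (part E b) v : ℤ) = deg E v + sgn b * balance (allTours E).1.side v := by
    rw [deg_eq_sum, deg_eq_sum, balance, Finset.mul_sum]
    push_cast
    rw [Finset.mul_sum, ← Finset.sum_add_distrib]
    refine Finset.sum_congr rfl fun y _ => ?_
    simp only [mem_sym_part]
    by_cases hy : s(v, y) ∈ sym E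
    · obtain ⟨b', hb'⟩ := Option.ne_none_iff_exists'.1 (h2 _ hy)
      cases b <;> cases b' <;> simp [hy, hb', sideSign, sgn]
    · have : (allTours E).1.side s(v, y) = none := by
        by_contra h
        exact hy (h1.side_mem _ h)
      simp [hy, this, sideSign]
  have h4 := abs_le.1 (h3 v)
  cases b <;> simp [sgn] at key <;> omega

theorem two_mul_maxDeg_part_le (hE : Valid E) (b : Bool) :
    2 * maxDeg (part E b) ≤ maxDeg E + 2 := by
  have : maxDeg (part E b) ≤ (maxDeg E + 2) / 2 := Finset.sup_le fun v _ => by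
    have h1 := two_mul_deg_part_le hE b v
    have h2 := deg_le_maxDeg (E := E) v
    omega
  omega

theorem mem_sym_part_or (hE : Valid E) {e : Sym2 (Fin n)} (he : e ∈ sym E) :
    e ∈ sym (part E false) ∨ e ∈ sym (part E true) := by
  obtain ⟨b, hb⟩ := Option.ne_none_iff_exists'.1 ((allTours_spec hE).2.1 e he)
  cases b
  · exact Or.inl (mem_sym_part.2 ⟨he, hb⟩)
  · exact Or.inr (mem_sym_part.2 ⟨he, hb⟩)

end Euler

/-! ### Merging and pruning -/

section MergePrune

variable {n : ℕ} {E : Edges n} {K : ℕ} {χ : Coloring n} {w : List Bool → ℝ≥0∞} {node : List Bool}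

theorem uncolored_eq_nil : uncolored E χ = [] ↔ ∀ e ∈ sym E, χ e ≠ none := by
  rw [uncolored, List.filter_eq_nil_iff, sym, List.forall_mem_map]
  simp

/-- A pass over the edges that updates each edge by itself updates all edges at once, because no edge
is listed twice. -/
theorem foldl_update_sym (r : Sym2 (Fin n) → Option ℕ → Option ℕ) (L : Edges n)
    (hL : (sym L).Nodup) (χ : Coloring n) (x : Sym2 (Fin n)) :
    L.foldl (fun (χ : Coloring n) e =>
      Function.update χ s(e.1, e.2) (r s(e.1, e.2) (χ s(e.1, e.2)))) χ x =
      if x ∈ sym L then r x (χ x) else χ x := by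
  induction L generalizing χ with
  | nil => simp [sym]
  | cons e L ih =>
    obtain ⟨h1, h2⟩ := List.nodup_cons.1 (show (s(e.1, e.2) :: sym L).Nodup from hL)
    rw [List.foldl_cons, ih h2]
    have hmem : x ∈ sym (e :: L) ↔ x = s(e.1, e.2) ∨ x ∈ sym L := List.mem_cons
    simp only [hmem]
    by_cases hx : x = s(e.1, e.2)
    · subst hx
      simp [h1]
    · simp [hx]

theorem foldl_uncolor (L : Edges n) :
    L.foldl (fun (χ : Coloring n) e => Function.update χ s(e.1, e.2) none) (fun _ => none) =
      fun _ => none := by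
  induction L with
  | nil => rfl
  | cons e L ih =>
    rw [List.foldl_cons]
    convert ih using 2
    exact Function.update_eq_self s(e.1, e.2) (fun _ => none)

theorem proper_none (E : Edges n) (K : ℕ) : Proper E K (fun _ => none) :=
  ⟨fun _ h => absurd rfl h, fun _ _ h => by simp at h, fun _ _ _ _ h => by simp at h⟩

theorem merge_within (hE : Valid E) {K₁ K₂ : ℕ} {χ₁ χ₂ : Coloring n}
    (h₁ : Full (part E false) K₁ χ₁) (h₂ : Full (part E true) K₂ χ₂) :
    Within w node (merge node (part E false) (part E true) χ₁ χ₂ K₁) (4 * E.length)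
      (Full E (K₁ + K₂)) := by
  have hl : ∀ b, (part E b).length ≤ E.length := fun b => List.length_filter_le _ _
  have hv₁ : Valid (part E false) := hE.filter _
  have hv₂ : Valid (part E true) := hE.filter _
  rw [merge, emptyColoring]
  refine Within.mono (T := (part E false ++ part E true).length +
    ((part E false).length + (part E true).length)) (Within.scan_bind (Within.scan_bind
      (Within.scan (Q := Full E (K₁ + K₂)) ?_))) ?_ fun _ h => h
  swap
  · have := hl false
    have := hl true
    rw [List.length_append]
    omega
  rw [foldl_uncolor]
  set χ := (part E true).foldl (fun (χ : Coloring n) e =>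
    Function.update χ s(e.1, e.2) ((χ₂ s(e.1, e.2)).map fun c => K₁ + c))
    ((part E false).foldl (fun (χ : Coloring n) e =>
      Function.update χ s(e.1, e.2) (χ₁ s(e.1, e.2))) fun _ => none) with hχdef
  have hχ : ∀ x, χ x = if x ∈ sym (part E true) then (χ₂ x).map (fun c => K₁ + c) else
      if x ∈ sym (part E false) then χ₁ x else none := by
    intro x
    rw [hχdef, foldl_update_sym (fun e _ => (χ₂ e).map fun c => K₁ + c) _ hv₂.nodup,
      foldl_update_sym (fun e _ => χ₁ e) _ hv₁.nodup]
  have hcases : ∀ x c, χ x = some c →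
      (c < K₁ ∧ χ₁ x = some c) ∨ ∃ d, c = K₁ + d ∧ χ₂ x = some d := by
    intro x c hc
    rw [hχ] at hc
    split_ifs at hc
    · obtain ⟨d, hd, rfl⟩ := Option.map_eq_some_iff.1 hc
      exact Or.inr ⟨d, rfl, hd⟩
    · exact Or.inl ⟨h₁.1.lt _ _ hc, hc⟩
  refine ⟨⟨fun e he => ?_, fun e c hc => ?_, fun v x y c hx hy => ?_⟩, uncolored_eq_nil.2 ?_⟩
  · rw [hχ] at he
    split_ifs at he with h1 h2
    · exact (mem_sym_part.1 h1).1
    · exact (mem_sym_part.1 h2).1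
    · exact absurd rfl he
  · rcases hcases e c hc with h | ⟨d, rfl, hd⟩
    · omega
    · have := h₂.1.lt _ _ hd
      omega
  · rcases hcases _ c hx with ⟨h3, h4⟩ | ⟨d, rfl, hd⟩
    · rcases hcases _ c hy with ⟨-, h5⟩ | ⟨d, rfl, hd⟩
      · exact h₁.1.inj v x y c h4 h5
      · omega
    · rcases hcases _ _ hy with ⟨h5, -⟩ | ⟨d', h6, hd'⟩
      · omega
      · obtain rfl : d = d' := by omega
        exact h₂.1.inj v x y d hd hd'
  · intro e he
    rw [hχ]
    split_ifs with h1 h2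
    · simpa using uncolored_eq_nil.1 h₂.2 e h1
    · exact uncolored_eq_nil.1 h₁.2 e h2
    · exact absurd (mem_sym_part_or hE he) (by tauto)

/-- The weight of a color class. -/
def classWt (E : Edges n) (χ : Coloring n) (c : ℕ) : ℕ :=
  (E.map fun e => if χ s(e.1, e.2) = some c then wt E e else 0).sum

/-- The weight of the uncolored edges. -/
def uncoloredWt (E : Edges n) (χ : Coloring n) : ℕ :=
  (E.map fun e => if χ s(e.1, e.2) = none then wt E e else 0).sum

theorem uncoloredWt_eq : uncoloredWt E χ = ((uncolored E χ).map (wt E)).sum := by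
  rw [uncoloredWt, sum_map_ite_eq E (fun e => χ s(e.1, e.2) = none) (wt E)]
  simp [uncolored]

theorem foldl_add_apply {ε : Type*} (g : (ℕ → ℕ) → ε → ℕ → ℕ) (h : ε → ℕ → ℕ)
    (hg : ∀ W e c, g W e c = W c + h e c) (L : List ε) (W : ℕ → ℕ) (c : ℕ) :
    L.foldl g W c = W c + (L.map fun e => h e c).sum := by
  induction L generalizing W with
  | nil => simp
  | cons e L ih => rw [List.foldl_cons, ih, hg, List.map_cons, List.sum_cons, add_assoc]

theorem classWeights_within : Within w node (classWeights node E (deg E) χ) E.length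
    (fun W => W = classWt E χ) := by
  rw [classWeights]
  refine Within.scan (funext fun c => ?_)
  rw [foldl_add_apply _ (fun e c => if χ s(e.1, e.2) = some c then wt E e else 0)]
  · simp [classWt]
  · intro W e c
    cases h : χ s(e.1, e.2) with
    | none => simp
    | some c' =>
      by_cases hc : c = c'
      · subst hc
        simp [wt]
      · simp [hc, Ne.symm hc]

theorem foldl_argmin (W : ℕ → ℕ) (l : List ℕ) (c : ℕ) :
    (l.foldl (fun c c' => if W c' < W c then c' else c) c ∈ c :: l) ∧
    W (l.foldl (fun c c' => if W c' < W c then c' else c) c) ≤ W c ∧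
    ∀ c' ∈ l, W (l.foldl (fun c c' => if W c' < W c then c' else c) c) ≤ W c' := by
  induction l generalizing c with
  | nil => simp
  | cons x l ih =>
    rw [List.foldl_cons]
    obtain ⟨h1, h2, h3⟩ := ih (if W x < W c then x else c)
    have hle : W (if W x < W c then x else c) ≤ W c ∧ W (if W x < W c then x else c) ≤ W x := by
      split_ifs <;> omega
    refine ⟨?_, h2.trans hle.1, fun c' hc' => ?_⟩
    · rcases List.mem_cons.1 h1 with h | h
      · rw [h]
        split_ifs <;> simp
      · exact List.mem_cons_of_mem _ (List.mem_cons_of_mem _ h)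
    · rcases List.mem_cons.1 hc' with rfl | hc'
      · exact h2.trans hle.2
      · exact h3 c' hc'

theorem sum_classWt_le (E : Edges n) (χ : Coloring n) (K : ℕ) :
    ∑ c ∈ Finset.range K, classWt E χ c ≤ totalWt E := by
  have key : ∀ L : Edges n, ∑ c ∈ Finset.range K,
      (L.map fun e => if χ s(e.1, e.2) = some c then wt E e else 0).sum ≤ (L.map (wt E)).sum := by
    intro L
    induction L with
    | nil => simp
    | cons e L ih =>
      simp only [List.map_cons, List.sum_cons, Finset.sum_add_distrib]
      refine add_le_add ?_ ih
      cases h : χ s(e.1, e.2) with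
      | none => simp
      | some c =>
        simp only [Option.some.injEq, Finset.sum_ite_eq]
        split_ifs <;> omega
  exact key E

/-- The new name of a color when the color `c` is removed from a palette of size `K`. -/
def removeColor (K c : ℕ) (o : Option ℕ) : Option ℕ :=
  if o = some c then none else if o = some (K - 1) then some c else o

theorem removeColor_eq_none {K c : ℕ} {o : Option ℕ} :
    removeColor K c o = none ↔ o = none ∨ o = some c := by
  rw [removeColor]
  split_ifs with h1 h2
  · simp [h1]
  · subst h2
    simp [h1]
  · simp [h1]

theorem removeColor_eq_some {K c d : ℕ} {o : Option ℕ} (h : removeColor K c o = some d) :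
    o = some (K - 1) ∧ d = c ∧ c ≠ K - 1 ∨ o = some d ∧ d ≠ c ∧ d ≠ K - 1 := by
  rw [removeColor] at h
  split_ifs at h with h1 h2
  · cases h
    refine Or.inl ⟨h2, rfl, fun h3 => h1 ?_⟩
    rw [h2, ← h3]
  · subst h
    simp at h1 h2
    exact Or.inr ⟨rfl, h1, h2⟩

theorem foldl_removeColor (hE : Valid E) (hχ : Proper E K χ) (c : ℕ) :
    E.foldl (fun (χ : Coloring n) e =>
      if χ s(e.1, e.2) = some c then Function.update χ s(e.1, e.2) none
      else if χ s(e.1, e.2) = some (K - 1) then Function.update χ s(e.1, e.2) (some c)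
      else χ) χ = fun e => removeColor K c (χ e) := by
  have : (fun (χ : Coloring n) (e : Fin n × Fin n) =>
      if χ s(e.1, e.2) = some c then Function.update χ s(e.1, e.2) none
      else if χ s(e.1, e.2) = some (K - 1) then Function.update χ s(e.1, e.2) (some c)
      else χ) = fun χ e =>
        Function.update χ s(e.1, e.2) (removeColor K c (χ s(e.1, e.2))) := by
    funext χ e
    rw [removeColor]
    split_ifs
    · rfl
    · rfl
    · rw [Function.update_eq_self]
  rw [this]
  funext x
  rw [foldl_update_sym (fun _ => removeColor K c) E hE.nodup]
  split_ifs with h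
  · rfl
  · have : χ x = none := by
      by_contra h'
      exact h (hχ.mem_sym x h')
    rw [this]
    rfl

theorem Proper.removeColor (hχ : Proper E K χ) {c : ℕ} (hc : c < K) :
    Proper E (K - 1) (fun e => removeColor K c (χ e)) := by
  refine ⟨fun e he => hχ.mem_sym e fun h => he (removeColor_eq_none.2 (Or.inl h)), fun e d hd => ?_,
    fun v x y d hx hy => ?_⟩
  · rcases removeColor_eq_some hd with ⟨h1, h2, h3⟩ | ⟨h1, h2, h3⟩
    · omega
    · have := hχ.lt e d h1
      omega
  · rcases removeColor_eq_some hx with ⟨h1, h2, h3⟩ | ⟨h1, h2, h3⟩ <;>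
    rcases removeColor_eq_some hy with ⟨h1', h2', h3'⟩ | ⟨h1', h2', h3'⟩
    · exact hχ.inj v x y _ h1 h1'
    · exact absurd h2 h2'
    · exact absurd h2' h2
    · exact hχ.inj v x y _ h1 h1'

theorem deg_uncolored_removeColor_le (hχ : Proper E K χ) (c : ℕ) (v : Fin n) :
    deg (uncolored E fun e => removeColor K c (χ e)) v ≤ deg (uncolored E χ) v + 1 := by
  classical
  have h1 : (Finset.univ.filter fun y => χ s(v, y) = some c).card ≤ 1 :=
    Finset.card_le_one.2 fun x hx y hy => hχ.inj v x y c (by simpa using hx) (by simpa using hy)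
  refine le_trans ?_ (Nat.add_le_add_left h1 _)
  refine (Finset.card_le_card fun y hy => ?_).trans (Finset.card_union_le _ _)
  simp only [mem_sym_uncolored, removeColor_eq_none, Finset.mem_filter, Finset.mem_univ, true_and,
    Finset.mem_union] at hy ⊢
  tauto

theorem uncoloredWt_removeColor_le (c : ℕ) :
    uncoloredWt E (fun e => removeColor K c (χ e)) ≤ uncoloredWt E χ + classWt E χ c := by
  rw [uncoloredWt, uncoloredWt, classWt, ← List.sum_map_add]
  refine List.sum_le_sum fun e _ => ?_
  simp only [removeColor_eq_none]
  split_ifs <;> simp_all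

/-- Pruning removes at most three color classes. Each of them is a matching whose weight is at most
the average weight of the color classes. -/
theorem prune_within (hE : Valid E) {Δ K₀ : ℕ} (hK₀ : K₀ ≤ Δ + 4) (hχ : Full E K₀ χ) :
    Within w node (prune node E (deg E) Δ K₀ χ) (4 * (2 * E.length + Δ + 5))
      (fun χ' => Proper E (Δ + 1) χ' ∧ (∀ u, deg (uncolored E χ') u ≤ 3) ∧
        (Δ + 1) * uncoloredWt E χ' ≤ 3 * totalWt E) := by
  have hunc : ∀ u, deg (uncolored E χ) u = 0 := fun u => by simp [hχ.2, deg, sym]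
  have hwt : uncoloredWt E χ = 0 := by simp [uncoloredWt_eq, hχ.2]
  rw [prune]
  refine Within.mono (T := (K₀ - (Δ + 1) + 1) * (2 * E.length + Δ + 5)) (Within.loop (s := (K₀, χ))
    (fun S : ℕ × Coloring n => Proper E S.1 S.2 ∧ S.1 ≤ K₀ ∧ (S.1 = K₀ ∨ Δ + 1 ≤ S.1) ∧
      (∀ u, deg (uncolored E S.2) u ≤ K₀ - S.1) ∧
      (Δ + 1) * uncoloredWt E S.2 ≤ (K₀ - S.1) * totalWt E)
    (fun S : ℕ × Coloring n => (S.1 - (Δ + 1) + 1) * (2 * E.length + Δ + 5))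
    (2 * E.length + Δ + 5) (fun S _ => Nat.le_mul_of_pos_left _ (Nat.succ_pos _))
    (fun S hS => ?_) ⟨hχ.1, le_rfl, Or.inl rfl, fun u => by simp [hunc], by simp [hwt]⟩) ?_
    fun _ h => h
  swap
  · exact Nat.mul_le_mul_right _ (by omega)
  obtain ⟨K, χ⟩ := S
  obtain ⟨h1, h2, h3, h4, h5⟩ := hS
  dsimp only at h1 h2 h3 h4 h5 ⊢
  refine Within.tick_bind (T := 2 * E.length + Δ + 4) ?_
  split_ifs with hK
  · have hle : K₀ - K ≤ 3 := by omega
    exact Within.ret ⟨h1.mono hK, fun u => (h4 u).trans hle, h5.trans (Nat.mul_le_mul_right _ hle)⟩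
  · refine (Within.bind (T' := E.length + Δ + 4) classWeights_within fun W hW => ?_).mono
      (by omega) fun _ h => h
    subst hW
    refine (Within.scan_bind (T := E.length) ?_).mono
      (by rw [List.length_range]; omega) fun _ h => h
    obtain ⟨m1, -, m3⟩ := foldl_argmin (classWt E χ) (List.range K) 0
    set c := (List.range K).foldl
      (fun c c' => if classWt E χ c' < classWt E χ c then c' else c) 0 with hcdef
    have hcK : c < K := by
      rcases List.mem_cons.1 m1 with h | h
      · omega
      · simpa using h
    refine Within.mono (T := E.length + 0) (Within.scan_bind (Within.ret ?_)) (by omega)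
      fun _ h => h
    rw [foldl_removeColor hE h1]
    have hmin : (Δ + 1) * classWt E χ c ≤ totalWt E := by
      refine le_trans ?_ (sum_classWt_le E χ K)
      calc (Δ + 1) * classWt E χ c ≤ K * classWt E χ c := Nat.mul_le_mul_right _ (by omega)
        _ = ∑ _c' ∈ Finset.range K, classWt E χ c := by simp
        _ ≤ _ := Finset.sum_le_sum fun c' hc' => m3 c' (by simpa using hc')
    refine ⟨⟨h1.removeColor hcK, by simp only; omega, by simp only; omega, fun u => ?_, ?_⟩, ?_⟩
    · have := deg_uncolored_removeColor_le h1 c u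
      have := h4 u
      simp only at this ⊢
      omega
    · have h6 := uncoloredWt_removeColor_le (E := E) (K := K) (χ := χ) c
      have h7 : K₀ - (K - 1) = K₀ - K + 1 := by omega
      simp only
      rw [h7, Nat.succ_mul (K₀ - K)]
      calc _ ≤ (Δ + 1) * (uncoloredWt E χ + classWt E χ c) := Nat.mul_le_mul_left _ h6
        _ = (Δ + 1) * uncoloredWt E χ + (Δ + 1) * classWt E χ c := mul_add _ _ _
        _ ≤ _ := add_le_add h5 hmin
    · simp only
      have : K - (Δ + 1) + 1 = (K - 1 - (Δ + 1) + 1) + 1 := by omega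
      rw [this, Nat.succ_mul (K - 1 - (Δ + 1) + 1), add_comm]

end MergePrune

/-! ### The time at one node of the recursion tree -/

section NodeTime

variable {n : ℕ} {E : Edges n} {w : List Bool → ℝ≥0∞} {node : List Bool}

theorem Valid.two_le (hE : Valid E) (hne : E ≠ []) : 2 ≤ n := by
  obtain ⟨e, he⟩ := List.exists_mem_of_ne_nil _ hne
  have h1 := hE.ne e he
  have h2 : (e.1 : ℕ) ≠ e.2 := fun h => h1 (Fin.ext h)
  omega

theorem one_le_logb (hn : 2 ≤ n) : 1 ≤ Real.logb 2 n := by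
  rw [Real.le_logb_iff_rpow_le (by norm_num) (by positivity), Real.rpow_one]
  exact_mod_cast hn

/-- A simple graph has at most `n²` edges, so its harmonic numbers are of order `log n`. -/
theorem harm_le (hn : 2 ≤ n) {l : ℕ} (hl : l ≤ n * n) :
    harm l ≤ ENNReal.ofReal (3 * Real.logb 2 n) := by
  have h1 : harm l = ENNReal.ofReal (harmonic l) := by
    rw [harm, harmonic]
    push_cast
    rw [ENNReal.ofReal_sum_of_nonneg fun _ _ => by positivity]
    refine Finset.sum_congr rfl fun j _ => ?_
    rw [ENNReal.ofReal_inv_of_pos (by positivity), ENNReal.ofReal_add (by positivity) (by norm_num)]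
    simp
  rw [h1]
  refine ENNReal.ofReal_le_ofReal ?_
  have hL := one_le_logb hn
  rcases Nat.eq_zero_or_pos l with rfl | hl0
  · simp
    linarith
  have hn0 : (0 : ℝ) < n := by positivity
  have h2 : Real.log l ≤ 2 * Real.log n := by
    have : (l : ℝ) ≤ n * n := by exact_mod_cast hl
    have h3 := Real.log_le_log (by positivity) this
    rw [Real.log_mul hn0.ne' hn0.ne'] at h3
    linarith
  have h3 : Real.log n ≤ Real.logb 2 n := by
    rw [Real.logb, le_div_iff₀ (Real.log_pos (by norm_num))]
    have h4 : 0 ≤ Real.log n := Real.log_natCast_nonneg n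
    have h5 : Real.log 2 ≤ 1 := by linarith [Real.log_two_lt_d9]
    nlinarith
  have := harmonic_le_one_add_log l
  linarith

/-- The bound for the time that is spent on the subgraph with edges `E`. -/
noncomputable def nodeBound (n : ℕ) (E : Edges n) : ℝ :=
  150 * (E.length + 1 + totalWt E / maxDeg E * (n / maxDeg E + Real.logb 2 n))

theorem logb_mul_sq_le (hn : 2 ≤ n) {Δ : ℕ} (h : IsSmall n Δ) :
    Real.logb 2 n * (Δ : ℝ) ^ 2 ≤ 4 * n := by
  have hL := one_le_logb hn
  have h1 : (Δ : ℝ) ^ 2 ≤ (2 * Real.sqrt (n / Real.logb 2 n)) ^ 2 :=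
    pow_le_pow_left₀ (by positivity) h 2
  rw [mul_pow, Real.sq_sqrt (by positivity)] at h1
  refine (mul_le_mul_of_nonneg_left h1 (by positivity)).trans (le_of_eq ?_)
  field_simp
  norm_num

/-- At the bottom of the recursion the logarithm is at most `4n / Δ²`. -/
theorem bottom_time_le (hE : Valid E) (hs : IsSmall n (maxDeg E)) :
    (5 * E.length + 2 + 20 * totalWt E + 4 * totalWt E * harm E.length : ℝ≥0∞) ≤
      ENNReal.ofReal (nodeBound n E) := by
  by_cases hne : E = []
  · subst hne
    have h0 : totalWt ([] : Edges n) = 0 := rfl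
    rw [nodeBound, h0]
    simp only [harm, List.length_nil, Nat.cast_zero, Finset.range_zero, Finset.sum_empty, mul_zero,
      zero_add, add_zero, zero_div, zero_mul, mul_one]
    rw [show (2 : ℝ≥0∞) = ENNReal.ofReal 2 by simp]
    exact ENNReal.ofReal_le_ofReal (by norm_num)
  have hn := hE.two_le hne
  have hL := one_le_logb hn
  set L := Real.logb 2 n with hLdef
  have hΔ : (0 : ℝ) < maxDeg E := by exact_mod_cast maxDeg_pos hne
  have hW : (0 : ℝ) ≤ totalWt E := by positivity
  have hm : (0 : ℝ) ≤ E.length := by positivity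
  have hsq := logb_mul_sq_le hn hs
  have hh := harm_le hn hE.length_le
  calc (5 * E.length + 2 + 20 * totalWt E + 4 * totalWt E * harm E.length : ℝ≥0∞)
      ≤ 5 * E.length + 2 + 20 * totalWt E + 4 * totalWt E * ENNReal.ofReal (3 * L) := by gcongr
    _ = ENNReal.ofReal (5 * E.length + 2 + 20 * totalWt E + 4 * totalWt E * (3 * L)) := by
        rw [ENNReal.ofReal_add (by positivity) (by positivity), ENNReal.ofReal_add (by positivity)
          (by positivity), ENNReal.ofReal_add (by positivity) (by positivity),
          ENNReal.ofReal_mul (p := 5) (by positivity),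
          ENNReal.ofReal_mul (p := 20) (by positivity),
          ENNReal.ofReal_mul (p := 4 * totalWt E) (by positivity),
          ENNReal.ofReal_mul (p := 4) (by positivity)]
        simp
    _ ≤ _ := by
        refine ENNReal.ofReal_le_ofReal ?_
        have h1 : L / 4 ≤ n / maxDeg E / maxDeg E := by
          rw [div_div, le_div_iff₀ (by positivity)]
          nlinarith
        have h2 : totalWt E / maxDeg E * (n / maxDeg E + L) ≥ totalWt E * (L / 4) := by
          calc (totalWt E : ℝ) * (L / 4) ≤ totalWt E * (n / maxDeg E / maxDeg E) := by gcongr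
            _ = totalWt E / maxDeg E * (n / maxDeg E) := by ring
            _ ≤ _ := by gcongr; linarith
        rw [nodeBound]
        nlinarith [mul_le_mul_of_nonneg_left hL hW]

/-- The vertices from which alternating paths are estimated by their trivial bound during Repair. -/
def IsHeavy (E : Edges n) (u : Fin n) : Prop := maxDeg E < 2 * deg E u

instance (E : Edges n) : DecidablePred (IsHeavy E) := fun u =>
  inferInstanceAs (Decidable (maxDeg E < 2 * deg E u))

/-- An edge whose center is heavy has a weight of more than `Δ / 2`, so that a length of order `n` is at
most of order `n / Δ` times the weight of the edge. -/
theorem sum_edgeTime_le {U : Edges n} (hU : ∀ e ∈ U, e ∈ E)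
    (hW : (maxDeg E + 1) * (U.map (wt E)).sum ≤ 3 * totalWt E) (hne : E ≠ []) :
    (((U.map fun e => edgeTime (IsHeavy E) E e + 1).sum : ℕ) : ℝ) ≤
      totalWt E / maxDeg E * (24 * (n / maxDeg E) + 63) := by
  have h1 : maxDeg E * (U.map fun e => edgeTime (IsHeavy E) E e + 1).sum ≤
      (21 * maxDeg E + 8 * n) * (U.map (wt E)).sum := by
    rw [← List.sum_map_mul_left, ← List.sum_map_mul_left]
    refine List.sum_le_sum fun e he => ?_
    have hpos := wt_pos (hU e he)
    have hiff : IsHeavy E (center E e) ↔ maxDeg E < 2 * wt E e := by rw [IsHeavy, deg_center]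
    rw [edgeTime]
    split_ifs with h
    · rw [hiff] at h
      nlinarith
    · nlinarith
  have hΔ : (0 : ℝ) < maxDeg E := by exact_mod_cast maxDeg_pos hne
  have h1' : (maxDeg E : ℝ) * ((U.map fun e => edgeTime (IsHeavy E) E e + 1).sum : ℕ) ≤
      (21 * maxDeg E + 8 * n) * ((U.map (wt E)).sum : ℕ) := by exact_mod_cast h1
  have h2' : (maxDeg E : ℝ) * ((U.map (wt E)).sum : ℕ) ≤ 3 * totalWt E := by
    have : maxDeg E * (U.map (wt E)).sum ≤ 3 * totalWt E :=
      le_trans (Nat.mul_le_mul_right _ (Nat.le_succ _)) hW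
    exact_mod_cast this
  generalize ((U.map fun e => edgeTime (IsHeavy E) E e + 1).sum : ℕ) = A at *
  generalize ((U.map (wt E)).sum : ℕ) = B at *
  have h3 : (A : ℝ) ≤ (21 * maxDeg E + 8 * n) * (3 * totalWt E / maxDeg E) / maxDeg E := by
    rw [le_div_iff₀ hΔ, mul_comm]
    refine h1'.trans ?_
    gcongr
    rw [le_div_iff₀ hΔ, mul_comm]
    exact h2'
  refine h3.trans (le_of_eq ?_)
  field_simp
  ring

theorem repair_time_le (hE : Valid E) (hne : E ≠ []) {U : Edges n} (hU : ∀ e ∈ U, e ∈ E)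
    (hlen : U.length ≤ E.length)
    (hW : (maxDeg E + 1) * (U.map (wt E)).sum ≤ 3 * totalWt E) :
    (26 * E.length + 22 + (U.map fun e => (edgeTime (IsHeavy E) E e + 1 : ℝ≥0∞)).sum +
      4 * ENNReal.ofReal (6 / maxDeg E) * totalWt E * harm U.length : ℝ≥0∞) ≤
      ENNReal.ofReal (nodeBound n E) := by
  have hn := hE.two_le hne
  have hL := one_le_logb hn
  have hh := harm_le hn (hlen.trans hE.length_le)
  set L := Real.logb 2 n with hLdef
  have hΔ : (0 : ℝ) < maxDeg E := by exact_mod_cast maxDeg_pos hne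
  have hcast : (U.map fun e => (edgeTime (IsHeavy E) E e + 1 : ℝ≥0∞)).sum =
      ENNReal.ofReal ((U.map fun e => edgeTime (IsHeavy E) E e + 1).sum : ℕ) := by
    rw [ENNReal.ofReal_natCast, Nat.cast_list_sum, List.map_map]
    congr 1
    refine List.map_congr_left fun e _ => ?_
    simp
  have hsum := sum_edgeTime_le hU hW hne
  rw [hcast]
  generalize ((U.map fun e => edgeTime (IsHeavy E) E e + 1).sum : ℕ) = A at *
  calc (26 * E.length + 22 + ENNReal.ofReal A +
        4 * ENNReal.ofReal (6 / maxDeg E) * totalWt E * harm U.length : ℝ≥0∞)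
      ≤ 26 * E.length + 22 + ENNReal.ofReal A +
        4 * ENNReal.ofReal (6 / maxDeg E) * totalWt E * ENNReal.ofReal (3 * L) := by gcongr
    _ = ENNReal.ofReal (26 * E.length + 22 + A + 4 * (6 / maxDeg E) * totalWt E * (3 * L)) := by
        rw [ENNReal.ofReal_add (by positivity) (by positivity), ENNReal.ofReal_add (by positivity)
          (by positivity), ENNReal.ofReal_add (by positivity) (by positivity),
          ENNReal.ofReal_mul (p := 26) (by positivity),
          ENNReal.ofReal_mul (p := 4 * (6 / maxDeg E) * totalWt E) (by positivity),
          ENNReal.ofReal_mul (p := 4 * (6 / maxDeg E)) (by positivity),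
          ENNReal.ofReal_mul (p := 4) (by positivity)]
        simp
    _ ≤ _ := by
        refine ENNReal.ofReal_le_ofReal ?_
        have h1 : 4 * (6 / maxDeg E) * totalWt E * (3 * L) =
            (totalWt E / maxDeg E : ℝ) * (72 * L) := by ring
        have hX : (0 : ℝ) ≤ totalWt E / maxDeg E := by positivity
        have hY : (0 : ℝ) ≤ n / maxDeg E := by positivity
        have hm : (0 : ℝ) ≤ E.length := by positivity
        rw [nodeBound, h1]
        generalize (totalWt E / maxDeg E : ℝ) = X at *
        generalize (n / maxDeg E : ℝ) = Y at *
        nlinarith [mul_nonneg hX hY, mul_le_mul_of_nonneg_left hL hX]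

/-- Since `log n ≤ n`, the threshold for the bottom of the recursion is at least `2`. Hence the maximum
degree `(Δ + 2) / 2` of a child is smaller than `Δ`. -/
theorem three_le_maxDeg (hE : Valid E) (hs : ¬ IsSmall n (maxDeg E)) : 3 ≤ maxDeg E := by
  by_contra h
  refine hs ?_
  rcases Nat.eq_zero_or_pos (maxDeg E) with h0 | h0
  · rw [IsSmall, h0]
    push_cast
    positivity
  have hne : E ≠ [] := by
    rintro rfl
    simp [maxDeg, deg, sym] at h0
  have hn := hE.two_le hne
  have hL := one_le_logb hn
  have h1 : Real.logb 2 n ≤ n := by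
    rw [Real.logb_le_iff_le_rpow (by norm_num) (by positivity), Real.rpow_natCast]
    exact_mod_cast Nat.lt_two_pow_self.le
  have h2 : 1 ≤ Real.sqrt (n / Real.logb 2 n) := by
    rw [Real.one_le_sqrt, le_div_iff₀ (by linarith)]
    linarith
  have h3 : (maxDeg E : ℝ) ≤ 2 := by exact_mod_cast (by omega : maxDeg E ≤ 2)
  rw [IsSmall]
  linarith

theorem cost_computeDegrees (hE : Valid E) (f : (Fin n → ℕ) → ℝ≥0∞) :
    (computeDegrees node E).cost w f = E.length * w node + f (deg E) := by
  rw [computeDegrees, cost_scan, foldl_degrees hE]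
  simp

theorem cost_computeMaxDegree (f : ℕ → ℝ≥0∞) :
    (computeMaxDegree node E (deg E)).cost w f = E.length * w node + f (maxDeg E) := by
  rw [computeMaxDegree, cost_scan, foldl_maxDegree]

theorem cost_emptyColoring (f : Coloring n → ℝ≥0∞) :
    (emptyColoring node E).cost w f = E.length * w node + f (fun _ => none) := by
  rw [emptyColoring, cost_scan, foldl_uncolor]

/-- What a call of `Recursive-Color-Edges` returns. -/
def Good (E : Edges n) (r : Coloring n × ℕ) : Prop := r.2 = maxDeg E + 1 ∧ Full E r.2 r.1

theorem iSup_full_le (f : Coloring n × ℕ → ℝ≥0∞) :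
    ⨆ χ, ⨆ (_ : Full E (maxDeg E + 1) χ), f (χ, maxDeg E + 1) ≤ ⨆ r, ⨆ (_ : Good E r), f r :=
  iSup₂_le fun χ h => le_iSup₂_of_le (f := fun r (_ : Good E r) => f r) (χ, maxDeg E + 1)
    ⟨rfl, h⟩ le_rfl

/-- Coloring all edges from the empty coloring: there are at least as many missing colors at a
vertex as uncolored edges. -/
theorem bottom_cost_le (hE : Valid E) (f : Coloring n × ℕ → ℝ≥0∞) :
    (emptyColoring node E >>= fun χ => colorEdges node E (deg E) (maxDeg E) χ >>= fun χ =>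
      ret (χ, maxDeg E + 1)).cost w f ≤
      (3 * E.length + 1 + 20 * totalWt E + 4 * totalWt E * harm E.length) * w node +
        ⨆ r, ⨆ (_ : Good E r), f r := by
  rw [cost_bind, cost_emptyColoring, cost_bind]
  have hunc : uncolored E (fun _ => none) = E := by simp [uncolored]
  have h := colorEdges_cost_le (w := w) (node := node) (fun _ : Fin n => False) hE
    (fun v => deg_le_maxDeg v) E.length 1 (fun χ hχ _ u _ => by
      have h1 := hχ.le_length_missing u
      have h2 := deg_le_maxDeg (E := E) u
      rw [one_mul]
      exact_mod_cast (by omega : deg (uncolored E χ) u ≤ (missing χ (maxDeg E + 1) u).length))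
    (proper_none E _) (fun u => by rw [hunc]; exact deg_le_length u)
    (fun χ => f (χ, maxDeg E + 1))
  refine (add_le_add le_rfl (h.trans (add_le_add le_rfl (iSup_full_le f)))).trans ?_
  rw [hunc]
  have hsum : (E.map fun e => (edgeTime (fun _ : Fin n => False) E e + 1 : ℝ≥0∞)).sum =
      20 * totalWt E + E.length := by
    rw [List.sum_map_add]
    simp only [edgeTime, if_false, add_zero, totalWt, Nat.cast_mul, List.sum_map_mul_left,
      Nat.cast_list_sum, List.map_map, List.map_const', List.sum_replicate]
    simp [Function.comp_def]
  rw [hsum, mul_one]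
  refine le_of_eq ?_
  ring

/-- The hypothesis `ha` is needed if no index satisfies `Q`. -/
theorem add_iSup₂_le {α : Type*} {Q : α → Prop} {a c : ℝ≥0∞} {g : α → ℝ≥0∞} (ha : a ≤ c)
    (h : ∀ i, Q i → a + g i ≤ c) : a + ⨆ i, ⨆ (_ : Q i), g i ≤ c := by
  by_cases hT : a = ⊤
  · subst hT
    rw [top_le_iff.1 ha]
    exact le_top
  · calc _ ≤ a + (c - a) := by
          gcongr
          exact iSup₂_le fun i hi => ENNReal.le_sub_of_add_le_left hT (h i hi)
      _ = c := add_tsub_cancel_of_le ha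

/-- The time of the phases of an inner node that make a bounded number of passes over the edges. -/
theorem linear_time_le (hE : Valid E) (hne : E ≠ []) :
    ((25 * E.length + 21 : ℕ) : ℝ≥0∞) ≤ ENNReal.ofReal (nodeBound n E) := by
  refine le_trans ?_ (repair_time_le hE hne (U := []) (by simp) (by simp) (by simp))
  simp only [List.map_nil, List.sum_nil, List.length_nil, harm, Finset.range_zero,
    Finset.sum_empty, mul_zero, add_zero]
  exact_mod_cast (by omega : 25 * E.length + 21 ≤ 26 * E.length + 22)

/-- The work at an inner node of the recursion tree after the recursive calls. After Prune there
are at most three uncolored edges at every vertex. -/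
theorem repair_cost_le (hE : Valid E) (hne : E ≠ []) {K₁ K₂ : ℕ} {χ₁ χ₂ : Coloring n}
    (h₁ : Full (part E false) K₁ χ₁) (h₂ : Full (part E true) K₂ χ₂)
    (hK : K₁ + K₂ ≤ maxDeg E + 4) (f : Coloring n × ℕ → ℝ≥0∞) :
    ((2 * E.length + 1 + partitionSteps E : ℕ) : ℝ≥0∞) * w node +
    (merge node (part E false) (part E true) χ₁ χ₂ K₁ >>= fun χ =>
      prune node E (deg E) (maxDeg E) (K₁ + K₂) χ >>= fun χ =>
        colorEdges node E (deg E) (maxDeg E) χ >>= fun χ => ret (χ, maxDeg E + 1)).cost w f ≤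
      ENNReal.ofReal (nodeBound n E) * w node + ⨆ r, ⨆ (_ : Good E r), f r := by
  set S := ⨆ r, ⨆ (_ : Good E r), f r with hS
  have hprune : ∀ χ, Full E (K₁ + K₂) χ →
      (prune node E (deg E) (maxDeg E) (K₁ + K₂) χ >>= fun χ =>
        colorEdges node E (deg E) (maxDeg E) χ >>= fun χ => ret (χ, maxDeg E + 1)).cost w f ≤
      ((4 * (2 * E.length + maxDeg E + 5) : ℕ) : ℝ≥0∞) * w node +
        ⨆ χ, ⨆ (_ : Proper E (maxDeg E + 1) χ ∧ (∀ u, deg (uncolored E χ) u ≤ 3) ∧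
          (maxDeg E + 1) * uncoloredWt E χ ≤ 3 * totalWt E),
          (colorEdges node E (deg E) (maxDeg E) χ).cost w fun χ => f (χ, maxDeg E + 1) :=
    fun χ hχ => prune_within hE hK hχ _
  have hpos := maxDeg_pos hne
  have hcolor : ∀ χ, Proper E (maxDeg E + 1) χ ∧ (∀ u, deg (uncolored E χ) u ≤ 3) ∧
      (maxDeg E + 1) * uncoloredWt E χ ≤ 3 * totalWt E →
      ((25 * E.length + 21 : ℕ) : ℝ≥0∞) * w node + ((colorEdges node E (deg E) (maxDeg E) χ).cost w
        fun χ => f (χ, maxDeg E + 1)) ≤ ENNReal.ofReal (nodeBound n E) * w node + S := by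
    rintro χ ⟨hχ, h3, hW⟩
    have h := colorEdges_cost_le (w := w) (node := node) (IsHeavy E) hE
      (fun v => deg_le_maxDeg v) 3 (ENNReal.ofReal (6 / maxDeg E)) (fun χ hχ h3 u hu => by
        have h1 := hχ.le_length_missing u
        rw [IsHeavy] at hu
        have h2 : maxDeg E ≤ 2 * (missing χ (maxDeg E + 1) u).length := by omega
        rw [← ENNReal.ofReal_natCast (missing χ (maxDeg E + 1) u).length,
          ← ENNReal.ofReal_natCast (deg (uncolored E χ) u), ← ENNReal.ofReal_mul (by positivity)]
        refine ENNReal.ofReal_le_ofReal ?_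
        have h4 : (deg (uncolored E χ) u : ℝ) ≤ 3 := by exact_mod_cast h3 u
        refine h4.trans ?_
        have hΔ : (0 : ℝ) < maxDeg E := by exact_mod_cast hpos
        rw [div_mul_eq_mul_div, le_div_iff₀ hΔ]
        have h5 : (maxDeg E : ℝ) ≤ 2 * (missing χ (maxDeg E + 1) u).length := by exact_mod_cast h2
        linarith)
      hχ h3 (fun χ => f (χ, maxDeg E + 1))
    rw [uncoloredWt_eq] at hW
    have hrep := repair_time_le hE hne (U := uncolored E χ) (fun e he => (List.mem_filter.1 he).1)
      (List.length_filter_le _ _) hW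
    refine (add_le_add le_rfl (h.trans (add_le_add le_rfl (iSup_full_le f)))).trans ?_
    rw [← add_assoc, ← add_mul]
    refine add_le_add (mul_le_mul_left ?_ _) le_rfl
    refine le_trans (le_of_eq ?_) hrep
    push_cast
    ring
  have hbase : ((25 * E.length + 21 : ℕ) : ℝ≥0∞) * w node ≤
      ENNReal.ofReal (nodeBound n E) * w node + S :=
    le_add_right (mul_le_mul_left (linear_time_le hE hne) _)
  have hsteps := partitionSteps_le hE
  have hΔm := maxDeg_le_length (E := E)
  rw [cost_bind]
  refine (add_le_add le_rfl (merge_within hE h₁ h₂ _)).trans ?_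
  rw [← add_assoc, ← add_mul]
  refine (add_le_add le_rfl (iSup₂_le fun χ hχ => hprune χ hχ)).trans ?_
  rw [← add_assoc, ← add_mul]
  refine le_trans (add_le_add (mul_le_mul_left
    (show (_ : ℝ≥0∞) ≤ ((25 * E.length + 21 : ℕ) : ℝ≥0∞) from ?_) _) le_rfl)
    (add_iSup₂_le hbase hcolor)
  norm_cast
  omega

end NodeTime

/-! ### The recursion -/

section Recursion

variable {n : ℕ} {E : Edges n}

theorem AtNode.valid {node : List Bool} {F : Edges n} (hE : Valid E) (h : AtNode E node F) :
    Valid F := by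
  induction h with
  | root => exact hE
  | child b _ _ ih => exact ih.filter _

theorem AtNode.unique {node : List Bool} {F F' : Edges n} (h : AtNode E node F)
    (h' : AtNode E node F') : F = F' := by
  induction h generalizing F' with
  | root =>
    generalize hν : ([] : List Bool) = ν at h'
    cases h' with
    | root => rfl
    | child b h1 h2 => simp at hν
  | @child node F b h1 h2 ih =>
    generalize hν : node ++ [b] = ν at h'
    cases h' with
    | root => simp at hν
    | @child node' F₁ b' h1' h2' =>
      obtain ⟨rfl, h3⟩ := List.append_inj' hν rfl
      cases h3
      rw [ih h1']

/-- The cost of counting the steps of one node `τ` only. The calls at other nodes cost nothing, but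
their safety and correctness matter. -/
theorem recursiveColorEdges_cost_le {E₀ : Edges n} {τ : List Bool} {β : ℝ≥0∞}
    (hβ : ∀ F, AtNode E₀ τ F → ENNReal.ofReal (nodeBound n F) ≤ β) (depth : ℕ) :
    ∀ (ν : List Bool) (E : Edges n), Valid E → AtNode E₀ ν E → maxDeg E ≤ depth →
      ∀ f, (recursiveColorEdges depth ν E).cost (fun ν => if ν = τ then 1 else 0) f ≤
        (if ν <+: τ then β else 0) + ⨆ r, ⨆ (_ : Good E r), f r := by
  set w : List Bool → ℝ≥0∞ := fun ν => if ν = τ then 1 else 0 with hw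
  have hown : ∀ ν E, AtNode E₀ ν E → ENNReal.ofReal (nodeBound n E) * w ν ≤
      if ν <+: τ then β else 0 := by
    intro ν E hat
    simp only [hw]
    by_cases h : ν = τ
    · subst h
      simpa using hβ E hat
    · simp [h]
  have hbottom : ∀ ν E, Valid E → AtNode E₀ ν E → IsSmall n (maxDeg E) → ∀ f,
      ((E.length + (E.length + 1) : ℝ≥0∞) * w ν +
      (emptyColoring ν E >>= fun χ => colorEdges ν E (deg E) (maxDeg E) χ >>= fun χ =>
      ret (χ, maxDeg E + 1)).cost w f) ≤ (if ν <+: τ then β else 0) + ⨆ r, ⨆ (_ : Good E r), f r := by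
    intro ν E hE hat hs f
    refine (add_le_add le_rfl (bottom_cost_le hE f)).trans ?_
    refine le_trans (le_of_eq ?_)
      (add_le_add ((mul_le_mul_left (bottom_time_le hE hs) _).trans (hown ν E hat)) le_rfl)
    ring
  induction depth with
  | zero =>
    intro ν E hE hat hd f
    have h0 : maxDeg E = 0 := Nat.le_zero.1 hd
    rw [recursiveColorEdges, cost_bind, cost_computeDegrees hE, cost_bind, cost_computeMaxDegree]
    refine le_trans ?_ (hbottom ν E hE hat (by rw [h0, IsSmall]; push_cast; positivity) f)
    rw [← add_assoc, ← add_mul]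
    gcongr
    exact le_self_add
  | succ depth ih =>
    intro ν E hE hat hd f
    rw [recursiveColorEdges, cost_bind, cost_computeDegrees hE, cost_bind, cost_computeMaxDegree,
      cost_bind, cost_tick]
    by_cases hs : IsSmall n (maxDeg E)
    · rw [if_pos hs]
      refine le_trans (le_of_eq ?_) (hbottom ν E hE hat hs f)
      ring
    rw [if_neg hs]
    have hΔ := three_le_maxDeg hE hs
    have hne : E ≠ [] := by
      rintro rfl
      simp [maxDeg, deg, sym] at hΔ
    have hchild : ∀ b, Valid (part E b) ∧ AtNode E₀ (ν ++ [b]) (part E b) ∧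
        maxDeg (part E b) ≤ depth := fun b => by
      refine ⟨hE.filter _, AtNode.child b hat (by rwa [maxDegree_toGraph hE]), ?_⟩
      have := two_mul_maxDeg_part_le hE b
      omega
    obtain ⟨hv₁, hat₁, hd₁⟩ := hchild false
    obtain ⟨hv₂, hat₂, hd₂⟩ := hchild true
    set B : Bool → ℝ≥0∞ := fun b => if ν ++ [b] <+: τ then β else 0 with hB
    set S := ⨆ r, ⨆ (_ : Good E r), f r with hS
    -- The node `τ` is `ν`, or it lies below at most one of the two children.
    have hsum : ENNReal.ofReal (nodeBound n E) * w ν + B false + B true ≤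
        if ν <+: τ then β else 0 := by
      by_cases h : ν = τ
      · have hb : ∀ b, B b = 0 := fun b => if_neg fun hp => by
          have := hp.length_le
          rw [h, List.length_append] at this
          simp at this
        rw [hb, hb, add_zero, add_zero]
        exact hown ν E hat
      · have h0 : w ν = 0 := if_neg h
        rw [h0, mul_zero, zero_add]
        by_cases hp : ν <+: τ
        · rw [if_pos hp]
          simp only [hB]
          by_cases h1 : ν ++ [false] <+: τ
          · have h2 : ¬ ν ++ [true] <+: τ := fun h2 => by
              have := (List.prefix_of_prefix_length_le h1 h2 (by simp)).eq_of_length (by simp)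
              simp at this
            rw [if_pos h1, if_neg h2, add_zero]
          · rw [if_neg h1, zero_add]
            split_ifs
            · exact le_rfl
            · exact zero_le
        · have hb : ∀ b, B b = 0 := fun b => if_neg fun h' =>
            hp ((List.prefix_append ν [b]).trans h')
          rw [hb, hb, add_zero]
          exact zero_le
    rw [cost_bind, cost_ticks, cost_bind]
    have hown' : ∀ r₁, Good (part E false) r₁ → ∀ r₂, Good (part E true) r₂ →
        ((2 * E.length + 1 + partitionSteps E : ℕ) : ℝ≥0∞) * w ν +
        (merge ν (part E false) (part E true) r₁.1 r₂.1 r₁.2 >>= fun χ =>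
          prune ν E (deg E) (maxDeg E) (r₁.2 + r₂.2) χ >>= fun χ =>
            colorEdges ν E (deg E) (maxDeg E) χ >>= fun χ => ret (χ, maxDeg E + 1)).cost w f ≤
        ENNReal.ofReal (nodeBound n E) * w ν + S := by
      intro r₁ h₁ r₂ h₂
      have e1 := two_mul_maxDeg_part_le hE false
      have e2 := two_mul_maxDeg_part_le hE true
      have e3 := h₁.1
      have e4 := h₂.1
      exact repair_cost_le hE hne h₁.2 h₂.2 (by omega) f
    have hbase : ((2 * E.length + 1 + partitionSteps E : ℕ) : ℝ≥0∞) * w ν ≤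
        ENNReal.ofReal (nodeBound n E) * w ν + S := by
      have hsteps := partitionSteps_le hE
      refine le_add_right (mul_le_mul_left (le_trans ?_ (linear_time_le hE hne)) _)
      exact_mod_cast (by omega : 2 * E.length + 1 + partitionSteps E ≤ 25 * E.length + 21)
    have hmid : ∀ r₁, Good (part E false) r₁ →
        ((2 * E.length + 1 + partitionSteps E : ℕ) : ℝ≥0∞) * w ν +
        (recursiveColorEdges depth (ν ++ [true]) (part E true)).cost w (fun r₂ =>
          (merge ν (part E false) (part E true) r₁.1 r₂.1 r₁.2 >>= fun χ =>
            prune ν E (deg E) (maxDeg E) (r₁.2 + r₂.2) χ >>= fun χ =>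
              colorEdges ν E (deg E) (maxDeg E) χ >>= fun χ => ret (χ, maxDeg E + 1)).cost w f) ≤
        B true + (ENNReal.ofReal (nodeBound n E) * w ν + S) := fun r₁ h₁ =>
      calc _ ≤ _ := add_le_add le_rfl (ih _ _ hv₂ hat₂ hd₂ _)
        _ = _ := add_left_comm _ _ _
        _ ≤ _ := add_le_add le_rfl (add_iSup₂_le hbase (hown' r₁ h₁))
    calc _ = ((2 * E.length + 1 + partitionSteps E : ℕ) : ℝ≥0∞) * w ν +
          (recursiveColorEdges depth (ν ++ [false]) (part E false)).cost w (fun r₁ =>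
          (recursiveColorEdges depth (ν ++ [true]) (part E true)).cost w (fun r₂ =>
          (merge ν (part E false) (part E true) r₁.1 r₂.1 r₁.2 >>= fun χ =>
            prune ν E (deg E) (maxDeg E) (r₁.2 + r₂.2) χ >>= fun χ =>
              colorEdges ν E (deg E) (maxDeg E) χ >>= fun χ =>
                ret (χ, maxDeg E + 1)).cost w f)) := by
          simp only [cost_bind]
          push_cast
          ring
      _ ≤ _ := add_le_add le_rfl (ih _ _ hv₁ hat₁ hd₁ _)
      _ = _ := add_left_comm _ _ _
      _ ≤ B false + (B true + (ENNReal.ofReal (nodeBound n E) * w ν + S)) :=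
        add_le_add le_rfl (add_iSup₂_le (hbase.trans le_add_self) hmid)
      _ = ENNReal.ofReal (nodeBound n E) * w ν + B false + B true + S := by ring
      _ ≤ _ := add_le_add hsum le_rfl

end Recursion

end EdgeColor

theorem mainTheorem4 :
    ∃ C : ℝ, 0 < C ∧
      ∀ (n : ℕ) (G : SimpleGraph (Fin n)) (E : EdgeColor.Edges n), EdgeColor.Lists E G →
      ∀ (i : ℕ) (node : List Bool) (F : EdgeColor.Edges n) (H : SimpleGraph (Fin n)),
        node.length = i → EdgeColor.AtNode E node F → H = EdgeColor.toGraph F →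
        0 < EdgeColor.numEdges H →
        EdgeColor.expectedTimeAt E node ≤
          ENNReal.ofReal (C * ((EdgeColor.numEdges H : ℝ) +
            (EdgeColor.weight H : ℝ) / (EdgeColor.maxDegree H : ℝ) *
              ((n : ℝ) / (EdgeColor.maxDegree H : ℝ) + Real.logb 2 n))) := by
  refine ⟨300, by norm_num, ?_⟩
  rintro n G E hEG i node F H - hF rfl hm
  have hE := hEG.valid
  have hFv := hF.valid hE
  rw [EdgeColor.numEdges_toGraph hFv] at hm ⊢
  rw [EdgeColor.weight_toGraph hFv, EdgeColor.maxDegree_toGraph hFv]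
  have h := EdgeColor.recursiveColorEdges_cost_le (τ := node)
    (β := ENNReal.ofReal (EdgeColor.nodeBound n F))
    (fun F' hF' => by rw [hF'.unique hF]) n [] E hE .root EdgeColor.maxDeg_le_card (fun _ => 0)
  simp only [List.nil_prefix, if_true, ENNReal.iSup_zero, add_zero] at h
  refine h.trans (ENNReal.ofReal_le_ofReal ?_)
  have hL : 0 ≤ Real.logb 2 n :=
    div_nonneg (Real.log_natCast_nonneg n) (Real.log_nonneg (by norm_num))
  have h0 : 0 ≤ (EdgeColor.totalWt F : ℝ) / EdgeColor.maxDeg F *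
      ((n : ℝ) / EdgeColor.maxDeg F + Real.logb 2 n) := by positivity
  have h1 : (1 : ℝ) ≤ F.length := by exact_mod_cast hm
  rw [EdgeColor.nodeBound]
  linarith
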